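/- Let $(\Omega,\mathcal K,\mathbb P)$ be a probability space and let $T:\Omega\to\Omega$ be a bijective bi-measurable transformation that preserves $\mathbb P$ and is ergodic. Let $\mathcal F_0\subseteq\mathcal K$ be a $\sigma$-algebra with $\mathcal F_0\subseteq T^{-1}(\mathcal F_0)$, write $\mathbb E_0=\mathbb E(\cdot\mid\mathcal F_0)$, and let $(\mathbb P^\omega)_{\omega\in\Omega}$ be a regular conditional probability on $\mathcal K$ given $\mathcal F_0$, with expectation $\mathbb E^\omega$. Let $X_0$ be a real-valued, $\mathcal F_0$-measurable, square integrable random variable with $\mathbb E X_0=0$, and put $$X_k=X_0\circ T^k,\qquad S_n(t)=\sum_{k=1}^n e^{ikt}X_k,\qquad \mathbf V_n(t)=\frac1{\sqrt n}\bigl[\operatorname{Re}S_n(t),\operatorname{Im}S_n(t)\bigr].$$ Let $t\in(0,2\pi)$ be such that $e^{-2it}$ is not an eigenvalue of $T$, that is, of the operator $f\mapsto f\circ T$ on $L^2(\Omega,\mathcal K,\mathbb P;\mathbb C)$. Assume that $$\sum_{k\ge1}\frac1{k^{3/2}}\bigl\|\mathbb E_0(S_k(t))\bigr\|_2<\infty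 .$$ Then the limit $\sigma_t^2=\lim_{n\to\infty}\mathbb E|S_n(t)|^2/n$ exists and is finite, and there is $\Omega'\subseteq\Omega$ with $\mathbb P(\Omega')=1$ such that, for every $\omega\in\Omega'$ and every bounded continuous $g:\mathbb R^2\to\mathbb R$, $$\mathbb E^\omega\bigl[g(\mathbf V_n(t))\bigr]\to\mathbb E\bigl[g(N_1,N_2)\bigr]\qquad(n\to\infty),$$ where $N_1,N_2$ are independent normal random variables with mean $0$ and variance $\sigma_t^2/2$ (equal to $0$ almost surely if $\sigma_t^2=0$). -/

import Mathlib

open MeasureTheory ProbabilityTheory Filter Topology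
open scoped NNReal BoundedContinuousFunction

/-- The family `κ ω = P^ω` is a regular conditional probability for `P` given the
sub-σ-algebra `m`. -/
structure IsRegularCondProb {Ω : Type*} (m : MeasurableSpace Ω) [mΩ : MeasurableSpace Ω]
    (P : Measure Ω) (κ : Ω → Measure Ω) : Prop where
  isProbabilityMeasure : ∀ ω, IsProbabilityMeasure (κ ω)
  measurable : ∀ A : Set Ω, MeasurableSet[mΩ] A → Measurable[m] (fun ω => κ ω A)
  ae_eq : ∀ A : Set Ω, MeasurableSet[mΩ] A →
    (fun ω => (κ ω).real A) =ᵐ[P] P[A.indicator (fun _ => (1 : ℝ)) | m]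

/-- The operator `f ↦ f ∘ T` on the complex Hilbert space `L²(P)`. -/
noncomputable def koopman {Ω : Type*} [MeasurableSpace Ω] {P : Measure Ω} {T : Ω → Ω}
    (hT : MeasurePreserving T P P) : Module.End ℂ (Lp ℂ 2 P) :=
  (Lp.compMeasurePreservingₗᵢ ℂ T hT).toLinearMap

/-- `S_n(t) = ∑_{k=1}^n e^{ikt} X_k`, where `X_k = X₀ ∘ T^k`. -/
noncomputable def fourierSum {Ω : Type*} (T : Ω → Ω) (X₀ : Ω → ℝ) (t : ℝ) (n : ℕ) (ω : Ω) : ℂ :=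
  ∑ k ∈ Finset.Icc 1 n, Complex.exp (Complex.I * (k : ℂ) * (t : ℂ)) * (X₀ (T^[k] ω) : ℂ)

/-- `V_n(t) = n^{-1/2} (Re S_n(t), Im S_n(t))`. -/
noncomputable def normalizedFourier {Ω : Type*} (T : Ω → Ω) (X₀ : Ω → ℝ) (t : ℝ) (n : ℕ)
    (ω : Ω) : ℝ × ℝ :=
  ((fourierSum T X₀ t n ω).re / √(n : ℝ), (fourierSum T X₀ t n ω).im / √(n : ℝ))

/-! The idea is quenched martingale approximation. Put `c = e^{it}` and `f = X₀`. Since `F₀ ⊆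
T⁻¹F₀`, the σ-algebras `T⁻ᵏF₀` form a filtration, and `S_n(t)` is a twisted sum `∑ c^j f ∘ T^j`,
shifted by one step.

Adding terms in pairs and splitting off the part with vanishing conditional expectation writes a
twisted sum of length `n` as martingales at the scales `2^r` (`ae_eLpNorm_twistSum_le`). These are
built from `v_r = E[∑_{j<2^r} c^j f ∘ T^j | F₀]`. The orthogonality holds under almost every `P^ω`,
so the norm in `L²(P^ω)` is bounded by averages of `E^ω|v_r|²` along orbits. Hopf's maximal
inequality for the positive contraction `g ↦ E[g ∘ T | F₀]` then gives a bound `√n H(ω)`, with `∫ H`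
controlled by the dyadic norm `∑ 2^{-r/2} ‖v_r‖₂` (`exists_maximal_bound`). The hypothesis on `‖E₀
S_k(t)‖₂` makes this norm finite (`summable_dyadic_powSum`).

In this norm `f` is a limit of coboundaries `h - E[c h ∘ T | F₀]` with `h` bounded
(`exists_bounded_twistNorm_sub_lt`). Such a coboundary is a bounded martingale difference `w = c h ∘
T - E[c h ∘ T | F₀]` plus the telescoping term `h - c h ∘ T`. Hence `S_n(t)` is close to a
martingale, both in `L²(P)` and in `L²(P^ω)` (`exists_martingale_approx`).

For the martingale, McLeish's product argument under `P^ω` needs only the limit of the averages of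
the squares of `Re(conj θ · c^k w ∘ T^k)`. As `(Re z)² = (|z|² + Re z²)/2`, Birkhoff's theorem
yields `|θ|² ‖w‖₂²/2`, and the remaining average, twisted by `c² = e^{2it}`, tends to `0` because
`e^{-2it}` is not an eigenvalue. That is why the limit is a pair of independent normals of equal
variance. -/

open scoped ENNReal

/-! ### Regular conditional probabilities and disintegration. -/

namespace IsRegularCondProb

variable {Ω : Type*} {F₀ : MeasurableSpace Ω} [mΩ : MeasurableSpace Ω] {P : Measure Ω}
  {κ : Ω → Measure Ω}

lemma measurable_toMeasure (hκ : IsRegularCondProb F₀ P κ) : Measurable[F₀] κ :=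
  @Measure.measurable_of_measurable_coe Ω Ω mΩ F₀ κ hκ.measurable

/-- A regular conditional probability as a Markov kernel from the sub-σ-algebra. -/
noncomputable def toKernel (hκ : IsRegularCondProb F₀ P κ) : @Kernel Ω Ω F₀ mΩ :=
  @Kernel.mk Ω Ω F₀ mΩ κ hκ.measurable_toMeasure

/-- A regular conditional probability as a kernel for the ambient σ-algebra. -/
noncomputable def toKernelAmbient (hκ : IsRegularCondProb F₀ P κ) (hF₀ : F₀ ≤ mΩ) :
    Kernel Ω Ω := ⟨κ, hκ.measurable_toMeasure.mono hF₀ le_rfl⟩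

/-- The defining property of `κ`, integrated over a set of `F₀`. With `A` the whole space it says
that `P` is the mixture of the `κ ω`; general `A` is needed to identify conditional expectations in
`condExp_ae_eq`. -/
lemma bind_restrict [IsProbabilityMeasure P] (hκ : IsRegularCondProb F₀ P κ) (hF₀ : F₀ ≤ mΩ)
    {A : Set Ω} (hA : MeasurableSet[F₀] A) : (P.restrict A).bind κ = P.restrict A := by
  have hm : Measurable κ := hκ.measurable_toMeasure.mono hF₀ le_rfl
  ext B hB
  rw [Measure.bind_apply hB hm.aemeasurable, Measure.restrict_apply hB]
  have hprob := hκ.isProbabilityMeasure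
  have h1 : ∫ ω in A, (κ ω).real B ∂P = P.real (B ∩ A) := by
    rw [setIntegral_congr_ae (g := P[B.indicator (fun _ => (1 : ℝ)) | F₀]) (hF₀ _ hA)
      ((hκ.ae_eq B hB).mono fun x hx _ => hx),
      setIntegral_condExp hF₀ ((integrable_const _).indicator hB) hA,
      integral_indicator_const _ hB]
    simp [measureReal_restrict_apply hB]
  have h2 : ∫⁻ ω in A, κ ω B ∂P = ENNReal.ofReal (∫ ω in A, (κ ω).real B ∂P) := by
    rw [ofReal_integral_eq_lintegral_ofReal]
    · exact lintegral_congr fun ω => (ofReal_measureReal (measure_ne_top _ _)).symm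
    · refine Integrable.of_bound (C := 1) ?_ (ae_of_all _ fun ω => ?_)
      · exact (((hκ.measurable B hB).mono hF₀ le_rfl).ennreal_toReal).aestronglyMeasurable
      · rw [Real.norm_of_nonneg measureReal_nonneg]; exact measureReal_le_one
    · exact ae_of_all _ fun ω => measureReal_nonneg
  rw [h2, h1, ofReal_measureReal (measure_ne_top _ _)]

lemma bind_eq [IsProbabilityMeasure P] (hκ : IsRegularCondProb F₀ P κ) (hF₀ : F₀ ≤ mΩ) :
    P.bind κ = P := by
  simpa using hκ.bind_restrict hF₀ (@MeasurableSet.univ Ω F₀)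

lemma lintegral_lintegral [IsProbabilityMeasure P] (hκ : IsRegularCondProb F₀ P κ) (hF₀ : F₀ ≤ mΩ)
    {f : Ω → ℝ≥0∞} (hf : Measurable f) : ∫⁻ ω, ∫⁻ x, f x ∂κ ω ∂P = ∫⁻ x, f x ∂P := by
  have hm : Measurable κ := hκ.measurable_toMeasure.mono hF₀ le_rfl
  conv_rhs => rw [← hκ.bind_eq hF₀]
  rw [Measure.lintegral_bind hm.aemeasurable hf.aemeasurable]

lemma measurable_lintegral (hκ : IsRegularCondProb F₀ P κ)
    {f : Ω → ℝ≥0∞} (hf : Measurable f) : Measurable[F₀] fun ω => ∫⁻ x, f x ∂κ ω :=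
  (Measure.measurable_lintegral hf).comp hκ.measurable_toMeasure

/-- This is how ergodic theorems, and identities between versions, that are known only `P`-almost
surely become usable under a fixed `κ ω`. -/
lemma ae_ae [IsProbabilityMeasure P] (hκ : IsRegularCondProb F₀ P κ) (hF₀ : F₀ ≤ mΩ)
    {p : Ω → Prop} (h : ∀ᵐ x ∂P, p x) : ∀ᵐ ω ∂P, ∀ᵐ x ∂κ ω, p x := by
  have hm : Measurable κ := hκ.measurable_toMeasure.mono hF₀ le_rfl
  exact Measure.ae_ae_of_ae_bind hm.aemeasurable (by rwa [hκ.bind_eq hF₀])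

variable {E : Type*} [NormedAddCommGroup E]

lemma ae_memLp [IsProbabilityMeasure P] (hκ : IsRegularCondProb F₀ P κ) (hF₀ : F₀ ≤ mΩ)
    {f : Ω → E} (hfm : StronglyMeasurable f) (hf : MemLp f 2 P) :
    ∀ᵐ ω ∂P, MemLp f 2 (κ ω) := by
  have h : ∫⁻ ω, ∫⁻ x, ‖f x‖ₑ ^ (2 : ℝ) ∂κ ω ∂P ≠ ∞ := by
    rw [hκ.lintegral_lintegral hF₀ (hfm.enorm.pow_const _)]
    have := lintegral_rpow_enorm_lt_top_of_eLpNorm_lt_top (by norm_num) (by norm_num) hf.2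
    simpa using this.ne
  have hm := (hκ.measurable_lintegral (hfm.enorm.pow_const (2 : ℝ))).mono hF₀ le_rfl
  filter_upwards [ae_lt_top hm h] with ω hω
  refine ⟨hfm.aestronglyMeasurable, ?_⟩
  refine (eLpNorm_lt_top_iff_lintegral_rpow_enorm_lt_top (by norm_num) (by norm_num)).2 ?_
  simpa using hω

lemma ae_integrable [IsProbabilityMeasure P] (hκ : IsRegularCondProb F₀ P κ) (hF₀ : F₀ ≤ mΩ)
    {f : Ω → E} (hf : Integrable f P) : ∀ᵐ ω ∂P, Integrable f (κ ω) := by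
  have hb : Measure.bind P (hκ.toKernelAmbient hF₀) = P := hκ.bind_eq hF₀
  exact Measure.ae_integrable_of_integrable_comp (κ := hκ.toKernelAmbient hF₀) (by rwa [hb])

lemma condExp_ae_eq [NormedSpace ℝ E] [CompleteSpace E] [IsProbabilityMeasure P]
    (hκ : IsRegularCondProb F₀ P κ) (hF₀ : F₀ ≤ mΩ)
    {f : Ω → E} (hf : Integrable f P) : P[f | F₀] =ᵐ[P] fun ω => ∫ x, f x ∂κ ω := by
  have hb : Measure.bind P (hκ.toKernelAmbient hF₀) = P := hκ.bind_eq hF₀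
  have hint : Integrable (fun ω => ∫ x, f x ∂κ ω) P :=
    by
    have h : Integrable f ((hκ.toKernelAmbient hF₀ ∘ₖ Kernel.const Unit P) ()) := by
      rwa [← Measure.comp_eq_comp_const_apply, hb]
    have h' := h.integral_comp
    simp only [Kernel.const_apply] at h'
    exact h'
  refine (ae_eq_condExp_of_forall_setIntegral_eq hF₀ hf (fun s _ _ => hint.integrableOn)
    (fun s hs _ => ?_) ?_).symm
  · have hb' : Measure.bind (P.restrict s) (hκ.toKernelAmbient hF₀) = P.restrict s :=
      hκ.bind_restrict hF₀ hs
    conv_rhs => rw [← hb']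
    have h : Integrable f
        ((hκ.toKernelAmbient hF₀ ∘ₖ Kernel.const Unit (P.restrict s)) ()) := by
      rw [← Measure.comp_eq_comp_const_apply, hb']; exact hf.integrableOn
    rw [Measure.comp_eq_comp_const_apply, Kernel.integral_comp h]
    rfl
  -- `f` is only a.e. strongly measurable, so `F₀`-measurability is obtained for the integrals of a
  -- strongly measurable representative.
  · refine ⟨fun ω => ∫ x, hf.1.mk f x ∂κ ω, ?_, ?_⟩
    · exact @StronglyMeasurable.integral_kernel Ω Ω F₀ mΩ hκ.toKernel E _ _ _
        hf.1.stronglyMeasurable_mk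
    · filter_upwards [hκ.ae_ae hF₀ hf.1.ae_eq_mk] with ω hω using integral_congr_ae hω

end IsRegularCondProb

/-! ### Conditional expectation along the filtration generated by the transformation. -/

section CondExpComp

variable {Ω : Type*} {F₀ : MeasurableSpace Ω} [mΩ : MeasurableSpace Ω] {P : Measure Ω}
  [IsProbabilityMeasure P] {S : Ω → Ω}
  {E : Type*} [NormedAddCommGroup E] [NormedSpace ℝ E] [CompleteSpace E]

lemma comap_le_of_measurable (hF₀ : F₀ ≤ mΩ) (hS : Measurable S) : F₀.comap S ≤ mΩ :=
  (MeasurableSpace.comap_mono hF₀).trans hS.comap_le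

/-- Conditional expectation commutes with a measure preserving change of variables. -/
lemma condExp_comp_comap (hF₀ : F₀ ≤ mΩ) (hS : MeasurePreserving S P P)
    {Y : Ω → E} (hY : Integrable Y P) :
    P[Y ∘ S | F₀.comap S] =ᵐ[P] P[Y | F₀] ∘ S := by
  refine (ae_eq_condExp_of_forall_setIntegral_eq (comap_le_of_measurable hF₀ hS.measurable)
    (hS.integrable_comp_of_integrable hY)
    (fun s _ _ => (hS.integrable_comp_of_integrable integrable_condExp).integrableOn) ?_ ?_).symm
  · rintro s ⟨B, hB, rfl⟩ -
    have hBm := hF₀ _ hB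
    have key : ∀ f : Ω → E, Integrable f P →
        ∫ x in S ⁻¹' B, f (S x) ∂P = ∫ x in B, f x ∂P := by
      intro f hf
      have hmp := hS.restrict_preimage hBm
      conv_rhs => rw [← hmp.map_eq]
      rw [integral_map hS.measurable.aemeasurable]
      rw [hmp.map_eq]; exact hf.1.restrict
    simp only [Function.comp_apply]
    rw [key _ integrable_condExp, key _ hY, setIntegral_condExp hF₀ hY hB]
  · exact ((stronglyMeasurable_condExp (m := F₀) (f := Y) (μ := P)).comp_measurable
      (@comap_measurable Ω Ω F₀ S)).aestronglyMeasurable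

/-- The inner conditional expectation is one given `F₀.comap S`, which contains `F₀`, so the tower
property applies. This makes the operators `g ↦ E[g ∘ S^n | F₀]` a semigroup. -/
lemma condExp_comp_condExp (hF₀ : F₀ ≤ mΩ) (hS : MeasurePreserving S P P)
    (hSF : F₀ ≤ F₀.comap S) {Y : Ω → E} (hY : Integrable Y P) :
    P[P[Y | F₀] ∘ S | F₀] =ᵐ[P] P[Y ∘ S | F₀] :=
  (condExp_congr_ae (condExp_comp_comap hF₀ hS hY).symm).trans
    (condExp_condExp_of_le hSF (comap_le_of_measurable hF₀ hS.measurable))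

/-- A function of the past is conditionally orthogonal to the image by `S` of a function with
vanishing conditional expectation. -/
lemma condExp_mul_comp_eq_zero (hF₀ : F₀ ≤ mΩ) (hS : MeasurePreserving S P P)
    (hSF : F₀ ≤ F₀.comap S) {g Y : Ω → ℂ} (hg : StronglyMeasurable[F₀.comap S] g)
    (hY : Integrable Y P) (hY0 : P[Y | F₀] =ᵐ[P] 0)
    (hgY : Integrable (fun ω => g ω * Y (S ω)) P) :
    P[fun ω => g ω * Y (S ω) | F₀] =ᵐ[P] 0 := by
  have hle := comap_le_of_measurable hF₀ hS.measurable
  have h1 : P[fun ω => g ω * Y (S ω) | F₀.comap S] =ᵐ[P]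
      fun ω => g ω * (P[Y ∘ S | F₀.comap S]) ω :=
    condExp_bilin_of_stronglyMeasurable_left (ContinuousLinearMap.mul ℝ ℂ) hg hgY
      (hS.integrable_comp_of_integrable hY)
  have h2 : P[fun ω => g ω * Y (S ω) | F₀.comap S] =ᵐ[P] 0 := by
    filter_upwards [h1, condExp_comp_comap hF₀ hS hY,
      hS.quasiMeasurePreserving.ae_eq_comp hY0] with ω h1 h2 h3
    rw [h1, h2, h3]; simp
  refine (condExp_condExp_of_le hSF hle).symm.trans ((condExp_congr_ae h2).trans ?_)
  rw [condExp_zero]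

end CondExpComp

/-! ### Orthogonality under the conditional measures. -/

namespace IsRegularCondProb

variable {Ω : Type*} {F₀ : MeasurableSpace Ω} [mΩ : MeasurableSpace Ω] {P : Measure Ω}
  [IsProbabilityMeasure P] {S : Ω → Ω} {κ : Ω → Measure Ω}

lemma ae_integral_mul_comp_eq_zero (hκ : IsRegularCondProb F₀ P κ) (hF₀ : F₀ ≤ mΩ)
    (hS : MeasurePreserving S P P)
    (hSF : F₀ ≤ F₀.comap S) {g Y : Ω → ℂ} (hg : StronglyMeasurable[F₀.comap S] g)
    (hY : Integrable Y P) (hY0 : P[Y | F₀] =ᵐ[P] 0)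
    (hgY : Integrable (fun ω => g ω * Y (S ω)) P) :
    ∀ᵐ ω ∂P, ∫ x, g x * Y (S x) ∂κ ω = 0 := by
  filter_upwards [hκ.condExp_ae_eq hF₀ hgY, condExp_mul_comp_eq_zero hF₀ hS hSF hg hY hY0 hgY]
    with ω h1 h2
  rw [← h1, h2]; rfl

end IsRegularCondProb

lemma lintegral_enorm_add_sq_of_integral_eq_zero {Ω : Type*} [MeasurableSpace Ω] {μ : Measure Ω}
    {f g : Ω → ℂ} (hf : MemLp f 2 μ) (hg : MemLp g 2 μ)
    (h : ∫ x, (starRingEnd ℂ) (f x) * g x ∂μ = 0) :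
    ∫⁻ x, ‖f x + g x‖ₑ ^ 2 ∂μ = ∫⁻ x, ‖f x‖ₑ ^ 2 ∂μ + ∫⁻ x, ‖g x‖ₑ ^ 2 ∂μ := by
  have key : ∀ u : Ω → ℂ, MemLp u 2 μ →
      ∫⁻ x, ‖u x‖ₑ ^ 2 ∂μ = ENNReal.ofReal (∫ x, ‖u x‖ ^ 2 ∂μ) := by
    intro u hu
    rw [ofReal_integral_eq_lintegral_ofReal ((memLp_two_iff_integrable_sq_norm hu.1).1 hu)
      (ae_of_all _ fun x => by positivity)]
    refine lintegral_congr fun x => ?_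
    rw [← ofReal_norm, ENNReal.ofReal_pow (norm_nonneg _)]
  have hif := (memLp_two_iff_integrable_sq_norm hf.1).1 hf
  have hig := (memLp_two_iff_integrable_sq_norm hg.1).1 hg
  have hfg : Integrable (fun x => (starRingEnd ℂ) (f x) * g x) μ := by
    have := MemLp.integrable_mul (p := 2) (q := 2) hf.star hg
    exact this
  have hadd : MemLp (fun x => f x + g x) 2 μ := hf.add hg
  rw [key _ hadd, key _ hf, key _ hg, ← ENNReal.ofReal_add
    (integral_nonneg fun x => by positivity) (integral_nonneg fun x => by positivity),
    ← integral_add hif hig]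
  congr 1
  have h3 : ∫ x, (((starRingEnd ℂ) (f x) * g x).re) ∂μ = 0 := by
    have := integral_re hfg
    simp only [RCLike.re_to_complex] at this
    rw [this, h]; simp
  have h4 : ∀ x, ‖f x + g x‖ ^ 2 = (‖f x‖ ^ 2 + ‖g x‖ ^ 2)
      + 2 * ((starRingEnd ℂ) (f x) * g x).re := by
    intro x
    rw [← Complex.normSq_eq_norm_sq, ← Complex.normSq_eq_norm_sq, ← Complex.normSq_eq_norm_sq,
      Complex.normSq_add]
    simp [Complex.mul_re]
  simp only [h4]
  have h5 : Integrable (fun x => ‖f x‖ ^ 2 + ‖g x‖ ^ 2) μ := hif.add hig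
  have h6 : Integrable (fun x => ((starRingEnd ℂ) (f x) * g x).re) μ := hfg.re
  rw [integral_add h5 (h6.const_mul 2), integral_const_mul, h3]
  simp

namespace IsRegularCondProb

variable {Ω : Type*} {F₀ : MeasurableSpace Ω} [mΩ : MeasurableSpace Ω] {P : Measure Ω}
  [IsProbabilityMeasure P] {S : Ω → Ω} {κ : Ω → Measure Ω}

/-- Conditional Pythagoras identity for a function of the past and the image of a function
with vanishing conditional expectation. -/
lemma ae_lintegral_enorm_add_sq (hκ : IsRegularCondProb F₀ P κ) (hF₀ : F₀ ≤ mΩ)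
    (hS : MeasurePreserving S P P) (hSF : F₀ ≤ F₀.comap S) {Y w : Ω → ℂ}
    (hY : StronglyMeasurable[F₀.comap S] Y) (hY2 : MemLp Y 2 P)
    (hw : StronglyMeasurable w) (hw2 : MemLp w 2 P) (hw0 : P[w | F₀] =ᵐ[P] 0) (c : ℂ) :
    ∀ᵐ ω ∂P, ∫⁻ x, ‖Y x + c * w (S x)‖ₑ ^ 2 ∂κ ω =
      ∫⁻ x, ‖Y x‖ₑ ^ 2 ∂κ ω + ∫⁻ x, ‖c * w (S x)‖ₑ ^ 2 ∂κ ω := by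
  have hle := comap_le_of_measurable hF₀ hS.measurable
  have hwS : MemLp (fun x => c * w (S x)) 2 P := (hw2.comp_measurePreserving hS).const_mul c
  have hwm : StronglyMeasurable fun x => c * w (S x) :=
    (hw.comp_measurable hS.measurable).const_mul c
  have hint : Integrable (fun ω => ((starRingEnd ℂ) (Y ω) * c) * w (S ω)) P := by
    have h := MemLp.integrable_mul (p := 2) (q := 2) hY2.star hwS
    refine h.congr (ae_of_all _ fun x => ?_)
    simp [mul_assoc]
  have hconj : StronglyMeasurable[F₀.comap S] fun ω => (starRingEnd ℂ) (Y ω) * c :=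
    (continuous_star.comp_stronglyMeasurable hY).mul_const c
  filter_upwards [hκ.ae_memLp hF₀ (hY.mono hle) hY2, hκ.ae_memLp hF₀ hwm hwS,
    hκ.ae_integral_mul_comp_eq_zero hF₀ hS hSF hconj (hw2.integrable (by norm_num)) hw0 hint]
    with ω h1 h2 h3
  refine lintegral_enorm_add_sq_of_integral_eq_zero h1 h2 ?_
  rw [← h3]
  congr 1 with x
  ring

end IsRegularCondProb

/-! ### Algebra and measurability of twisted sums. -/

/-- `∑_{j<n} c^j f ∘ S^j`. -/
noncomputable def twistSum {Ω : Type*} (S : Ω → Ω) (c : ℂ) (n : ℕ) (f : Ω → ℂ) (ω : Ω) : ℂ :=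
  ∑ j ∈ Finset.range n, c ^ j * f (S^[j] ω)

section TwistSum

variable {Ω : Type*} {S : Ω → Ω} {c : ℂ}

lemma twistSum_zero (f : Ω → ℂ) (ω : Ω) : twistSum S c 0 f ω = 0 := by simp [twistSum]

lemma twistSum_succ (n : ℕ) (f : Ω → ℂ) (ω : Ω) :
    twistSum S c (n + 1) f ω = twistSum S c n f ω + c ^ n * f (S^[n] ω) := by
  simp [twistSum, Finset.sum_range_succ]

lemma twistSum_one (f : Ω → ℂ) (ω : Ω) : twistSum S c 1 f ω = f ω := by simp [twistSum]

lemma twistSum_add_fun (n : ℕ) (f g : Ω → ℂ) (ω : Ω) :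
    twistSum S c n (fun x => f x + g x) ω = twistSum S c n f ω + twistSum S c n g ω := by
  simp [twistSum, mul_add, Finset.sum_add_distrib]

lemma twistSum_sub_fun (n : ℕ) (f g : Ω → ℂ) (ω : Ω) :
    twistSum S c n (fun x => f x - g x) ω = twistSum S c n f ω - twistSum S c n g ω := by
  simp [twistSum, mul_sub, Finset.sum_sub_distrib]

lemma twistSum_add (m n : ℕ) (f : Ω → ℂ) (ω : Ω) :
    twistSum S c (m + n) f ω = twistSum S c m f ω + c ^ m * twistSum S c n f (S^[m] ω) := by
  simp only [twistSum, Finset.sum_range_add, Finset.mul_sum]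
  congr 1
  refine Finset.sum_congr rfl fun j _ => ?_
  rw [pow_add, mul_assoc, add_comm m j, Function.iterate_add_apply]

/-- Pairing consecutive terms gives again a twisted sum, for `S^[2]` and `c ^ 2`. This
self-similarity drives the dyadic recursion. -/
lemma twistSum_two_mul (M : ℕ) (f : Ω → ℂ) (ω : Ω) :
    twistSum S c (2 * M) f ω = twistSum S^[2] (c ^ 2) M (fun x => f x + c * f (S x)) ω := by
  induction M with
  | zero => simp [twistSum]
  | succ M ih =>
    rw [twistSum_succ, ← ih, show 2 * (M + 1) = 2 * M + 1 + 1 by ring, twistSum_succ,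
      twistSum_succ, ← Function.iterate_mul, Function.iterate_succ_apply']
    ring

variable {F₀ : MeasurableSpace Ω}

lemma comap_iterate_mono (hSF : F₀ ≤ F₀.comap S) {j m : ℕ} (h : j ≤ m) :
    F₀.comap S^[j] ≤ F₀.comap S^[m] := by
  induction m, h using Nat.le_induction with
  | base => exact le_rfl
  | succ m _ ih =>
    refine ih.trans ?_
    rw [Function.iterate_succ', ← MeasurableSpace.comap_comp]
    exact MeasurableSpace.comap_mono hSF

lemma le_comap_iterate (hSF : F₀ ≤ F₀.comap S) (m : ℕ) : F₀ ≤ F₀.comap S^[m] := by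
  simpa using comap_iterate_mono hSF (Nat.zero_le m)

/-- Adaptedness: the last term has index `n - 1` and `w` looks one step ahead, so the sum of `n`
terms belongs to the past of `w ∘ S^[n]`. -/
lemma stronglyMeasurable_twistSum (hSF : F₀ ≤ F₀.comap S) {w : Ω → ℂ}
    (hw : StronglyMeasurable[F₀.comap S] w) (n : ℕ) :
    StronglyMeasurable[F₀.comap S^[n]] (twistSum S c n w) := by
  refine Finset.stronglyMeasurable_fun_sum _ fun j hj => ?_
  have h1 : StronglyMeasurable[(F₀.comap S).comap S^[j]] fun ω => w (S^[j] ω) :=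
    hw.comp_measurable (@comap_measurable Ω Ω (F₀.comap S) S^[j])
  rw [MeasurableSpace.comap_comp, ← Function.iterate_succ'] at h1
  exact (h1.mono (comap_iterate_mono hSF (Finset.mem_range.1 hj))).const_mul _

variable [mΩ : MeasurableSpace Ω]

lemma StronglyMeasurable.twistSum_of_measurable (hS : Measurable S) {f : Ω → ℂ}
    (hf : StronglyMeasurable f) (n : ℕ) : StronglyMeasurable (twistSum S c n f) :=
  Finset.stronglyMeasurable_fun_sum _ fun j _ =>
    (hf.comp_measurable (hS.iterate j)).const_mul _

lemma MemLp.twistSum {P : Measure Ω} (hS : MeasurePreserving S P P) {f : Ω → ℂ}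
    (hf : MemLp f 2 P) (n : ℕ) : MemLp (twistSum S c n f) 2 P :=
  memLp_finsetSum _ fun j _ =>
    (hf.comp_measurePreserving (hS.iterate j)).const_mul _

lemma twistSum_congr_ae {P : Measure Ω} (hS : MeasurePreserving S P P) {f g : Ω → ℂ}
    (h : f =ᵐ[P] g) (n : ℕ) : twistSum S c n f =ᵐ[P] twistSum S c n g := by
  have : ∀ᵐ ω ∂P, ∀ j, f (S^[j] ω) = g (S^[j] ω) :=
    ae_all_iff.2 fun j => (hS.iterate j).quasiMeasurePreserving.ae_eq_comp h
  filter_upwards [this] with ω hω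
  simp [twistSum, hω]

end TwistSum

lemma eLpNorm_two_eq {Ω : Type*} [MeasurableSpace Ω] (μ : Measure Ω) (f : Ω → ℂ) :
    eLpNorm f 2 μ = (∫⁻ x, ‖f x‖ₑ ^ 2 ∂μ) ^ (1 / 2 : ℝ) := by
  rw [eLpNorm_eq_lintegral_rpow_enorm_toReal (by norm_num) (by norm_num)]
  simp

lemma eLpNorm_two_sq {Ω : Type*} [MeasurableSpace Ω] (μ : Measure Ω) (f : Ω → ℂ) :
    eLpNorm f 2 μ ^ 2 = ∫⁻ x, ‖f x‖ₑ ^ 2 ∂μ := by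
  rw [eLpNorm_two_eq, ← ENNReal.rpow_natCast, ← ENNReal.rpow_mul]
  simp

/-! ### Conditional second moments and the halving step. -/

namespace IsRegularCondProb

variable {Ω : Type*} {F₀ : MeasurableSpace Ω} [mΩ : MeasurableSpace Ω] {P : Measure Ω}
  [IsProbabilityMeasure P] {S : Ω → Ω} {κ : Ω → Measure Ω}

/-- Conditional second moment of a sum of stationary twisted martingale differences. -/
lemma ae_lintegral_twistSum_sq (hκ : IsRegularCondProb F₀ P κ) (hF₀ : F₀ ≤ mΩ)
    (hS : MeasurePreserving S P P) (hSF : F₀ ≤ F₀.comap S) {w : Ω → ℂ}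
    (hw : StronglyMeasurable[F₀.comap S] w) (hw2 : MemLp w 2 P) (hw0 : P[w | F₀] =ᵐ[P] 0)
    {c : ℂ} (hc : ‖c‖ = 1) :
    ∀ᵐ ω ∂P, ∀ M, ∫⁻ x, ‖twistSum S c M w x‖ₑ ^ 2 ∂κ ω =
      ∑ i ∈ Finset.range M, ∫⁻ x, ‖w (S^[i] x)‖ₑ ^ 2 ∂κ ω := by
  have hle := comap_le_of_measurable hF₀ hS.measurable
  have h : ∀ᵐ ω ∂P, ∀ M, ∫⁻ x, ‖twistSum S c M w x + c ^ M * w (S^[M] x)‖ₑ ^ 2 ∂κ ω =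
      ∫⁻ x, ‖twistSum S c M w x‖ₑ ^ 2 ∂κ ω + ∫⁻ x, ‖c ^ M * w (S^[M] x)‖ₑ ^ 2 ∂κ ω :=
    ae_all_iff.2 fun M => hκ.ae_lintegral_enorm_add_sq hF₀ (hS.iterate M)
      (le_comap_iterate hSF M) (stronglyMeasurable_twistSum hSF hw M)
      (MemLp.twistSum hS hw2 M) (hw.mono hle) hw2 hw0 _
  have hc' : ‖c‖ₑ = 1 := by simp [← ofReal_norm, hc]
  filter_upwards [h] with ω hω M
  induction M with
  | zero => simp [twistSum_zero]
  | succ M ih =>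
    simp only [twistSum_succ, Finset.sum_range_succ]
    rw [hω M, ih]
    simp [enorm_mul, hc']

/-- By the conditional Pythagoras identity, `Y ∘ R` is the orthogonal sum, under almost every `κ ω`,
of `P[Y | F₀] ∘ R` and the centred part. -/
lemma ae_lintegral_sub_condExp_le (hκ : IsRegularCondProb F₀ P κ) (hF₀ : F₀ ≤ mΩ)
    {R : Ω → Ω} (hR : MeasurePreserving R P P) (hRF : F₀ ≤ F₀.comap R) {Y : Ω → ℂ}
    (hY : StronglyMeasurable Y) (hY2 : MemLp Y 2 P) :
    ∀ᵐ ω ∂P, ∫⁻ x, ‖Y (R x) - (P[Y | F₀]) (R x)‖ₑ ^ 2 ∂κ ω ≤ ∫⁻ x, ‖Y (R x)‖ₑ ^ 2 ∂κ ω := by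
  have he : MemLp (P[Y | F₀]) 2 P := hY2.condExp (by norm_num)
  have hem : StronglyMeasurable[F₀] (P[Y | F₀]) := stronglyMeasurable_condExp
  have hw0 : P[fun x => Y x - (P[Y | F₀]) x | F₀] =ᵐ[P] 0 := by
    have hYi : Integrable Y P := hY2.integrable (by norm_num)
    refine (condExp_sub hYi integrable_condExp F₀).trans ?_
    rw [condExp_of_stronglyMeasurable hF₀ hem integrable_condExp]
    simp
  have := hκ.ae_lintegral_enorm_add_sq hF₀ hR hRF (Y := (P[Y | F₀]) ∘ R)
    (hem.comp_measurable (@comap_measurable Ω Ω F₀ R)) (he.comp_measurePreserving hR)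
    (hY.sub (hem.mono hF₀)) (hY2.sub he) hw0 1
  filter_upwards [this] with ω hω
  simp only [Function.comp_apply, one_mul, Pi.sub_apply, add_sub_cancel] at hω
  rw [hω]
  exact le_add_self

/-- One halving step of the dyadic decomposition of a twisted sum. -/
lemma ae_eLpNorm_twistSum_le_halve (hκ : IsRegularCondProb F₀ P κ) (hF₀ : F₀ ≤ mΩ)
    (hS : MeasurePreserving S P P) (hSF : F₀ ≤ F₀.comap S) {v v' : Ω → ℂ}
    (hv : StronglyMeasurable[F₀] v) (hv2 : MemLp v 2 P) {c : ℂ} (hc : ‖c‖ = 1)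
    (hv' : v' =ᵐ[P] fun x => v x + (P[fun y => c * v (S y) | F₀]) x) :
    ∀ᵐ ω ∂P, ∀ N, eLpNorm (twistSum S c N v) 2 (κ ω) ≤
      eLpNorm (twistSum S^[2] (c ^ 2) (N / 2) v') 2 (κ ω) +
      2 * (∑ j ∈ Finset.range N, ∫⁻ x, ‖v (S^[j] x)‖ₑ ^ 2 ∂κ ω) ^ (1 / 2 : ℝ) := by
  have hle := comap_le_of_measurable hF₀ hS.measurable
  have hS2 : MeasurePreserving S^[2] P P := hS.iterate 2
  have hc' : ‖c‖ₑ = 1 := by simp [← ofReal_norm, hc]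
  have hc2 : ‖c ^ 2‖ = 1 := by simp [hc]
  set Y : Ω → ℂ := fun y => c * v (S y) with hYdef
  have hYm1 : StronglyMeasurable[F₀.comap S] Y :=
    (hv.comp_measurable (@comap_measurable Ω Ω F₀ S)).const_mul c
  have hYm : StronglyMeasurable Y := hYm1.mono hle
  have hY2 : MemLp Y 2 P := (hv2.comp_measurePreserving hS).const_mul c
  set e := P[Y | F₀] with hedef
  have hem : StronglyMeasurable[F₀] e := stronglyMeasurable_condExp
  have he2 : MemLp e 2 P := hY2.condExp (by norm_num)
  set w : Ω → ℂ := fun x => Y x - e x with hwdef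
  have hw0 : P[w | F₀] =ᵐ[P] 0 := by
    have hYi : Integrable Y P := hY2.integrable (by norm_num)
    refine (condExp_sub hYi integrable_condExp F₀).trans ?_
    rw [condExp_of_stronglyMeasurable hF₀ hem integrable_condExp]
    simp [hedef]
  have hw2 : MemLp w 2 P := hY2.sub he2
  have hwm : StronglyMeasurable[F₀.comap S] w := hYm1.sub (hem.mono hSF)
  have hwm2 : StronglyMeasurable[F₀.comap S^[2]] w :=
    hwm.mono (by simpa using comap_iterate_mono hSF (show 1 ≤ 2 by norm_num))
  have h1 := hκ.ae_lintegral_twistSum_sq hF₀ hS2 (le_comap_iterate hSF 2) hwm2 hw2 hw0 hc2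
  have h2 : ∀ᵐ ω ∂P, ∀ i, ∫⁻ x, ‖w ((S^[2])^[i] x)‖ₑ ^ 2 ∂κ ω ≤
      ∫⁻ x, ‖v (S^[2 * i + 1] x)‖ₑ ^ 2 ∂κ ω := by
    refine ae_all_iff.2 fun i => ?_
    have hRF : F₀ ≤ F₀.comap (S^[2])^[i] := by
      rw [← Function.iterate_mul]; exact le_comap_iterate hSF _
    filter_upwards [hκ.ae_lintegral_sub_condExp_le hF₀ (hS2.iterate i) hRF hYm hY2] with ω hω
    refine hω.trans (le_of_eq (lintegral_congr fun x => ?_))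
    rw [hYdef, ← Function.iterate_mul, Function.iterate_succ_apply']
    simp [enorm_mul, hc']
  have h3 : ∀ᵐ ω ∂P, ∀ M, twistSum S^[2] (c ^ 2) M v' =ᵐ[κ ω]
      twistSum S^[2] (c ^ 2) M (fun x => v x + e x) :=
    ae_all_iff.2 fun M => hκ.ae_ae hF₀ (twistSum_congr_ae hS2 hv' M)
  filter_upwards [h1, h2, h3] with ω h1 h2 h3 N
  set q := ∑ j ∈ Finset.range N, ∫⁻ x, ‖v (S^[j] x)‖ₑ ^ 2 ∂κ ω with hq
  have hmeas : ∀ (R : Ω → Ω), Measurable R → ∀ (a : ℂ) (u : Ω → ℂ), StronglyMeasurable u → ∀ M,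
      AEStronglyMeasurable (twistSum R a M u) (κ ω) := fun R hR a u hu M =>
    (StronglyMeasurable.twistSum_of_measurable hR hu M).aestronglyMeasurable
  -- For odd `N` the pairing leaves out the last term, which is one of the summands of `q`.
  have hodd : eLpNorm (fun x => twistSum S c N v x - twistSum S c (2 * (N / 2)) v x) 2 (κ ω)
      ≤ q ^ (1 / 2 : ℝ) := by
    rcases Nat.even_or_odd' N with ⟨M, rfl | rfl⟩
    · simp
    · have : (2 * M + 1) / 2 = M := by omega
      rw [this, eLpNorm_two_eq]
      refine ENNReal.rpow_le_rpow ?_ (by norm_num)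
      simp only [twistSum_succ, add_sub_cancel_left]
      rw [hq, Finset.sum_range_succ]
      refine le_add_left (le_of_eq (lintegral_congr fun x => ?_))
      simp [enorm_mul, hc']
  -- The martingale differences are centred versions of the odd-indexed terms `v ∘ S^[2 * i + 1]`,
  -- so their second moments add up to at most `q`.
  have hmart : eLpNorm (twistSum S^[2] (c ^ 2) (N / 2) w) 2 (κ ω) ≤ q ^ (1 / 2 : ℝ) := by
    rw [eLpNorm_two_eq]
    refine ENNReal.rpow_le_rpow ?_ (by norm_num)
    rw [h1]
    refine (Finset.sum_le_sum fun i _ => h2 i).trans ?_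
    have hinj : Set.InjOn (fun i => 2 * i + 1) (Finset.range (N / 2) : Set ℕ) := by
      intro a _ b _ h; simpa using h
    rw [← Finset.sum_image (f := fun j => ∫⁻ x, ‖v (S^[j] x)‖ₑ ^ 2 ∂κ ω) hinj]
    refine Finset.sum_le_sum_of_subset fun j hj => ?_
    simp only [Finset.mem_image, Finset.mem_range] at hj ⊢
    omega
  -- Each pair `v + c v ∘ S` equals `(v + e) + w`: a new function of the past plus a martingale
  -- difference for `S^[2]`.
  have hsplit : twistSum S c N v = fun x => (twistSum S^[2] (c ^ 2) (N / 2) (fun x => v x + e x) x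
      + twistSum S^[2] (c ^ 2) (N / 2) w x) +
      (twistSum S c N v x - twistSum S c (2 * (N / 2)) v x) := by
    ext x
    rw [← twistSum_add_fun, twistSum_two_mul]
    have : (fun x => v x + e x + w x) = fun x => v x + c * v (S x) := by
      ext x; simp [hwdef, hYdef, add_assoc]
    rw [this]; ring
  have hvm := hv.mono hF₀
  have hm1 := hmeas _ hS2.measurable (c ^ 2) _ (hvm.add (hem.mono hF₀)) (N / 2)
  have hm2 := hmeas _ hS2.measurable (c ^ 2) _ (hwm.mono hle) (N / 2)
  have hm3 := (hmeas _ hS.measurable c _ hvm N).sub (hmeas _ hS.measurable c _ hvm (2 * (N / 2)))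
  rw [hsplit]
  refine (eLpNorm_add_le (hm1.add hm2) hm3 (by norm_num)).trans ?_
  rw [two_mul (q ^ (1 / 2 : ℝ)), ← add_assoc]
  refine add_le_add ?_ hodd
  refine (eLpNorm_add_le hm1 hm2 (by norm_num)).trans ?_
  exact add_le_add (eLpNorm_congr_ae (h3 _).symm).le hmart

end IsRegularCondProb

/-! ### Dyadic martingale decomposition of a twisted sum. -/

section Dyadic

variable {Ω : Type*} (F₀ : MeasurableSpace Ω) [mΩ : MeasurableSpace Ω] (P : Measure Ω)

/-- The conditional expectation of a twisted sum of length `2 ^ r`. -/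
noncomputable def dyadicCondExp (S : Ω → Ω) (c : ℂ) (f : Ω → ℂ) (r : ℕ) : Ω → ℂ :=
  P[twistSum S c (2 ^ r) f | F₀]

variable {F₀} {P} {S : Ω → Ω} {c : ℂ} {f : Ω → ℂ}

lemma stronglyMeasurable_dyadicCondExp (r : ℕ) :
    StronglyMeasurable[F₀] (dyadicCondExp F₀ P S c f r) := stronglyMeasurable_condExp

lemma memLp_dyadicCondExp (hS : MeasurePreserving S P P) (hf2 : MemLp f 2 P) (r : ℕ) :
    MemLp (dyadicCondExp F₀ P S c f r) 2 P :=
  (MemLp.twistSum hS hf2 _).condExp (by norm_num)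

variable [IsProbabilityMeasure P]

lemma condExp_twistSum_add (hF₀ : F₀ ≤ mΩ) (hS : MeasurePreserving S P P)
    (hSF : F₀ ≤ F₀.comap S) (hf2 : MemLp f 2 P) (m n : ℕ) :
    P[twistSum S c (m + n) f | F₀] =ᵐ[P] fun x => (P[twistSum S c m f | F₀]) x +
      (P[fun y => c ^ m * (P[twistSum S c n f | F₀]) (S^[m] y) | F₀]) x := by
  have h2 := (MemLp.twistSum (c := c) hS hf2 n).integrable (by norm_num)
  have h1 : P[P[c ^ m • twistSum S c n f | F₀] ∘ S^[m] | F₀] =ᵐ[P]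
      P[(c ^ m • twistSum S c n f) ∘ S^[m] | F₀] :=
    condExp_comp_condExp hF₀ (hS.iterate m) (le_comap_iterate hSF _) (h2.smul _)
  have h3 : P[c ^ m • twistSum S c n f | F₀] ∘ S^[m] =ᵐ[P]
      fun y => c ^ m * (P[twistSum S c n f | F₀]) (S^[m] y) :=
    (hS.iterate m).quasiMeasurePreserving.ae_eq_comp (condExp_smul (c ^ m) _ F₀)
  have h4 : twistSum S c (m + n) f = twistSum S c m f + (c ^ m • twistSum S c n f) ∘ S^[m] := by
    ext x; simp [twistSum_add]
  have h5 := condExp_add ((MemLp.twistSum (c := c) hS hf2 m).integrable (by norm_num))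
    ((hS.iterate m).integrable_comp_of_integrable (h2.smul (c ^ m))) F₀
  rw [h4]
  filter_upwards [h5, h1, condExp_congr_ae (m := F₀) h3] with x h5 h1 h3
  rw [h5, Pi.add_apply, ← h1, h3]

/-- This is the relation between `v` and `v'` in the halving step, for the transformation `S^[2 ^
r]` and the twist `c ^ 2 ^ r`. -/
lemma dyadicCondExp_succ (hF₀ : F₀ ≤ mΩ) (hS : MeasurePreserving S P P)
    (hSF : F₀ ≤ F₀.comap S) (hf2 : MemLp f 2 P) (r : ℕ) :
    dyadicCondExp F₀ P S c f (r + 1) =ᵐ[P] fun x => dyadicCondExp F₀ P S c f r x +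
      (P[fun y => c ^ 2 ^ r * dyadicCondExp F₀ P S c f r (S^[2 ^ r] y) | F₀]) x := by
  have := condExp_twistSum_add (c := c) hF₀ hS hSF hf2 (2 ^ r) (2 ^ r)
  rwa [← two_mul, ← pow_succ'] at this

lemma dyadicCondExp_zero (hF₀ : F₀ ≤ mΩ) (hf : StronglyMeasurable[F₀] f)
    (hf2 : MemLp f 2 P) : dyadicCondExp F₀ P S c f 0 = f := by
  have : twistSum S c (2 ^ 0) f = f := by ext x; simp [twistSum]
  rw [dyadicCondExp, this,
    condExp_of_stronglyMeasurable hF₀ hf (hf2.integrable (by norm_num))]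

/-- The halving step is iterated; scale `r` costs twice the root of the second moments of `n / 2 ^
r` terms. -/
lemma IsRegularCondProb.ae_eLpNorm_twistSum_le {κ : Ω → Measure Ω}
    (hκ : IsRegularCondProb F₀ P κ) (hF₀ : F₀ ≤ mΩ)
    (hS : MeasurePreserving S P P) (hSF : F₀ ≤ F₀.comap S)
    (hf : StronglyMeasurable[F₀] f) (hf2 : MemLp f 2 P) (hc : ‖c‖ = 1) :
    ∀ᵐ ω ∂P, ∀ n, eLpNorm (twistSum S c n f) 2 (κ ω) ≤
      2 * ∑ r ∈ Finset.range n, (∑ j ∈ Finset.range (n / 2 ^ r),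
        ∫⁻ x, ‖dyadicCondExp F₀ P S c f r ((S^[2 ^ r])^[j] x)‖ₑ ^ 2 ∂κ ω) ^ (1 / 2 : ℝ) := by
  have hstep := ae_all_iff.2 fun r =>
    hκ.ae_eLpNorm_twistSum_le_halve hF₀ (hS.iterate (2 ^ r)) (le_comap_iterate hSF _)
      (stronglyMeasurable_dyadicCondExp (c := c) (f := f) r) (memLp_dyadicCondExp hS hf2 r)
      (c := c ^ 2 ^ r) (by simp [hc]) (dyadicCondExp_succ hF₀ hS hSF hf2 r)
  filter_upwards [hstep] with ω hω n
  have key : ∀ R, eLpNorm (twistSum S c n f) 2 (κ ω) ≤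
      eLpNorm (twistSum S^[2 ^ R] (c ^ 2 ^ R) (n / 2 ^ R) (dyadicCondExp F₀ P S c f R)) 2 (κ ω) +
      2 * ∑ r ∈ Finset.range R, (∑ j ∈ Finset.range (n / 2 ^ r),
        ∫⁻ x, ‖dyadicCondExp F₀ P S c f r ((S^[2 ^ r])^[j] x)‖ₑ ^ 2 ∂κ ω) ^ (1 / 2 : ℝ) := by
    intro R
    induction R with
    | zero =>
      rw [dyadicCondExp_zero hF₀ hf hf2]
      simp
    | succ R ih =>
      refine ih.trans ((add_le_add_left (hω R (n / 2 ^ R)) _).trans (le_of_eq ?_))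
      rw [← Function.iterate_mul, ← pow_mul, ← pow_succ, Nat.div_div_eq_div_mul, ← pow_succ,
        Finset.sum_range_succ]
      ring
  -- After `n` halvings no term is left, so the bound has no remainder.
  have h0 : n / 2 ^ n = 0 := Nat.div_eq_of_lt Nat.lt_two_pow_self
  refine (key n).trans (le_of_eq ?_)
  rw [h0]
  have : twistSum S^[2 ^ n] (c ^ 2 ^ n) 0 (dyadicCondExp F₀ P S c f n) = 0 := by
    ext x; simp [twistSum]
  rw [this]
  simp

end Dyadic

/-! ### Maximal inequalities of Hopf and Wiener. -/

section Maximal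

variable {Ω : Type*} [mΩ : MeasurableSpace Ω] {P : Measure Ω}

/-- Hopf's maximal ergodic lemma for a positive contraction of `L¹`. -/
lemma hopf_maximal_lemma (Q : (Ω → ℝ) → Ω → ℝ)
    (hQint : ∀ g, Integrable g P → Integrable (Q g) P)
    (hQmono : ∀ g h, Integrable g P → Integrable h P → g ≤ᵐ[P] h → Q g ≤ᵐ[P] Q h)
    (hQ0 : ∀ g, Integrable g P → 0 ≤ᵐ[P] g → 0 ≤ᵐ[P] Q g)
    (hQle : ∀ g, Integrable g P → 0 ≤ᵐ[P] g → ∫ x, Q g x ∂P ≤ ∫ x, g x ∂P)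
    {f : Ω → ℝ} (hf : Integrable f P) (s : ℕ → Ω → ℝ) (hs0 : s 0 = 0)
    (hsm : ∀ n, Measurable (s n)) (hsint : ∀ n, Integrable (s n) P)
    (hsucc : ∀ n, s (n + 1) =ᵐ[P] fun x => f x + Q (s n) x) (n : ℕ) :
    0 ≤ ∫ x in {x | ∃ k ≤ n, 0 < s k x}, f x ∂P := by
  have hne : (Finset.range (n + 1)).Nonempty := ⟨0, by simp⟩
  set M : Ω → ℝ := (Finset.range (n + 1)).sup' hne s with hM
  have hMapp : ∀ x, M x = (Finset.range (n + 1)).sup' hne (fun k => s k x) := fun x => by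
    rw [hM, Finset.sup'_apply]
  have hMint : Integrable M P :=
    Finset.sup'_induction hne s (p := fun g => Integrable g P)
      (fun a ha b hb => ha.sup hb) (fun k _ => hsint k)
  have hMm : Measurable M := Finset.measurable_sup' hne fun k _ => hsm k
  have hle : ∀ k ≤ n, ∀ x, s k x ≤ M x := fun k hk x => by
    rw [hMapp]
    exact Finset.le_sup' (fun k => s k x) (Finset.mem_range.2 (by omega))
  have hM0 : ∀ x, 0 ≤ M x := fun x => by simpa [hs0] using hle 0 (Nat.zero_le _) x
  have hset : {x | ∃ k ≤ n, 0 < s k x} = {x | 0 < M x} := by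
    ext x
    simp only [Set.mem_ofPred_eq, hMapp, Finset.lt_sup'_iff, Finset.mem_range, Nat.lt_succ_iff]
  rw [hset]
  set A := {x | 0 < M x} with hA
  have hAm : MeasurableSet A := measurableSet_lt measurable_const hMm
  have hQM := hQint M hMint
  -- Garsia's argument: where `M > 0` the maximum is attained at some `s (k + 1) = f + Q (s k)`, and
  -- `s k ≤ M` gives `M ≤ f + Q M`. Integrating over `A` suffices because `M` vanishes off `A`, `Q M
  -- ≥ 0` and `Q` does not increase the integral of `M`.
  have hbound : ∀ᵐ x ∂P, x ∈ A → M x - Q M x ≤ f x := by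
    have h1 : ∀ᵐ x ∂P, ∀ k, k ≤ n → Q (s k) x ≤ Q M x := by
      refine ae_all_iff.2 fun k => ?_
      by_cases hk : k ≤ n
      · filter_upwards [hQmono (s k) M (hsint k) hMint (ae_of_all _ (hle k hk))] with x hx _
          using hx
      · exact ae_of_all _ fun x h => absurd h hk
    filter_upwards [h1, ae_all_iff.2 hsucc] with x h1 h2 hx
    obtain ⟨k, hk, hkx⟩ := Finset.exists_mem_eq_sup' hne (fun k => s k x)
    rw [← hMapp] at hkx
    have hk' : k ≤ n := by simpa [Nat.lt_succ_iff] using hk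
    rcases k with _ | k
    · have : 0 < M x := hx
      rw [hkx, hs0] at this
      simp at this
    · rw [hkx, h2 k]
      linarith [h1 k (by omega)]
  have h1 : ∫ x in A, M x ∂P = ∫ x, M x ∂P :=
    setIntegral_eq_integral_of_forall_compl_eq_zero fun x hx =>
      le_antisymm (not_lt.1 hx) (hM0 x)
  have h2 : ∫ x in A, Q M x ∂P ≤ ∫ x, Q M x ∂P :=
    setIntegral_le_integral hQM (hQ0 M hMint (ae_of_all _ hM0))
  have h3 := hQle M hMint (ae_of_all _ hM0)
  have h4 : ∫ x in A, (M x - Q M x) ∂P ≤ ∫ x in A, f x ∂P :=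
    setIntegral_mono_on_ae (hMint.sub hQM).integrableOn hf.integrableOn hAm hbound
  rw [integral_sub hMint.integrableOn hQM.integrableOn] at h4
  linarith

/-- A function in weak `L¹` has integrable square root. -/
lemma lintegral_sqrt_le_of_weak [IsProbabilityMeasure P] {h : Ω → ℝ≥0∞} (hm : Measurable h)
    {A : ℝ≥0} (hw : ∀ l : ℝ≥0, 0 < l → P {ω | (l : ℝ≥0∞) < h ω} ≤ A / l) :
    ∫⁻ ω, h ω ^ (1 / 2 : ℝ) ∂P ≤ 5 * (A : ℝ≥0∞) ^ (1 / 2 : ℝ) := by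
  have hfin : ∀ᵐ ω ∂P, h ω < ∞ := by
    rw [ae_iff]
    refine le_antisymm (le_of_forall_pos_le_add fun ε hε => ?_) bot_le
    rcases eq_or_ne ε ∞ with rfl | hεt
    · simp
    lift ε to ℝ≥0 using hεt
    have hε' : 0 < ε := by exact_mod_cast hε
    have hl : 0 < (A + 1) / ε := by positivity
    refine (measure_mono ?_).trans ((hw _ hl).trans ?_)
    · intro ω hω
      simp only [Set.mem_ofPred_eq, not_lt, top_le_iff] at hω ⊢
      rw [hω]; exact ENNReal.coe_lt_top
    · rw [zero_add, ← ENNReal.coe_div hl.ne']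
      refine ENNReal.coe_le_coe.2 ?_
      rw [div_div_eq_mul_div, div_le_iff₀ (by positivity), mul_comm]
      gcongr
      exact le_self_add
  -- Cut `h` at the levels `s² 4^k`: between two levels the root is at most `2^(k+1) s`, while the
  -- weak bound gives mass `A / (s² 4^k)`. The resulting series is geometric with ratio `1/2` and
  -- sum `4 A / s`.
  have main : ∀ s : ℝ≥0, 0 < s → ∫⁻ ω, h ω ^ (1 / 2 : ℝ) ∂P ≤ s + 4 * A / s := by
    intro s hs
    set g : ℕ → Ω → ℝ≥0∞ := fun k =>
      {ω | ((s ^ 2 * 4 ^ k : ℝ≥0) : ℝ≥0∞) < h ω}.indicator fun _ => ((2 ^ (k + 1) * s : ℝ≥0) : ℝ≥0∞)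
      with hg
    have hgm : ∀ k, Measurable (g k) := fun k =>
      measurable_const.indicator (measurableSet_lt measurable_const hm)
    have hle : ∀ᵐ ω ∂P, h ω ^ (1 / 2 : ℝ) ≤ s + ∑' k, g k ω := by
      filter_upwards [hfin] with ω hω
      lift h ω to ℝ≥0 using hω.ne with a ha
      have hex : ∃ k : ℕ, a ≤ s ^ 2 * 4 ^ k := by
        obtain ⟨k, hk⟩ := pow_unbounded_of_one_lt (a / s ^ 2) (show (1 : ℝ≥0) < 4 by norm_num)
        exact ⟨k, by rw [div_lt_iff₀ (by positivity)] at hk; rw [mul_comm]; exact hk.le⟩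
      have hsq : ∀ k : ℕ, a ≤ s ^ 2 * 4 ^ k →
          (a : ℝ≥0∞) ^ (1 / 2 : ℝ) ≤ ((2 ^ k * s : ℝ≥0) : ℝ≥0∞) := by
        intro k hk
        have : (a : ℝ≥0∞) ≤ ((2 ^ k * s : ℝ≥0) : ℝ≥0∞) ^ (2 : ℝ) := by
          have e : (2 ^ k * s : ℝ≥0) ^ 2 = s ^ 2 * 4 ^ k := by
            rw [show (4 : ℝ≥0) = 2 ^ 2 by norm_num, ← pow_mul]; ring
          rw [ENNReal.rpow_two, ← ENNReal.coe_pow, e]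
          exact ENNReal.coe_le_coe.2 hk
        refine (ENNReal.rpow_le_rpow this (by norm_num)).trans (le_of_eq ?_)
        rw [← ENNReal.rpow_mul]; norm_num
      classical
      rcases hk : Nat.find hex with _ | k
      · have := Nat.find_spec hex
        rw [hk] at this
        exact (hsq 0 this).trans (by simp)
      · have h1 := Nat.find_spec hex
        rw [hk] at h1
        have h2 : s ^ 2 * 4 ^ k < a := not_le.1 (Nat.find_min hex (by omega))
        refine (hsq _ h1).trans (le_add_left ?_)
        refine le_trans (le_of_eq ?_) (ENNReal.le_tsum k)
        rw [hg]
        simp only [Set.indicator]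
        rw [if_pos]
        simp only [Set.mem_ofPred_eq, ← ha]
        exact_mod_cast h2
    calc ∫⁻ ω, h ω ^ (1 / 2 : ℝ) ∂P ≤ ∫⁻ ω, (s + ∑' k, g k ω) ∂P := lintegral_mono_ae hle
      _ = s + ∑' k, ∫⁻ ω, g k ω ∂P := by
        rw [lintegral_add_left measurable_const, lintegral_tsum fun k => (hgm k).aemeasurable]
        simp
      _ ≤ s + ∑' k : ℕ, ((2 * A / s * (1 / 2) ^ k : ℝ≥0) : ℝ≥0∞) := by
        refine add_le_add_right (ENNReal.tsum_le_tsum fun k => ?_) _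
        rw [hg, lintegral_indicator_const (measurableSet_lt measurable_const hm)]
        refine (mul_le_mul_right (hw _ (by positivity)) _).trans (le_of_eq ?_)
        rw [← ENNReal.coe_div (by positivity), ← ENNReal.coe_mul]
        congr 1
        have h4 : (4 : ℝ≥0) ^ k = 2 ^ k * 2 ^ k := by rw [← mul_pow]; norm_num
        rw [h4, one_div_pow]
        field_simp
        ring
      _ = s + 4 * A / s := by
        rw [← ENNReal.coe_tsum, NNReal.tsum_mul_left, NNReal.tsum_geometric]
        · rw [show (4 * A / s : ℝ≥0∞) = ((4 * A / s : ℝ≥0) : ℝ≥0∞) by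
            rw [ENNReal.coe_div hs.ne']; push_cast; rfl]
          congr 2
          have : (1 - 1 / 2 : ℝ≥0)⁻¹ = 2 := by
            rw [← NNReal.coe_inj]; push_cast [NNReal.coe_sub (show (1 / 2 : ℝ≥0) ≤ 1 by
              rw [← NNReal.coe_le_coe]; norm_num)]; norm_num
          rw [this]; ring
        · rw [← NNReal.coe_lt_coe]; norm_num
        · refine NNReal.summable_coe.1 ?_
          push_cast
          exact summable_geometric_two.mul_left _
  -- The choice `s = √A` gives `5 √A`; adding `ε` keeps `s` positive when `A = 0`.
  set q := NNReal.sqrt A with hq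
  have hqA : (A : ℝ≥0∞) ^ (1 / 2 : ℝ) = q := by
    rw [← ENNReal.coe_rpow_of_nonneg _ (by norm_num), hq, NNReal.sqrt_eq_rpow]
  rw [hqA]
  refine ENNReal.le_of_forall_pos_le_add fun ε hε _ => ?_
  have hpos : 0 < q + ε := by positivity
  refine (main (q + ε) hpos).trans ?_
  rw [show (4 * A / (q + ε : ℝ≥0) : ℝ≥0∞) = ((4 * A / (q + ε) : ℝ≥0) : ℝ≥0∞) by
    rw [ENNReal.coe_div hpos.ne']; push_cast; rfl]
  have : 4 * A / (q + ε) ≤ 4 * q := by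
    rw [div_le_iff₀ hpos]
    have : A = q * q := by simp [hq]
    rw [this, mul_assoc]
    gcongr
    exact le_self_add
  calc ((q + ε : ℝ≥0) : ℝ≥0∞) + ((4 * A / (q + ε) : ℝ≥0) : ℝ≥0∞)
      ≤ ((q + ε : ℝ≥0) : ℝ≥0∞) + ((4 * q : ℝ≥0) : ℝ≥0∞) := by gcongr
    _ = 5 * q + ε := by push_cast; ring

/-- The hypothesis says `l P(B n) ≤ ∫_{B n} φ ≤ ∫ φ`, uniformly in `n`. It turns Hopf's lemma into a
weak type inequality. -/
lemma measure_iUnion_le_of_hopf [IsProbabilityMeasure P] {φ : Ω → ℝ} (hφ0 : ∀ x, 0 ≤ φ x)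
    (hφ : Integrable φ P) {l : ℝ} (hl : 0 < l) {B : ℕ → Set Ω} (hB : Monotone B)
    (h : ∀ n, 0 ≤ ∫ x in B n, (φ x - l) ∂P) :
    P (⋃ n, B n) ≤ ENNReal.ofReal (∫ x, φ x ∂P) / ENNReal.ofReal l := by
  rw [hB.measure_iUnion]
  refine iSup_le fun n => ?_
  have h1 := h n
  rw [integral_sub hφ.integrableOn (integrable_const _), setIntegral_const, smul_eq_mul] at h1
  have h2 : ∫ x in B n, φ x ∂P ≤ ∫ x, φ x ∂P := setIntegral_le_integral hφ (ae_of_all _ hφ0)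
  rw [← ENNReal.ofReal_div_of_pos hl, ← ofReal_measureReal (measure_ne_top P _)]
  refine ENNReal.ofReal_le_ofReal ?_
  rw [le_div_iff₀ hl]
  linarith

/-- Wiener's maximal inequality for a measure preserving transformation. -/
lemma measure_exists_birkhoffSum_le [IsProbabilityMeasure P] {S : Ω → Ω}
    (hS : MeasurePreserving S P P) {φ : Ω → ℝ} (hφ0 : ∀ x, 0 ≤ φ x) (hφm : Measurable φ)
    (hφ : Integrable φ P) {l : ℝ} (hl : 0 < l) :
    P {x | ∃ k : ℕ, k * l < birkhoffSum S φ k x} ≤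
      ENNReal.ofReal (∫ x, φ x ∂P) / ENNReal.ofReal l := by
  set s : ℕ → Ω → ℝ := fun k x => birkhoffSum S φ k x - k * l with hs
  have hbm : ∀ k, Measurable (birkhoffSum S φ k) := fun k =>
    Finset.measurable_fun_sum _ fun j _ => hφm.comp (hS.measurable.iterate j)
  have hbi : ∀ k, Integrable (birkhoffSum S φ k) P := fun k =>
    integrable_finsetSum _ fun j _ => (hS.iterate j).integrable_comp_of_integrable hφ
  have hset : {x | ∃ k : ℕ, k * l < birkhoffSum S φ k x} =
      ⋃ n, {x | ∃ k ≤ n, 0 < s k x} := by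
    ext x
    simp only [Set.mem_ofPred_eq, Set.mem_iUnion, hs, sub_pos]
    exact ⟨fun ⟨k, hk⟩ => ⟨k, k, le_rfl, hk⟩, fun ⟨_, k, _, hk⟩ => ⟨k, hk⟩⟩
  rw [hset]
  refine measure_iUnion_le_of_hopf hφ0 hφ hl
    (fun m n hmn x ⟨k, hk, hx⟩ => ⟨k, hk.trans hmn, hx⟩) fun n => ?_
  refine hopf_maximal_lemma (fun g => g ∘ S) (fun g hg => hS.integrable_comp_of_integrable hg)
    (fun g h _ _ hgh => hS.quasiMeasurePreserving.tendsto_ae.eventually hgh)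
    (fun g _ hg0 => hS.quasiMeasurePreserving.tendsto_ae.eventually hg0)
    (fun g hg _ => le_of_eq ?_)
    (hφ.sub (integrable_const l)) s ?_ (fun k => (hbm k).sub_const _)
    (fun k => (hbi k).sub (integrable_const _)) (fun k => ae_of_all _ fun x => ?_) n
  · have h1 := hS.map_eq
    conv_rhs => rw [← h1]
    rw [integral_map hS.measurable.aemeasurable (by rw [h1]; exact hg.1)]
    rfl
  · ext x; simp [hs]
  · simp only [hs, birkhoffSum_succ', Function.comp_apply, Pi.sub_apply]
    push_cast; ring

end Maximal

/-! ### The maximal function of conditional second moments. -/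

section CondMaximal

variable {Ω : Type*} {F₀ : MeasurableSpace Ω} [mΩ : MeasurableSpace Ω] {P : Measure Ω}
  {S : Ω → Ω} {κ : Ω → Measure Ω}

/-- The maximal function of the conditional second moments along an orbit. -/
noncomputable def condMaximal (κ : Ω → Measure Ω) (S : Ω → Ω) (v : Ω → ℂ) (ω : Ω) : ℝ≥0∞ :=
  ⨆ n : ℕ, (∑ j ∈ Finset.range (n + 1), ∫⁻ x, ‖v (S^[j] x)‖ₑ ^ 2 ∂κ ω) / (n + 1)

lemma sum_le_condMaximal (v : Ω → ℂ) (ω : Ω) (n : ℕ) :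
    ∑ j ∈ Finset.range n, ∫⁻ x, ‖v (S^[j] x)‖ₑ ^ 2 ∂κ ω ≤ n * condMaximal κ S v ω := by
  rcases n with _ | n
  · simp
  · have h := le_iSup (fun n : ℕ =>
      (∑ j ∈ Finset.range (n + 1), ∫⁻ x, ‖v (S^[j] x)‖ₑ ^ 2 ∂κ ω) / (n + 1)) n
    rw [ENNReal.div_le_iff (by simp) (by finiteness)] at h
    rw [mul_comm]
    push_cast
    exact h

lemma IsRegularCondProb.measurable_condMaximal (hκ : IsRegularCondProb F₀ P κ) (hF₀ : F₀ ≤ mΩ)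
    (hS : Measurable S) {v : Ω → ℂ} (hv : Measurable v) : Measurable (condMaximal κ S v) :=
  Measurable.iSup fun _ => (Finset.measurable_fun_sum _ fun j _ =>
    (hκ.measurable_lintegral ((hv.comp (hS.iterate j)).enorm.pow_const 2)).mono hF₀ le_rfl).div_const
      _

lemma lintegral_enorm_sq_eq_ofReal {μ : Measure Ω} {u : Ω → ℂ}
    (hu : Integrable (fun x => ‖u x‖ ^ 2) μ) :
    ∫⁻ x, ‖u x‖ₑ ^ 2 ∂μ = ENNReal.ofReal (∫ x, ‖u x‖ ^ 2 ∂μ) := by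
  rw [ofReal_integral_eq_lintegral_ofReal hu (ae_of_all _ fun x => by positivity)]
  refine lintegral_congr fun x => ?_
  rw [← ofReal_norm, ENNReal.ofReal_pow (norm_nonneg _)]

variable [IsProbabilityMeasure P]

/-- Hopf's maximal inequality for conditional expectations of Birkhoff sums. -/
lemma measure_exists_condExp_birkhoffSum_le (hF₀ : F₀ ≤ mΩ)
    (hS : MeasurePreserving S P P) (hSF : F₀ ≤ F₀.comap S) {φ : Ω → ℝ} (hφ0 : ∀ x, 0 ≤ φ x)
    (hφm : StronglyMeasurable[F₀] φ) (hφ : Integrable φ P) {l : ℝ} (hl : 0 < l) :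
    P {x | ∃ k : ℕ, 0 < (P[fun y => birkhoffSum S φ k y - k * l | F₀]) x} ≤
      ENNReal.ofReal (∫ x, φ x ∂P) / ENNReal.ofReal l := by
  set b : ℕ → Ω → ℝ := fun k y => birkhoffSum S φ k y - k * l with hb
  have hbi : ∀ k, Integrable (b k) P := fun k =>
    (integrable_finsetSum _ fun j _ =>
      (hS.iterate j).integrable_comp_of_integrable hφ).sub (integrable_const _)
  set s : ℕ → Ω → ℝ := fun k => P[b k | F₀] with hs
  have hset : {x | ∃ k : ℕ, 0 < s k x} = ⋃ n, {x | ∃ k ≤ n, 0 < s k x} := by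
    ext x
    simp only [Set.mem_ofPred_eq, Set.mem_iUnion]
    exact ⟨fun ⟨k, hk⟩ => ⟨k, k, le_rfl, hk⟩, fun ⟨_, k, _, hk⟩ => ⟨k, hk⟩⟩
  rw [hset]
  refine measure_iUnion_le_of_hopf hφ0 hφ hl
    (fun m n hmn x ⟨k, hk, hx⟩ => ⟨k, hk.trans hmn, hx⟩) fun n => ?_
  have hcomp : ∀ {g : Ω → ℝ}, Integrable g P → Integrable (g ∘ S) P :=
    fun hg => hS.integrable_comp_of_integrable hg
  -- The sums `s k = E[b k | F₀]` obey Hopf's recursion for this operator by `condExp_comp_condExp`;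
  -- that `φ` is `F₀`-measurable makes the first term come out as `φ - l`.
  refine hopf_maximal_lemma (fun g => P[g ∘ S | F₀]) (fun g _ => integrable_condExp)
    (fun g h hg hh hgh => condExp_mono (hcomp hg) (hcomp hh)
      (hS.quasiMeasurePreserving.tendsto_ae.eventually hgh))
    (fun g _ hg0 => condExp_nonneg (hS.quasiMeasurePreserving.tendsto_ae.eventually hg0))
    (fun g hg _ => le_of_eq ?_)
    (hφ.sub (integrable_const l)) s ?_
    (fun k => (stronglyMeasurable_condExp.mono hF₀).measurable)
    (fun k => integrable_condExp) (fun k => ?_) n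
  · rw [integral_condExp hF₀]
    have h1 := hS.map_eq
    conv_rhs => rw [← h1]
    rw [integral_map hS.measurable.aemeasurable (by rw [h1]; exact hg.1)]
    rfl
  · have : b 0 = 0 := by ext x; simp [hb]
    rw [hs]
    simp only [this, condExp_zero]
  · have hfi : Integrable (fun x => φ x - l) P := hφ.sub (integrable_const l)
    have h1 : b (k + 1) = (fun x => φ x - l) + b k ∘ S := by
      ext x
      simp only [hb, birkhoffSum_succ', Function.comp_apply, Pi.add_apply]
      push_cast; ring
    have h2 := condExp_add hfi (hcomp (hbi k)) F₀
    have h4 : StronglyMeasurable[F₀] fun x => φ x - l := hφm.sub stronglyMeasurable_const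
    rw [condExp_of_stronglyMeasurable hF₀ h4 hfi] at h2
    have h3 := condExp_comp_condExp hF₀ hS hSF (hbi k)
    simp only [hs, h1]
    filter_upwards [h2, h3] with x h2 h3
    rw [h2, Pi.add_apply, h3, Pi.sub_apply]

lemma IsRegularCondProb.measure_condMaximal_le (hκ : IsRegularCondProb F₀ P κ) (hF₀ : F₀ ≤ mΩ)
    (hS : MeasurePreserving S P P) (hSF : F₀ ≤ F₀.comap S) {v : Ω → ℂ}
    (hv : StronglyMeasurable[F₀] v) (hv2 : MemLp v 2 P) {l : ℝ≥0} (hl : 0 < l) :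
    P {ω | (l : ℝ≥0∞) < condMaximal κ S v ω} ≤ (∫⁻ x, ‖v x‖ₑ ^ 2 ∂P) / l := by
  have hφ : Integrable (fun x => ‖v x‖ ^ 2) P := (memLp_two_iff_integrable_sq_norm hv2.1).1 hv2
  have hφj : ∀ j, Integrable (fun x => ‖v (S^[j] x)‖ ^ 2) P := fun j =>
    (hS.iterate j).integrable_comp_of_integrable hφ
  have hφm : StronglyMeasurable[F₀] fun x => ‖v x‖ ^ 2 := hv.norm.pow 2
  have h := measure_exists_condExp_birkhoffSum_le hF₀ hS hSF (fun x => by positivity) hφm hφ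
    (l := l) (by exact_mod_cast hl)
  rw [lintegral_enorm_sq_eq_ofReal hφ, ← ENNReal.ofReal_coe_nnreal]
  refine le_trans (measure_mono_ae ?_) h
  have hbi : ∀ k : ℕ, Integrable (fun y => birkhoffSum S (fun x => ‖v x‖ ^ 2) k y - k * (l : ℝ)) P :=
    fun k => (integrable_finsetSum _ fun j _ => hφj j).sub (integrable_const _)
  filter_upwards [ae_all_iff.2 fun k => hκ.condExp_ae_eq hF₀ (hbi k),
    ae_all_iff.2 fun j => hκ.ae_integrable hF₀ (hφj j)] with ω h1 h2 hω
  have hω' : ENNReal.ofReal (l : ℝ) < condMaximal κ S v ω := hω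
  obtain ⟨n, hn⟩ := lt_iSup_iff.1 hω'
  refine ⟨n + 1, ?_⟩
  have hprob := hκ.isProbabilityMeasure ω
  have h3 : ∀ j, ∫⁻ x, ‖v (S^[j] x)‖ₑ ^ 2 ∂κ ω =
      ENNReal.ofReal (∫ x, ‖v (S^[j] x)‖ ^ 2 ∂κ ω) := fun j => lintegral_enorm_sq_eq_ofReal (h2 j)
  have h4 : Integrable (fun y => birkhoffSum S (fun x => ‖v x‖ ^ 2) (n + 1) y) (κ ω) :=
    integrable_finsetSum _ fun j _ => h2 j
  rw [h1 (n + 1), integral_sub h4 (integrable_const _)]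
  simp only [birkhoffSum]
  rw [integral_finsetSum _ fun j _ => h2 j]
  simp only [h3] at hn
  rw [← ENNReal.ofReal_sum_of_nonneg fun j _ => integral_nonneg fun x => by positivity,
    ENNReal.lt_div_iff_mul_lt (by simp) (by simp),
    show ((n : ℝ≥0∞) + 1) = ENNReal.ofReal ((n : ℝ) + 1) by
      rw [ENNReal.ofReal_add (by positivity) (by positivity)]; simp,
    ← ENNReal.ofReal_mul (by positivity), ENNReal.ofReal_lt_ofReal_iff_of_nonneg (by positivity)]
    at hn
  simp only [integral_const, probReal_univ, smul_eq_mul]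
  push_cast
  linarith

/-- The maximal function of `‖v‖²` is only in weak `L¹`, but its root is integrable, and the root is
what enters the bound for an `L²` norm. -/
lemma IsRegularCondProb.lintegral_sqrt_condMaximal_le (hκ : IsRegularCondProb F₀ P κ)
    (hF₀ : F₀ ≤ mΩ) (hS : MeasurePreserving S P P) (hSF : F₀ ≤ F₀.comap S) {v : Ω → ℂ}
    (hv : StronglyMeasurable[F₀] v) (hv2 : MemLp v 2 P) :
    ∫⁻ ω, condMaximal κ S v ω ^ (1 / 2 : ℝ) ∂P ≤ 5 * eLpNorm v 2 P := by
  have hfin : ∫⁻ x, ‖v x‖ₑ ^ 2 ∂P ≠ ∞ := by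
    rw [← eLpNorm_two_sq]
    exact ENNReal.pow_ne_top hv2.2.ne
  rw [eLpNorm_two_eq]
  lift ∫⁻ x, ‖v x‖ₑ ^ 2 ∂P to ℝ≥0 using hfin with A hA
  refine lintegral_sqrt_le_of_weak
    (hκ.measurable_condMaximal hF₀ hS.measurable (hv.mono hF₀).measurable) fun l hl => ?_
  rw [hA]
  exact hκ.measure_condMaximal_le hF₀ hS hSF hv hv2 hl

end CondMaximal

/-! ### The dyadic Maxwell–Woodroofe norm controls twisted sums. -/

lemma lintegral_Lp_finsetSum_le {α ι : Type*} [MeasurableSpace α] {μ : Measure α} (s : Finset ι)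
    {f : ι → α → ℝ≥0∞} (hf : ∀ i, AEMeasurable (f i) μ) :
    (∫⁻ a, (∑ i ∈ s, f i a) ^ (2 : ℝ) ∂μ) ^ (1 / 2 : ℝ) ≤
      ∑ i ∈ s, (∫⁻ a, f i a ^ (2 : ℝ) ∂μ) ^ (1 / 2 : ℝ) := by
  classical
  induction s using Finset.induction_on with
  | empty => simp
  | insert i s hi ih =>
    simp only [Finset.sum_insert hi]
    exact (ENNReal.lintegral_Lp_add_le (hf i) (Finset.aemeasurable_fun_sum s fun j _ => hf j)
      (by norm_num)).trans (add_le_add_right ih _)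

/-- Source of the weights `2^{-r/2}`: scale `r` contains only `n / 2 ^ r` blocks. -/
lemma sqrt_natDiv_two_pow_le (n r : ℕ) :
    ((n / 2 ^ r : ℕ) : ℝ≥0∞) ^ (1 / 2 : ℝ) ≤
      ENNReal.ofReal √n * ENNReal.ofReal ((√2)⁻¹ ^ r) := by
  rw [← ENNReal.ofReal_natCast, ENNReal.ofReal_rpow_of_nonneg (by positivity) (by norm_num),
    ← Real.sqrt_eq_rpow, ← ENNReal.ofReal_mul (by positivity)]
  refine ENNReal.ofReal_le_ofReal ?_
  have h : √(n : ℝ) * (√2)⁻¹ ^ r = √((n : ℝ) / 2 ^ r) := by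
    rw [Real.sqrt_div (by positivity), div_eq_mul_inv, inv_pow]
    congr 2
    rw [eq_comm, Real.sqrt_eq_iff_mul_self_eq (by positivity) (by positivity), ← mul_pow]
    simp
  rw [h]
  refine Real.sqrt_le_sqrt ?_
  have := @Nat.cast_div_le ℝ _ _ _ n (2 ^ r)
  simpa using this

section TwistNorm

variable {Ω : Type*} (F₀ : MeasurableSpace Ω) [mΩ : MeasurableSpace Ω] (P : Measure Ω)

/-- The Maxwell–Woodroofe norm in dyadic form. -/
noncomputable def twistNorm (S : Ω → Ω) (c : ℂ) (f : Ω → ℂ) : ℝ≥0∞ :=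
  ∑' r : ℕ, ENNReal.ofReal ((√2)⁻¹ ^ r) * eLpNorm (dyadicCondExp F₀ P S c f r) 2 P

variable {F₀ P} [IsProbabilityMeasure P] {κ : Ω → Measure Ω} {S : Ω → Ω} {c : ℂ} {f : Ω → ℂ}

/-- `H` is twice the weighted sum over `r` of the roots of the maximal functions at scale `2 ^ r`.
It depends neither on `n` nor on the point under `κ ω`, so smallness of the norm yields closeness
uniform in `n` for almost every `ω`. -/
lemma IsRegularCondProb.exists_maximal_bound
    (hκ : IsRegularCondProb F₀ P κ) (hF₀ : F₀ ≤ mΩ)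
    (hS : MeasurePreserving S P P) (hSF : F₀ ≤ F₀.comap S)
    (hf : StronglyMeasurable[F₀] f) (hf2 : MemLp f 2 P) (hc : ‖c‖ = 1) :
    ∃ H : Ω → ℝ≥0∞, Measurable H ∧ ∫⁻ ω, H ω ∂P ≤ 10 * twistNorm F₀ P S c f ∧
      ∀ᵐ ω ∂P, ∀ n : ℕ, eLpNorm (twistSum S c n f) 2 (κ ω) ≤ ENNReal.ofReal √n * H ω := by
  set h : ℕ → Ω → ℝ≥0∞ := fun r => condMaximal κ S^[2 ^ r] (dyadicCondExp F₀ P S c f r) with hh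
  have hhm : ∀ r, Measurable (h r) := fun r =>
    hκ.measurable_condMaximal hF₀ (hS.iterate _).measurable
      ((stronglyMeasurable_dyadicCondExp r).mono hF₀).measurable
  have hterm : ∀ r, Measurable fun ω => ENNReal.ofReal ((√2)⁻¹ ^ r) * h r ω ^ (1 / 2 : ℝ) :=
    fun r => ((hhm r).pow_const _).const_mul _
  refine ⟨fun ω => 2 * ∑' r, ENNReal.ofReal ((√2)⁻¹ ^ r) * h r ω ^ (1 / 2 : ℝ),
    (Measurable.tsum hterm).const_mul _, ?_, ?_⟩
  · rw [lintegral_const_mul _ (Measurable.tsum hterm),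
      lintegral_tsum fun r => (hterm r).aemeasurable, show (10 : ℝ≥0∞) = 2 * 5 by norm_num,
      mul_assoc, twistNorm, ← ENNReal.tsum_mul_left (a := 5)]
    refine mul_le_mul_right (ENNReal.tsum_le_tsum fun r => ?_) _
    rw [lintegral_const_mul _ ((hhm r).pow_const _), mul_left_comm]
    exact mul_le_mul_right (hκ.lintegral_sqrt_condMaximal_le hF₀ (hS.iterate _)
      (le_comap_iterate hSF _) (stronglyMeasurable_dyadicCondExp r)
      (memLp_dyadicCondExp hS hf2 r)) _
  · filter_upwards [hκ.ae_eLpNorm_twistSum_le hF₀ hS hSF hf hf2 hc] with ω hω n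
    refine (hω n).trans ?_
    rw [mul_left_comm]
    refine mul_le_mul_right ?_ _
    rw [← ENNReal.tsum_mul_left]
    refine le_trans (Finset.sum_le_sum fun r _ => ?_) (ENNReal.sum_le_tsum (Finset.range n))
    refine (ENNReal.rpow_le_rpow (sum_le_condMaximal _ ω _) (by norm_num)).trans ?_
    rw [ENNReal.mul_rpow_of_nonneg _ _ (by norm_num), ← mul_assoc]
    exact mul_le_mul_left (sqrt_natDiv_two_pow_le n r) _

/-- The quenched bound controls only the first moment of `H`, so the norm in `L²(P)` is estimated
separately: Minkowski's inequality over the scales, and stationarity within each scale. -/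
lemma IsRegularCondProb.eLpNorm_twistSum_le
    (hκ : IsRegularCondProb F₀ P κ) (hF₀ : F₀ ≤ mΩ)
    (hS : MeasurePreserving S P P) (hSF : F₀ ≤ F₀.comap S)
    (hf : StronglyMeasurable[F₀] f) (hf2 : MemLp f 2 P) (hc : ‖c‖ = 1) (n : ℕ) :
    eLpNorm (twistSum S c n f) 2 P ≤ ENNReal.ofReal √n * (2 * twistNorm F₀ P S c f) := by
  have htm : StronglyMeasurable (twistSum S c n f) :=
    StronglyMeasurable.twistSum_of_measurable hS.measurable (hf.mono hF₀) n
  set q : ℕ → Ω → ℝ≥0∞ := fun r ω => ∑ j ∈ Finset.range (n / 2 ^ r),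
        ∫⁻ x, ‖dyadicCondExp F₀ P S c f r ((S^[2 ^ r])^[j] x)‖ₑ ^ 2 ∂κ ω with hq
  have hdm : ∀ r j, Measurable fun x =>
      ‖dyadicCondExp F₀ P S c f r ((S^[2 ^ r])^[j] x)‖ₑ ^ 2 := fun r j =>
    ((((stronglyMeasurable_dyadicCondExp r).mono hF₀).measurable.comp
      (((hS.iterate (2 ^ r)).iterate j).measurable)).enorm.pow_const 2)
  have hqm : ∀ r, Measurable (q r) := fun r => Finset.measurable_fun_sum _ fun j _ =>
    (hκ.measurable_lintegral (hdm r j)).mono hF₀ le_rfl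
  have hqint : ∀ r, ∫⁻ ω, q r ω ∂P =
      (n / 2 ^ r : ℕ) * eLpNorm (dyadicCondExp F₀ P S c f r) 2 P ^ 2 := by
    intro r
    simp only [hq]
    rw [lintegral_finsetSum _ fun j _ => (hκ.measurable_lintegral (hdm r j)).mono hF₀ le_rfl]
    rw [Finset.sum_congr rfl (g := fun _ => eLpNorm (dyadicCondExp F₀ P S c f r) 2 P ^ 2)]
    · simp
    · intro j _
      rw [hκ.lintegral_lintegral hF₀ (hdm r j), eLpNorm_two_sq]
      exact ((hS.iterate (2 ^ r)).iterate j).lintegral_comp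
        (((stronglyMeasurable_dyadicCondExp r).mono hF₀).measurable.enorm.pow_const 2)
  have h1 : eLpNorm (twistSum S c n f) 2 P =
      (∫⁻ ω, eLpNorm (twistSum S c n f) 2 (κ ω) ^ (2 : ℝ) ∂P) ^ (1 / 2 : ℝ) := by
    rw [eLpNorm_two_eq, ← hκ.lintegral_lintegral hF₀ (htm.measurable.enorm.pow_const 2)]
    simp only [ENNReal.rpow_two, eLpNorm_two_sq]
  rw [h1]
  calc (∫⁻ ω, eLpNorm (twistSum S c n f) 2 (κ ω) ^ (2 : ℝ) ∂P) ^ (1 / 2 : ℝ)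
      ≤ (∫⁻ ω, (∑ r ∈ Finset.range n, 2 * q r ω ^ (1 / 2 : ℝ)) ^ (2 : ℝ) ∂P) ^ (1 / 2 : ℝ) := by
        refine ENNReal.rpow_le_rpow (lintegral_mono_ae ?_) (by norm_num)
        filter_upwards [hκ.ae_eLpNorm_twistSum_le hF₀ hS hSF hf hf2 hc] with ω hω
        refine ENNReal.rpow_le_rpow ?_ (by norm_num)
        rw [← Finset.mul_sum]
        exact hω n
    _ ≤ ∑ r ∈ Finset.range n,
          (∫⁻ ω, (2 * q r ω ^ (1 / 2 : ℝ)) ^ (2 : ℝ) ∂P) ^ (1 / 2 : ℝ) :=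
        lintegral_Lp_finsetSum_le _ fun r => (((hqm r).pow_const _).const_mul _).aemeasurable
    _ ≤ ∑ r ∈ Finset.range n, ENNReal.ofReal √n * (2 * (ENNReal.ofReal ((√2)⁻¹ ^ r) *
          eLpNorm (dyadicCondExp F₀ P S c f r) 2 P)) := by
        refine Finset.sum_le_sum fun r _ => ?_
        have h2 : ∀ ω, (2 * q r ω ^ (1 / 2 : ℝ)) ^ (2 : ℝ) = 4 * q r ω := fun ω => by
          rw [ENNReal.mul_rpow_of_nonneg _ _ (by norm_num), ← ENNReal.rpow_mul]
          norm_num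
        simp only [h2]
        rw [lintegral_const_mul _ (hqm r), hqint r, ENNReal.mul_rpow_of_nonneg _ _ (by norm_num),
          ENNReal.mul_rpow_of_nonneg _ _ (by norm_num), ← ENNReal.rpow_two, ← ENNReal.rpow_mul,
          show (4 : ℝ≥0∞) = 2 ^ (2 : ℝ) by norm_num, ← ENNReal.rpow_mul]
        norm_num only [ENNReal.rpow_one]
        rw [mul_left_comm (ENNReal.ofReal √n), ← mul_assoc (ENNReal.ofReal √n)]
        refine mul_le_mul_right (mul_le_mul_left ?_ _) _
        have := sqrt_natDiv_two_pow_le n r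
        norm_num only at this
        exact this
    _ ≤ ENNReal.ofReal √n * (2 * twistNorm F₀ P S c f) := by
        rw [← Finset.mul_sum, ← Finset.mul_sum]
        exact mul_le_mul_right (mul_le_mul_right (ENNReal.sum_le_tsum _) _) _

end TwistNorm

/-! ### Maxwell–Woodroofe condition and coboundaries for a Hilbert or Banach contraction. -/

section Contraction

/-- Dyadic summability deduced from the Maxwell–Woodroofe series of a subadditive sequence. -/
lemma summable_dyadic_of_subadditive {b : ℕ → ℝ} (hb0 : ∀ n, 0 ≤ b n)
    (hb : ∀ m n, b (m + n) ≤ b m + b n)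
    (hs : Summable fun k : ℕ => 1 / (k : ℝ) ^ (3 / 2 : ℝ) * b k) :
    Summable fun r : ℕ => (√2)⁻¹ ^ r * b (2 ^ r) := by
  set u : ℕ → ℝ := fun k => 1 / (k : ℝ) ^ (3 / 2 : ℝ) * b k with hu
  have hu0 : ∀ k, 0 ≤ u k := fun k => mul_nonneg (by positivity) (hb0 k)
  set B : ℕ → ℝ := fun r => ∑ k ∈ Finset.Ico (2 ^ r) (2 ^ (r + 1)), u k with hB
  have hpow : ∀ {m n : ℕ}, m ≤ n → 2 ^ m ≤ 2 ^ n := fun h => Nat.pow_le_pow_right (by norm_num) h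
  have hBs : Summable B := by
    refine summable_of_sum_range_le (c := ∑' k, u k)
      (fun r => Finset.sum_nonneg fun k _ => hu0 k) fun R => ?_
    have : ∑ r ∈ Finset.range R, B r = ∑ k ∈ Finset.Ico 1 (2 ^ R), u k := by
      induction R with
      | zero => simp
      | succ R ih =>
        rw [Finset.sum_range_succ, ih, hB,
          Finset.sum_Ico_consecutive _ Nat.one_le_two_pow (hpow (Nat.le_succ R))]
    rw [this]
    exact hs.sum_le_tsum _ fun k _ => hu0 k
  -- With `m = 2^r`, pair `k ∈ [m, 2m)` with `4m - k`: subadditivity bounds `m b(4m)` by the sum of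
  -- `b` over `[m, 4m)`. There `k^{3/2} ≤ 4m √(4m)`, which produces the constant `4`.
  have hmain : ∀ r, (√2)⁻¹ ^ (r + 2) * b (2 ^ (r + 2)) ≤ 4 * (B r + B (r + 1)) := by
    intro r
    have hBB : B r + B (r + 1) = ∑ k ∈ Finset.Ico (2 ^ r) (2 ^ (r + 2)), u k :=
      Finset.sum_Ico_consecutive _ (hpow (Nat.le_succ r)) (hpow (Nat.le_succ (r + 1)))
    rw [hBB]
    set m := 2 ^ r with hm
    have hm1 : 1 ≤ m := Nat.one_le_two_pow
    have hn : 2 ^ (r + 2) = 4 * m := by rw [hm, pow_add]; ring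
    rw [hn]
    have h1 : (m : ℝ) * b (4 * m) ≤ ∑ k ∈ Finset.Ico m (4 * m), b k := by
      have e1 : (m : ℝ) * b (4 * m) = ∑ k ∈ Finset.Ico m (2 * m), b (4 * m) := by
        rw [Finset.sum_const, Nat.card_Ico, nsmul_eq_mul]
        congr 2; omega
      have e2 : ∑ k ∈ Finset.Ico m (2 * m), b (4 * m) ≤
          ∑ k ∈ Finset.Ico m (2 * m), b k + ∑ k ∈ Finset.Ico m (2 * m), b (4 * m - k) := by
        rw [← Finset.sum_add_distrib]
        refine Finset.sum_le_sum fun k hk => ?_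
        rw [Finset.mem_Ico] at hk
        have := hb k (4 * m - k)
        rwa [Nat.add_sub_cancel' (by omega)] at this
      have e3 : ∑ k ∈ Finset.Ico m (2 * m), b (4 * m - k) ≤
          ∑ k ∈ Finset.Ico (2 * m) (4 * m), b k := by
        have hinj : Set.InjOn (fun k => 4 * m - k) (Finset.Ico m (2 * m) : Set ℕ) := by
          intro a ha c hc h
          simp only [Finset.coe_Ico, Set.mem_Ico] at ha hc h
          omega
        rw [← Finset.sum_image hinj]
        refine Finset.sum_le_sum_of_subset_of_nonneg (fun j hj => ?_) fun j _ _ => hb0 j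
        simp only [Finset.mem_image, Finset.mem_Ico] at hj ⊢
        omega
      rw [← Finset.sum_Ico_consecutive _ (show m ≤ 2 * m by omega) (show 2 * m ≤ 4 * m by omega)]
      linarith
    have h2 : ∑ k ∈ Finset.Ico m (4 * m), b k ≤
        ((4 * m : ℕ) : ℝ) ^ (3 / 2 : ℝ) * ∑ k ∈ Finset.Ico m (4 * m), u k := by
      rw [Finset.mul_sum]
      refine Finset.sum_le_sum fun k hk => ?_
      rw [Finset.mem_Ico] at hk
      have hk0 : (0 : ℝ) < k := by exact_mod_cast (show 0 < k by omega)
      have e : b k = (k : ℝ) ^ (3 / 2 : ℝ) * u k := by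
        rw [hu]; field_simp
      rw [e]
      refine mul_le_mul_of_nonneg_right (Real.rpow_le_rpow hk0.le ?_ (by norm_num)) (hu0 k)
      exact_mod_cast hk.2.le
    have hs2 : (√2)⁻¹ ^ (r + 2) = (√((4 * m : ℕ) : ℝ))⁻¹ := by
      rw [← hn, inv_pow]
      congr 1
      rw [eq_comm, Real.sqrt_eq_iff_mul_self_eq (by positivity) (by positivity), ← mul_pow]
      simp
    have h32 : ((4 * m : ℕ) : ℝ) ^ (3 / 2 : ℝ) = ((4 * m : ℕ) : ℝ) * √((4 * m : ℕ) : ℝ) := by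
      rw [Real.sqrt_eq_rpow, show (3 / 2 : ℝ) = 1 + 1 / 2 by norm_num, Real.rpow_add (by positivity),
        Real.rpow_one]
    have hmpos : (0 : ℝ) < m := by exact_mod_cast hm1
    have hsq : 0 < √((4 * m : ℕ) : ℝ) := Real.sqrt_pos.2 (by positivity)
    rw [hs2, inv_mul_le_iff₀ hsq]
    rw [h32] at h2
    have h3 := h1.trans h2
    push_cast at h3 ⊢
    refine le_of_mul_le_mul_left (h3.trans (le_of_eq ?_)) hmpos
    ring
  refine (summable_nat_add_iff 2).1 (Summable.of_nonneg_of_le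
    (fun r => mul_nonneg (by positivity) (hb0 _)) hmain
    ((hBs.add ((summable_nat_add_iff 1).2 hBs)).mul_left 4))

variable {E : Type*} [NormedAddCommGroup E] [NormedSpace ℂ E] (Q : E →L[ℂ] E)

/-- `∑_{j<n} Q^j`. -/
noncomputable def powSum (n : ℕ) : E →L[ℂ] E := ∑ j ∈ Finset.range n, Q ^ j

lemma powSum_succ' (n : ℕ) (x : E) : powSum Q (n + 1) x = x + Q (powSum Q n x) := by
  simp [powSum, Finset.sum_range_succ', pow_succ', add_comm]

lemma powSum_add (m n : ℕ) (x : E) :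
    powSum Q (m + n) x = powSum Q m x + (Q ^ m) (powSum Q n x) := by
  simp [powSum, Finset.sum_range_add, pow_add]

lemma powSum_sub (n : ℕ) (x : E) : powSum Q n (x - Q x) = x - (Q ^ n) x := by
  induction n with
  | zero => simp [powSum]
  | succ n ih =>
    have : powSum Q (n + 1) (x - Q x) = powSum Q n (x - Q x) + (Q ^ n) (x - Q x) := by
      simp [powSum, Finset.sum_range_succ]
    rw [this, ih, pow_succ, map_sub]
    simp

lemma apply_powSum (n : ℕ) (x : E) : Q (powSum Q n x) = powSum Q n (Q x) := by
  simp only [powSum, _root_.sum_apply, map_sum]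
  refine Finset.sum_congr rfl fun j _ => ?_
  rw [← mul_apply_eq_comp, ← pow_succ', pow_succ, mul_apply_eq_comp]

lemma powSum_comm (m n : ℕ) (x : E) : powSum Q m (powSum Q n x) = powSum Q n (powSum Q m x) := by
  have h : Commute (powSum Q m) (powSum Q n) :=
    Commute.sum_left _ _ _ fun i _ => Commute.sum_right _ _ _ fun j _ => Commute.pow_pow_self Q i j
  have := congrArg (fun A : E →L[ℂ] E => A x) h.eq
  simpa using this

variable {Q}

lemma norm_pow_apply_le (hQ : ‖Q‖ ≤ 1) (n : ℕ) (x : E) : ‖(Q ^ n) x‖ ≤ ‖x‖ := by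
  induction n with
  | zero => simp
  | succ n ih =>
    rw [pow_succ', mul_apply_eq_comp]
    exact (Q.le_of_opNorm_le hQ _).trans (by simpa using ih)

lemma norm_powSum_le (hQ : ‖Q‖ ≤ 1) (n : ℕ) (x : E) : ‖powSum Q n x‖ ≤ n * ‖x‖ := by
  simp only [powSum, _root_.sum_apply]
  refine (norm_sum_le _ _).trans ((Finset.sum_le_sum fun j _ => norm_pow_apply_le hQ j x).trans ?_)
  simp

/-- The hypothesis has an extra `Q` because `S_k(t)` starts at index `1`. Removing it changes each
norm by at most `2‖x‖`, and `∑ k^{-3/2}` converges. -/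
lemma summable_dyadic_powSum (hQ : ‖Q‖ ≤ 1) (x : E)
    (hs : Summable fun k : ℕ => 1 / ((k + 1 : ℕ) : ℝ) ^ (3 / 2 : ℝ) *
      ‖Q (powSum Q (k + 1) x)‖) :
    Summable fun r : ℕ => (√2)⁻¹ ^ r * ‖powSum Q (2 ^ r) x‖ := by
  refine summable_dyadic_of_subadditive (b := fun n => ‖powSum Q n x‖) (fun n => norm_nonneg _)
    (fun m n => ?_) ((summable_nat_add_iff 1).1 ?_)
  · rw [powSum_add]
    exact (norm_add_le _ _).trans (by gcongr; exact norm_pow_apply_le hQ _ _)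
  · have h1 : Summable fun k : ℕ => 1 / ((k + 1 : ℕ) : ℝ) ^ (3 / 2 : ℝ) * (2 * ‖x‖) :=
      ((summable_nat_add_iff 1).2 (Real.summable_one_div_nat_rpow.2 (by norm_num :
        (1 : ℝ) < 3 / 2))).mul_right _
    refine Summable.of_nonneg_of_le (fun k => by positivity) (fun k => ?_) (hs.add h1)
    rw [← mul_add]
    refine mul_le_mul_of_nonneg_left ?_ (by positivity)
    have h2 : powSum Q (k + 1) x = Q (powSum Q (k + 1) x) + (x - (Q ^ (k + 1)) x) := by
      rw [← powSum_sub, map_sub, ← apply_powSum]; abel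
    calc ‖powSum Q (k + 1) x‖ = ‖Q (powSum Q (k + 1) x) + (x - (Q ^ (k + 1)) x)‖ := by rw [← h2]
      _ ≤ ‖Q (powSum Q (k + 1) x)‖ + (‖x‖ + ‖(Q ^ (k + 1)) x‖) :=
        (norm_add_le _ _).trans (by gcongr; exact norm_sub_le _ _)
      _ ≤ _ := by linarith [norm_pow_apply_le hQ (k + 1) x]

variable (Q) in
/-- The dyadic Maxwell–Woodroofe norm of a vector. -/
noncomputable def dyadicNorm (x : E) : ℝ≥0∞ :=
  ∑' r : ℕ, ENNReal.ofReal ((√2)⁻¹ ^ r) * ‖powSum Q (2 ^ r) x‖ₑ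

lemma dyadicNorm_eq_ofReal {x : E}
    (hs : Summable fun r : ℕ => (√2)⁻¹ ^ r * ‖powSum Q (2 ^ r) x‖) :
    dyadicNorm Q x = ENNReal.ofReal (∑' r : ℕ, (√2)⁻¹ ^ r * ‖powSum Q (2 ^ r) x‖) := by
  rw [ENNReal.ofReal_tsum_of_nonneg (fun r => by positivity) hs, dyadicNorm]
  congr 1 with r
  rw [ENNReal.ofReal_mul (by positivity), ofReal_norm]

lemma dyadicNorm_add_le (x y : E) : dyadicNorm Q (x + y) ≤ dyadicNorm Q x + dyadicNorm Q y := by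
  rw [dyadicNorm, dyadicNorm, dyadicNorm, ← ENNReal.tsum_add]
  refine ENNReal.tsum_le_tsum fun r => ?_
  rw [map_add, ← mul_add]
  exact mul_le_mul_right (enorm_add_le _ _) _

lemma sqrt_two_inv_lt_one : (√2)⁻¹ < 1 := by
  refine inv_lt_one_of_one_lt₀ ?_
  rw [Real.lt_sqrt (by norm_num)]; norm_num

lemma summable_sqrt_two_inv_pow : Summable fun r : ℕ => (√2)⁻¹ ^ r :=
  summable_geometric_of_lt_one (by positivity) sqrt_two_inv_lt_one

/-- The sums of a coboundary telescope and stay bounded by `2‖x‖`. Hence `h ↦ h - Q h` is continuous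
from the original norm to the dyadic one, which permits replacing `h` by a bounded function. -/
lemma dyadicNorm_coboundary_le (hQ : ‖Q‖ ≤ 1) (x : E) :
    dyadicNorm Q (x - Q x) ≤ ENNReal.ofReal ((∑' r : ℕ, (√2)⁻¹ ^ r) * (2 * ‖x‖)) := by
  have hle : ∀ r : ℕ, (√2)⁻¹ ^ r * ‖powSum Q (2 ^ r) (x - Q x)‖ ≤ (√2)⁻¹ ^ r * (2 * ‖x‖) := by
    intro r
    refine mul_le_mul_of_nonneg_left ?_ (by positivity)
    rw [powSum_sub]
    refine (norm_sub_le _ _).trans ?_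
    linarith [norm_pow_apply_le hQ (2 ^ r) x]
  have hs1 := summable_sqrt_two_inv_pow.mul_right (2 * ‖x‖)
  have hs := Summable.of_nonneg_of_le (fun r => by positivity) hle hs1
  rw [dyadicNorm_eq_ofReal hs, ← tsum_mul_right]
  exact ENNReal.ofReal_le_ofReal (hs.tsum_le_tsum hle hs1)

lemma dyadicNorm_sub_coboundary_le (hQ : ‖Q‖ ≤ 1) (x h y : E) :
    dyadicNorm Q (x - (y - Q y)) ≤ dyadicNorm Q (x - (h - Q h)) +
      ENNReal.ofReal ((∑' r : ℕ, (√2)⁻¹ ^ r) * (2 * ‖h - y‖)) := by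
  have hdecomp : x - (y - Q y) = (x - (h - Q h)) + ((h - y) - Q (h - y)) := by
    rw [map_sub]; abel
  rw [hdecomp]
  exact (dyadicNorm_add_le _ _).trans (add_le_add_right (dyadicNorm_coboundary_le hQ _) _)

/-- Coboundaries approximate any vector with finite dyadic norm. -/
lemma exists_dyadicNorm_sub_coboundary_lt (hQ : ‖Q‖ ≤ 1) {x : E}
    (hs : Summable fun r : ℕ => (√2)⁻¹ ^ r * ‖powSum Q (2 ^ r) x‖)
    {K : Submodule ℂ E} (hx : x ∈ K) (hQK : ∀ y, Q y ∈ K) {ε : ℝ≥0∞} (hε : 0 < ε) :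
    ∃ h ∈ K, dyadicNorm Q (x - (h - Q h)) < ε := by
  -- The Cesàro mean `y s` differs from `x` by a coboundary, so it is enough that its dyadic norm
  -- tends to `0`. This follows by dominated convergence over `r`.
  set y : ℕ → E := fun s => ((2 : ℂ) ^ s)⁻¹ • powSum Q (2 ^ s) x with hy
  have hny : ∀ s, ‖y s‖ = ((2 : ℝ) ^ s)⁻¹ * ‖powSum Q (2 ^ s) x‖ := fun s => by
    simp [hy, norm_smul]
  have hy0 : Tendsto (fun s => ‖y s‖) atTop (𝓝 0) := by
    refine squeeze_zero (fun s => norm_nonneg _) (fun s => ?_) hs.tendsto_atTop_zero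
    rw [hny]
    refine mul_le_mul_of_nonneg_right ?_ (norm_nonneg _)
    rw [← inv_pow]
    refine pow_le_pow_left₀ (by norm_num) ?_ s
    refine inv_anti₀ (by positivity) ?_
    rw [Real.sqrt_le_left (by norm_num)]; norm_num
  -- The dominating series: averaging commutes with `powSum Q (2 ^ r)` and is a contraction.
  have hVy : ∀ r s, ‖powSum Q (2 ^ r) (y s)‖ ≤ ‖powSum Q (2 ^ r) x‖ := by
    intro r s
    have : powSum Q (2 ^ r) (y s) = ((2 : ℂ) ^ s)⁻¹ • powSum Q (2 ^ s) (powSum Q (2 ^ r) x) := by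
      rw [hy, map_smul, powSum_comm]
    rw [this, norm_smul]
    have h1 := norm_powSum_le hQ (2 ^ s) (powSum Q (2 ^ r) x)
    simp only [norm_inv, norm_pow, RCLike.norm_ofNat]
    rw [inv_mul_le_iff₀ (by positivity)]
    exact_mod_cast h1
  have htend : Tendsto (fun s => ∑' r : ℕ, (√2)⁻¹ ^ r * ‖powSum Q (2 ^ r) (y s)‖) atTop
      (𝓝 (∑' r : ℕ, (0 : ℝ))) := by
    refine tendsto_tsum_of_dominated_convergence hs (fun r => ?_) (Eventually.of_forall fun s r => ?_)
    · have h0 : Tendsto (fun s => (√2)⁻¹ ^ r * (((2 ^ r : ℕ) : ℝ) * ‖y s‖)) atTop (𝓝 0) := by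
        simpa using (hy0.const_mul ((2 ^ r : ℕ) : ℝ)).const_mul ((√2)⁻¹ ^ r)
      exact squeeze_zero (fun s => by positivity)
        (fun s => mul_le_mul_of_nonneg_left (norm_powSum_le hQ _ _) (by positivity)) h0
    · rw [Real.norm_of_nonneg (by positivity)]
      exact mul_le_mul_of_nonneg_left (hVy r s) (by positivity)
  have hsum : ∀ s, Summable fun r : ℕ => (√2)⁻¹ ^ r * ‖powSum Q (2 ^ r) (y s)‖ := fun s =>
    Summable.of_nonneg_of_le (fun r => by positivity)
      (fun r => mul_le_mul_of_nonneg_left (hVy r s) (by positivity)) hs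
  rw [tsum_zero] at htend
  have htend' := ENNReal.tendsto_ofReal htend
  rw [ENNReal.ofReal_zero] at htend'
  obtain ⟨s, hsε⟩ := (htend'.eventually_lt_const hε).exists
  have hpow : ∀ j, (Q ^ j) x ∈ K := fun j => by
    rcases j with _ | j
    · simpa using hx
    · rw [pow_succ']; exact hQK _
  have hpS : ∀ j, powSum Q j x ∈ K := fun j => by
    simp only [powSum, _root_.sum_apply]
    exact K.sum_mem fun i _ => hpow i
  -- This solves `x - y s = h - Q h`, since `x - Q^j x` is the coboundary of `powSum Q j x`.
  refine ⟨((2 : ℂ) ^ s)⁻¹ • ∑ j ∈ Finset.range (2 ^ s), powSum Q j x,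
    K.smul_mem _ (K.sum_mem fun j _ => hpS j), ?_⟩
  have hxy : x - (((2 : ℂ) ^ s)⁻¹ • ∑ j ∈ Finset.range (2 ^ s), powSum Q j x -
      Q (((2 : ℂ) ^ s)⁻¹ • ∑ j ∈ Finset.range (2 ^ s), powSum Q j x)) = y s := by
    rw [map_smul, map_sum, ← smul_sub, ← Finset.sum_sub_distrib]
    have : ∀ j, powSum Q j x - Q (powSum Q j x) = x - (Q ^ j) x := fun j => by
      rw [apply_powSum, ← map_sub, powSum_sub]
    simp only [this]
    rw [Finset.sum_sub_distrib]
    simp [hy, powSum, smul_sub, ← Nat.cast_smul_eq_nsmul ℂ, smul_smul]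
  rw [hxy, dyadicNorm_eq_ofReal (hsum s)]
  exact hsε

end Contraction

/-! ### From the abstract contraction to conditional expectations. -/

section Transfer

variable {Ω : Type*} {F₀ : MeasurableSpace Ω} [mΩ : MeasurableSpace Ω] {P : Measure Ω}
  {S : Ω → Ω} {c : ℂ}

/-- The operator `f ↦ E[c f ∘ S | F₀]` on `L²`. -/
noncomputable def condShift (hF₀ : F₀ ≤ mΩ) (hS : MeasurePreserving S P P) (c : ℂ) :
    Lp ℂ 2 P →L[ℂ] Lp ℂ 2 P :=
  (lpMeas ℂ ℂ F₀ 2 P).subtypeL ∘L condExpL2 ℂ ℂ hF₀ ∘L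
    (c • (Lp.compMeasurePreservingₗᵢ ℂ S hS).toContinuousLinearMap)

lemma norm_condShift_le (hF₀ : F₀ ≤ mΩ) (hS : MeasurePreserving S P P) (hc : ‖c‖ = 1) :
    ‖condShift hF₀ hS c‖ ≤ 1 := by
  refine ContinuousLinearMap.opNorm_le_bound _ zero_le_one fun f => ?_
  rw [one_mul]
  refine (norm_condExpL2_le hF₀ _).trans (le_of_eq ?_)
  simp [norm_smul, hc]

lemma condShift_mem (hF₀ : F₀ ≤ mΩ) (hS : MeasurePreserving S P P) (f : Lp ℂ 2 P) :
    condShift hF₀ hS c f ∈ lpMeas ℂ ℂ F₀ 2 P := by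
  exact Subtype.property (condExpL2 ℂ ℂ hF₀
    ((c • (Lp.compMeasurePreservingₗᵢ ℂ S hS).toContinuousLinearMap) f))

variable [IsProbabilityMeasure P]

lemma condShift_ae_eq (hF₀ : F₀ ≤ mΩ) (hS : MeasurePreserving S P P) {f : Lp ℂ 2 P}
    {g : Ω → ℂ} (hfg : f =ᵐ[P] g) :
    condShift hF₀ hS c f =ᵐ[P] P[fun y => c * g (S y) | F₀] := by
  set u : Lp ℂ 2 P := c • Lp.compMeasurePreserving S hS f with hu
  have h1 : (condShift hF₀ hS c f : Ω → ℂ) = (condExpL2 ℂ ℂ hF₀ u : Lp ℂ 2 P) := rfl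
  have h2 : u =ᵐ[P] fun y => c * g (S y) := by
    filter_upwards [Lp.coeFn_smul c (Lp.compMeasurePreserving S hS f),
      Lp.coeFn_compMeasurePreserving f hS, hS.quasiMeasurePreserving.ae_eq_comp hfg]
      with x h1 h2 h3
    rw [hu, h1, Pi.smul_apply, h2, h3]
    simp
  have h3 := (Lp.memLp u).condExpL2_ae_eq_condExp (𝕜 := ℂ) hF₀
  rw [Lp.toLp_coeFn] at h3
  rw [h1]
  exact h3.trans (condExp_congr_ae h2)

lemma powSum_condShift_ae_eq (hF₀ : F₀ ≤ mΩ) (hS : MeasurePreserving S P P)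
    (hSF : F₀ ≤ F₀.comap S) {f : Ω → ℂ} (hf : StronglyMeasurable[F₀] f) (hf2 : MemLp f 2 P)
    (n : ℕ) :
    powSum (condShift hF₀ hS c) n hf2.toLp =ᵐ[P] P[twistSum S c n f | F₀] := by
  induction n with
  | zero =>
    have h0 : twistSum S c 0 f = 0 := by ext x; simp [twistSum]
    rw [h0, condExp_zero]
    simp only [powSum, Finset.range_zero, Finset.sum_empty]
    exact Lp.coeFn_zero _ _ _
  | succ n ih =>
    have h1 := condExp_twistSum_add (c := c) hF₀ hS hSF hf2 1 n
    have h2 : twistSum S c 1 f = f := by ext x; simp [twistSum]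
    rw [h2, condExp_of_stronglyMeasurable hF₀ hf (hf2.integrable (by norm_num)), add_comm 1 n] at h1
    rw [powSum_succ']
    filter_upwards [h1, condShift_ae_eq (c := c) hF₀ hS ih, hf2.coeFn_toLp,
      Lp.coeFn_add hf2.toLp (condShift hF₀ hS c (powSum (condShift hF₀ hS c) n hf2.toLp))]
      with x h1 h2 h3 h4
    rw [h1, h4, Pi.add_apply, h2, h3]
    simp

lemma dyadicNorm_condShift (hF₀ : F₀ ≤ mΩ) (hS : MeasurePreserving S P P)
    (hSF : F₀ ≤ F₀.comap S) {f : Ω → ℂ} (hf : StronglyMeasurable[F₀] f) (hf2 : MemLp f 2 P) :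
    dyadicNorm (condShift hF₀ hS c) hf2.toLp = twistNorm F₀ P S c f := by
  rw [dyadicNorm, twistNorm]
  congr 1 with r
  rw [Lp.enorm_def, eLpNorm_congr_ae (powSum_condShift_ae_eq hF₀ hS hSF hf hf2 _)]
  rfl

/-- An `L²` function measurable for a sub-σ-algebra is approximated by bounded ones. -/
lemma exists_bounded_norm_sub_lt (hF₀ : F₀ ≤ mΩ) {h : Lp ℂ 2 P} (hh : h ∈ lpMeas ℂ ℂ F₀ 2 P)
    {ε : ℝ} (hε : 0 < ε) :
    ∃ g : Ω → ℂ, StronglyMeasurable[F₀] g ∧ (∃ K, ∀ x, ‖g x‖ ≤ K) ∧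
      ∃ hg : MemLp g 2 P, ‖h - hg.toLp‖ < ε := by
  have hm : AEStronglyMeasurable[F₀] h P := mem_lpMeas_iff_aestronglyMeasurable.1 hh
  set h' := hm.mk h with hh'
  have hm' : StronglyMeasurable[F₀] h' := hm.stronglyMeasurable_mk
  have hmem : MemLp h' 2 P := (memLp_congr_ae hm.ae_eq_mk).1 (Lp.memLp h)
  have hmemt : @MemLp Ω ℂ F₀ _ _ h' 2 (P.trim hF₀) :=
    ⟨hm'.aestronglyMeasurable, by rw [eLpNorm_trim hF₀ hm']; exact hmem.2⟩
  obtain ⟨s, hs, -⟩ := @MemLp.exists_simpleFunc_eLpNorm_sub_lt Ω F₀ 2 ℂ _ h' (P.trim hF₀) hmemt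
    (by norm_num) (ENNReal.ofReal ε) (by simpa using hε)
  have hsm : StronglyMeasurable[F₀] s := @SimpleFunc.stronglyMeasurable Ω ℂ F₀ _ s
  rw [eLpNorm_trim hF₀ (hm'.sub hsm)] at hs
  obtain ⟨K, hK⟩ := @SimpleFunc.exists_forall_norm_le Ω ℂ F₀ _ s
  have hs2 : MemLp s 2 P := MemLp.of_bound (hsm.mono hF₀).aestronglyMeasurable K (ae_of_all _ hK)
  refine ⟨s, hsm, ⟨K, hK⟩, hs2, ?_⟩
  have h1 : h = hmem.toLp := by
    refine Lp.ext (hm.ae_eq_mk.trans hmem.coeFn_toLp.symm)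
  rw [h1, ← MemLp.toLp_sub, Lp.norm_toLp]
  exact (ENNReal.toReal_lt_of_lt_ofReal hs)

/-- Coboundaries of bounded functions approximate a function satisfying the Maxwell–Woodroofe
condition. -/
lemma exists_bounded_twistNorm_sub_lt (hF₀ : F₀ ≤ mΩ) (hS : MeasurePreserving S P P)
    (hSF : F₀ ≤ F₀.comap S) (hc : ‖c‖ = 1) {f : Ω → ℂ} (hf : StronglyMeasurable[F₀] f)
    (hf2 : MemLp f 2 P)
    (hMW : Summable fun k : ℕ => 1 / ((k + 1 : ℕ) : ℝ) ^ (3 / 2 : ℝ) *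
      (eLpNorm (P[fun x => c * twistSum S c (k + 1) f (S x) | F₀]) 2 P).toReal)
    {ε : ℝ} (hε : 0 < ε) :
    ∃ h : Ω → ℂ, StronglyMeasurable[F₀] h ∧ (∃ K, ∀ x, ‖h x‖ ≤ K) ∧
      ∀ e : Ω → ℂ, StronglyMeasurable[F₀] e → e =ᵐ[P] P[fun y => c * h (S y) | F₀] →
      twistNorm F₀ P S c (fun x => f x - (h x - e x)) < ENNReal.ofReal ε := by
  set Q := condShift hF₀ hS c with hQ
  have hQ1 : ‖Q‖ ≤ 1 := norm_condShift_le hF₀ hS hc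
  have hterm : ∀ n, ‖Q (powSum Q n hf2.toLp)‖ =
      (eLpNorm (P[fun x => c * twistSum S c n f (S x) | F₀]) 2 P).toReal := by
    intro n
    rw [Lp.norm_def]
    congr 1
    refine eLpNorm_congr_ae ((condShift_ae_eq hF₀ hS
      (powSum_condShift_ae_eq hF₀ hS hSF hf hf2 n)).trans ?_)
    have hi := (MemLp.twistSum (c := c) hS hf2 n).integrable (by norm_num)
    have h1 := condExp_comp_condExp hF₀ hS hSF (hi.smul c)
    refine EventuallyEq.trans (condExp_congr_ae ?_) h1
    exact (hS.quasiMeasurePreserving.ae_eq_comp (condExp_smul c _ F₀)).symm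
  have hsum : Summable fun r : ℕ => (√2)⁻¹ ^ r * ‖powSum Q (2 ^ r) hf2.toLp‖ := by
    refine summable_dyadic_powSum hQ1 _ ?_
    simp only [hterm]
    exact hMW
  have hfK : hf2.toLp ∈ lpMeas ℂ ℂ F₀ 2 P := by
    rw [mem_lpMeas_iff_aestronglyMeasurable]
    exact hf.aestronglyMeasurable.congr hf2.coeFn_toLp.symm
  obtain ⟨h₁, hh₁, hlt₁⟩ := exists_dyadicNorm_sub_coboundary_lt hQ1 hsum hfK
    (condShift_mem hF₀ hS) (ENNReal.ofReal_pos.2 (half_pos hε))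
  set C := (∑' r : ℕ, (√2)⁻¹ ^ r) * 2 with hC
  have hC0 : 0 ≤ C := mul_nonneg (tsum_nonneg fun r => by positivity) (by norm_num)
  -- `C` is the constant of `dyadicNorm_coboundary_le`, so this tolerance costs at most `ε / 2` in
  -- the dyadic norm.
  obtain ⟨h, hhm, hhb, hh2, hlt⟩ := exists_bounded_norm_sub_lt hF₀ hh₁
    (show 0 < ε / 2 / (C + 1) by positivity)
  refine ⟨h, hhm, hhb, fun e hem he => ?_⟩
  have heq : Q hh2.toLp =ᵐ[P] e := (condShift_ae_eq hF₀ hS hh2.coeFn_toLp).trans he.symm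
  have he2 : MemLp e 2 P := (memLp_congr_ae heq).1 (Lp.memLp _)
  have hg2 : MemLp (fun x => f x - (h x - e x)) 2 P := hf2.sub (hh2.sub he2)
  have hQe : Q hh2.toLp = he2.toLp := Lp.ext (heq.trans he2.coeFn_toLp.symm)
  have hgm : StronglyMeasurable[F₀] fun x => f x - (h x - e x) := hf.sub (hhm.sub hem)
  rw [← dyadicNorm_condShift hF₀ hS hSF hgm hg2]
  have hdecomp : hg2.toLp = hf2.toLp - (hh2.toLp - Q hh2.toLp) := by rw [hQe]; rfl
  rw [hdecomp]
  refine (dyadicNorm_sub_coboundary_le hQ1 hf2.toLp h₁ hh2.toLp).trans_lt ?_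
  have hsplit : ENNReal.ofReal ε = ENNReal.ofReal (ε / 2) + ENNReal.ofReal (ε / 2) := by
    rw [← ENNReal.ofReal_add (by positivity) (by positivity), add_halves]
  rw [hsplit]
  refine ENNReal.add_lt_add_of_lt_of_le ENNReal.ofReal_ne_top hlt₁ (ENNReal.ofReal_le_ofReal ?_)
  rw [← mul_assoc, ← hC]
  have h1 : C * ‖h₁ - hh2.toLp‖ ≤ (C + 1) * (ε / 2 / (C + 1)) :=
    mul_le_mul (by linarith) hlt.le (norm_nonneg _) (by positivity)
  rwa [mul_div_cancel₀ _ (show C + 1 ≠ 0 by positivity)] at h1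

end Transfer

/-! ### Twisted pointwise ergodic theorems for bounded functions. -/

section WeightedBirkhoff

variable {Ω : Type*} {S : Ω → Ω} {c : ℂ} {F : Ω → ℂ}

/-- Averaged over `j < m`, this exhibits `F` minus its twisted mean of length `m` as a coboundary of
a bounded function. -/
lemma twistSum_sub_mul_comp (j : ℕ) (ω : Ω) :
    twistSum S c j F ω - c * twistSum S c j F (S ω) = F ω - c ^ j * F (S^[j] ω) := by
  have h1 := twistSum_succ (S := S) (c := c) j F ω
  have h2 := twistSum_add (S := S) (c := c) 1 j F ω
  rw [add_comm 1 j, h1, twistSum_one] at h2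
  simp only [pow_one, Function.iterate_one] at h2
  linear_combination h2

lemma norm_twistSum_le (hc : ‖c‖ = 1) (n : ℕ) (ω : Ω) :
    ‖twistSum S c n F ω‖ ≤ birkhoffSum S (fun x => ‖F x‖) n ω := by
  refine (norm_sum_le _ _).trans (le_of_eq ?_)
  simp [birkhoffSum, hc]

lemma norm_twistSum_le_of_bound (hc : ‖c‖ = 1) {K : ℝ} (hF : ∀ x, ‖F x‖ ≤ K) (n : ℕ) (ω : Ω) :
    ‖twistSum S c n F ω‖ ≤ n * K := by
  refine (norm_twistSum_le hc n ω).trans ?_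
  refine (Finset.sum_le_sum fun j _ => hF _).trans ?_
  simp

lemma twistSum_coboundary (h : Ω → ℂ) (n : ℕ) (ω : Ω) :
    twistSum S c n (fun x => h x - c * h (S x)) ω = h ω - c ^ n * h (S^[n] ω) := by
  induction n with
  | zero => simp [twistSum_zero]
  | succ n ih => rw [twistSum_succ, ih, Function.iterate_succ_apply']; ring

variable [mΩ : MeasurableSpace Ω] {P : Measure Ω}

/-- Pointwise convergence of twisted averages of a bounded function, given mean convergence to a
constant. -/
lemma ae_tendsto_twistSum_of_mean [IsProbabilityMeasure P] (hS : MeasurePreserving S P P)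
    (hc : ‖c‖ = 1) (hFm : StronglyMeasurable F) {K : ℝ} (hF : ∀ x, ‖F x‖ ≤ K) {p : ℂ}
    (hp : c * p = p)
    (hmean : Tendsto (fun m : ℕ => eLpNorm (fun x => (m : ℂ)⁻¹ * twistSum S c m F x - p) 2 P)
      atTop (𝓝 0)) :
    ∀ᵐ ω ∂P, Tendsto (fun n : ℕ => (n : ℂ)⁻¹ * twistSum S c n F ω) atTop (𝓝 p) := by
  set G : ℕ → Ω → ℂ := fun m x => (m : ℂ)⁻¹ * twistSum S c m F x - p with hG
  have hGm : ∀ m, StronglyMeasurable (G m) := fun m =>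
    ((StronglyMeasurable.twistSum_of_measurable hS.measurable hFm m).const_mul _).sub
      stronglyMeasurable_const
  have hG2 : ∀ m, MemLp (G m) 2 P := fun m =>
    ((MemLp.twistSum hS (MemLp.of_bound hFm.aestronglyMeasurable K (ae_of_all _ hF)) m).const_mul
      _).sub (memLp_const p)
  -- Replacing `F` by its mean of length `m` changes the sums by a bounded amount, and `c * p = p`
  -- makes the twisted sum of the constant `p` equal to `n p`.
  have hbound : ∀ m : ℕ, 0 < m → ∃ C : ℝ, 0 ≤ C ∧ ∀ n : ℕ, ∀ ω,
      ‖twistSum S c n F ω - n * p‖ ≤ birkhoffSum S (fun x => ‖G m x‖) n ω + C := by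
    intro m hm
    set h : Ω → ℂ := fun x => (m : ℂ)⁻¹ * ∑ j ∈ Finset.range m, twistSum S c j F x with hh
    have hhb : ∃ C, ∀ x, ‖h x‖ ≤ C := by
      refine ⟨‖(m : ℂ)⁻¹‖ * ∑ j ∈ Finset.range m, (j : ℝ) * K, fun x => ?_⟩
      rw [hh, norm_mul]
      exact mul_le_mul_of_nonneg_left ((norm_sum_le _ _).trans
        (Finset.sum_le_sum fun j _ => norm_twistSum_le_of_bound hc hF j x)) (norm_nonneg _)
    obtain ⟨C, hC⟩ := hhb
    refine ⟨2 * |C|, by positivity, fun n ω => ?_⟩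
    have hm0 : (m : ℂ) ≠ 0 := by exact_mod_cast hm.ne'
    have hcob : ∀ x, h x - c * h (S x) = F x - (m : ℂ)⁻¹ * twistSum S c m F x := by
      intro x
      have : h x - c * h (S x) = (m : ℂ)⁻¹ * ∑ j ∈ Finset.range m,
          (twistSum S c j F x - c * twistSum S c j F (S x)) := by
        rw [Finset.sum_sub_distrib, ← Finset.mul_sum, hh]; ring
      rw [this]
      simp only [twistSum_sub_mul_comp]
      rw [Finset.sum_sub_distrib, mul_sub]
      simp [twistSum, hm0]
    have hconst : ∀ ω, twistSum S c n (fun _ => p) ω = n * p := by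
      intro ω
      have : ∀ j : ℕ, c ^ j * p = p := fun j => by
        induction j with
        | zero => simp
        | succ j ih => rw [pow_succ, mul_assoc, hp, ih]
      simp [twistSum, this]
    have hdec : twistSum S c n F ω - n * p =
        twistSum S c n (G m) ω + (h ω - c ^ n * h (S^[n] ω)) := by
      rw [← twistSum_coboundary, ← twistSum_add_fun, ← hconst ω, ← twistSum_sub_fun]
      congr 1
      ext x
      rw [hcob, hG]; ring
    rw [hdec]
    refine (norm_add_le _ _).trans (add_le_add (norm_twistSum_le hc n ω) ?_)
    refine (norm_sub_le _ _).trans ?_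
    rw [norm_mul (c ^ n), norm_pow, hc, one_pow, one_mul]
    linarith [(hC ω).trans (le_abs_self C), (hC (S^[n] ω)).trans (le_abs_self C)]
  have hbad : ∀ ε : ℝ, 0 < ε →
      ∀ᵐ ω ∂P, ∀ᶠ n : ℕ in atTop, ‖(n : ℂ)⁻¹ * twistSum S c n F ω - p‖ ≤ 2 * ε := by
    intro ε hε
    rw [ae_iff]
    have hlim : Tendsto (fun m => eLpNorm (G m) 2 P / ENNReal.ofReal ε) atTop (𝓝 0) := by
      have h0 : ENNReal.ofReal ε ≠ 0 := by simpa using hε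
      have := ENNReal.Tendsto.div_const hmean (Or.inr h0)
      simpa using this
    refine le_antisymm (ge_of_tendsto hlim ?_) bot_le
    filter_upwards [eventually_gt_atTop 0] with m hm
    obtain ⟨C, hC0, hC⟩ := hbound m hm
    have hGi : Integrable (G m) P := (hG2 m).integrable (by norm_num)
    -- The set where the averages exceed `2ε` infinitely often does not depend on `m`. Its measure
    -- is at most `‖G m‖₁ / ε`, and mean convergence sends this to `0`.
    have hmax := measure_exists_birkhoffSum_le hS (fun x => norm_nonneg (G m x))
      (hGm m).norm.measurable hGi.norm hε
    refine (measure_mono ?_).trans (hmax.trans ?_)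
    · intro ω hω
      by_contra hcon
      refine hω ?_
      simp only [Set.mem_ofPred_eq, not_exists, not_lt] at hcon
      have hCn : ∀ᶠ n : ℕ in atTop, C / ε ≤ n := (tendsto_natCast_atTop_atTop).eventually_ge_atTop _
      filter_upwards [hCn, eventually_gt_atTop 0] with n hn hn0
      have hn0' : (0 : ℝ) < n := by exact_mod_cast hn0
      have hnc : (n : ℂ) ≠ 0 := by exact_mod_cast hn0.ne'
      have e : (n : ℂ)⁻¹ * twistSum S c n F ω - p = (n : ℂ)⁻¹ * (twistSum S c n F ω - n * p) := by
        rw [mul_sub, inv_mul_cancel_left₀ hnc]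
      rw [e, norm_mul, norm_inv, Complex.norm_natCast, inv_mul_le_iff₀ hn0']
      rw [div_le_iff₀ hε] at hn
      linarith [hC n ω, hcon n]
    · refine ENNReal.div_le_div_right ?_ _
      calc ENNReal.ofReal (∫ x, ‖G m x‖ ∂P) = eLpNorm (G m) 1 P := by
            rw [ofReal_integral_norm_eq_lintegral_enorm hGi, eLpNorm_one_eq_lintegral_enorm]
        _ ≤ eLpNorm (G m) 2 P :=
            eLpNorm_le_eLpNorm_of_exponent_le (by norm_num) (hGm m).aestronglyMeasurable
  have hall := ae_all_iff.2 fun k : ℕ => hbad (1 / ((k : ℝ) + 1)) (by positivity)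
  filter_upwards [hall] with ω hω
  rw [Metric.tendsto_nhds]
  intro ε hε
  obtain ⟨k, hk⟩ := exists_nat_one_div_lt (half_pos hε)
  filter_upwards [hω k] with n hn
  rw [dist_eq_norm]
  linarith

/-- Twisted pointwise ergodic theorem for bounded functions, when all the invariant vectors of the
twisted Koopman operator are constant. -/
lemma exists_ae_tendsto_twistSum [IsProbabilityMeasure P] (hS : MeasurePreserving S P P)
    (hc : ‖c‖ = 1) (hFm : StronglyMeasurable F) {K : ℝ} (hF : ∀ x, ‖F x‖ ≤ K)
    (hfix : ∀ g : Lp ℂ 2 P, c • Lp.compMeasurePreserving S hS g = g →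
      ∃ p : ℂ, c * p = p ∧ g =ᵐ[P] fun _ => p) :
    ∃ p : ℂ, c * p = p ∧
      ∀ᵐ ω ∂P, Tendsto (fun n : ℕ => (n : ℂ)⁻¹ * twistSum S c n F ω) atTop (𝓝 p) := by
  set U : Lp ℂ 2 P →L[ℂ] Lp ℂ 2 P :=
    c • (Lp.compMeasurePreservingₗᵢ ℂ S hS).toContinuousLinearMap with hU
  have hUapp : ∀ g, U g = c • Lp.compMeasurePreserving S hS g := fun g => rfl
  have hU1 : ‖U‖ ≤ 1 := ContinuousLinearMap.opNorm_le_bound _ zero_le_one fun g => by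
    rw [hUapp, norm_smul, hc, Lp.norm_compMeasurePreserving]
  have hF2 : MemLp F 2 P := MemLp.of_bound hFm.aestronglyMeasurable K (ae_of_all _ hF)
  -- Von Neumann's theorem for the twisted operator: the mean limit is a fixed vector, hence the
  -- constant provided by `hfix`.
  have hconv := U.tendsto_birkhoffAverage_orthogonalProjection hU1 hF2.toLp
  set g : Lp ℂ 2 P := Subtype.val ((U.eqLocus
    (1 : Lp ℂ 2 P →L[ℂ] Lp ℂ 2 P)).orthogonalProjectionOnto hF2.toLp) with hg
  have hgfix : U g = g :=
    ((U.eqLocus (1 : Lp ℂ 2 P →L[ℂ] Lp ℂ 2 P)).orthogonalProjectionOnto hF2.toLp).2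
  obtain ⟨p, hp, hgp⟩ := hfix g hgfix
  refine ⟨p, hp, ae_tendsto_twistSum_of_mean hS hc hFm hF hp ?_⟩
  have hiter : ∀ j : ℕ, (U^[j] hF2.toLp : Lp ℂ 2 P) =ᵐ[P] fun x => c ^ j * F (S^[j] x) := by
    intro j
    induction j with
    | zero => simpa using hF2.coeFn_toLp
    | succ j ih =>
      rw [Function.iterate_succ_apply', hUapp]
      filter_upwards [Lp.coeFn_smul c (Lp.compMeasurePreserving S hS (U^[j] hF2.toLp)),
        Lp.coeFn_compMeasurePreserving (U^[j] hF2.toLp) hS,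
        hS.quasiMeasurePreserving.ae_eq_comp ih] with x h1 h2 h3
      rw [h1, Pi.smul_apply, h2, h3]
      simp [pow_succ', mul_assoc]
  have hsum : ∀ n : ℕ, (birkhoffSum U _root_.id n hF2.toLp : Lp ℂ 2 P) =ᵐ[P]
      twistSum S c n F := by
    intro n
    induction n with
    | zero =>
      have : twistSum S c 0 F = 0 := by ext x; simp [twistSum]
      rw [this, birkhoffSum_zero]
      exact Lp.coeFn_zero _ _ _
    | succ n ih =>
      rw [birkhoffSum_succ]
      filter_upwards [Lp.coeFn_add (birkhoffSum U _root_.id n hF2.toLp) (U^[n] hF2.toLp), ih,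
        hiter n] with x h1 h2 h3
      rw [id, h1, Pi.add_apply, h2, h3, twistSum_succ]
  have hav : ∀ n : ℕ, ((birkhoffAverage ℂ U _root_.id n hF2.toLp - g : Lp ℂ 2 P)) =ᵐ[P]
      fun x => (n : ℂ)⁻¹ * twistSum S c n F x - p := by
    intro n
    have e : birkhoffAverage ℂ U _root_.id n hF2.toLp =
      (n : ℂ)⁻¹ • birkhoffSum U _root_.id n hF2.toLp := rfl
    rw [e]
    filter_upwards [Lp.coeFn_sub ((n : ℂ)⁻¹ • birkhoffSum U _root_.id n hF2.toLp) g,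
      Lp.coeFn_smul (n : ℂ)⁻¹ (birkhoffSum U _root_.id n hF2.toLp), hsum n, hgp]
      with x h1 h2 h3 h4
    rw [h1, Pi.sub_apply, h2, Pi.smul_apply, h3, h4, smul_eq_mul]
  have h0 := tendsto_iff_norm_sub_tendsto_zero.1 hconv
  have h1 := ENNReal.tendsto_ofReal h0
  rw [ENNReal.ofReal_zero] at h1
  refine h1.congr fun n => ?_
  rw [← eLpNorm_congr_ae (hav n), Lp.norm_def, ENNReal.ofReal_toReal (Lp.eLpNorm_ne_top _)]

/-- Birkhoff's theorem for bounded functions of an ergodic transformation. -/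
lemma Ergodic.ae_tendsto_twistSum_one [IsProbabilityMeasure P] (hS : Ergodic S P)
    (hFm : StronglyMeasurable F) {K : ℝ} (hF : ∀ x, ‖F x‖ ≤ K) :
    ∀ᵐ ω ∂P, Tendsto (fun n : ℕ => (n : ℂ)⁻¹ * twistSum S 1 n F ω) atTop
      (𝓝 (∫ x, F x ∂P)) := by
  have hmp := hS.toMeasurePreserving
  obtain ⟨p, -, hp⟩ := exists_ae_tendsto_twistSum (c := 1) hmp (by simp) hFm hF (by
    intro g hg
    rw [one_smul] at hg
    have h1 := Lp.coeFn_compMeasurePreserving g hmp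
    rw [hg] at h1
    obtain ⟨p, hp⟩ := hS.ae_eq_const_of_ae_eq_comp_ae (Lp.aestronglyMeasurable g) h1.symm
    exact ⟨p, one_mul _, hp⟩)
  have hF2 : MemLp F 2 P := MemLp.of_bound hFm.aestronglyMeasurable K (ae_of_all _ hF)
  have hlim : Tendsto (fun n : ℕ => ∫ ω, (n : ℂ)⁻¹ * twistSum S 1 n F ω ∂P) atTop
      (𝓝 (∫ _, p ∂P)) := by
    refine tendsto_integral_of_dominated_convergence (fun _ => K) (fun n => ?_)
      (integrable_const _) (fun n => ae_of_all _ fun ω => ?_) hp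
    · exact ((StronglyMeasurable.twistSum_of_measurable hmp.measurable hFm n).const_mul
        _).aestronglyMeasurable
    · rw [norm_mul, norm_inv, Complex.norm_natCast]
      have hK : 0 ≤ K := (norm_nonneg _).trans (hF ω)
      rcases Nat.eq_zero_or_pos n with rfl | hn
      · simpa using hK
      · rw [inv_mul_le_iff₀ (by exact_mod_cast hn)]
        exact norm_twistSum_le_of_bound (by simp) hF n ω
  have hconst : ∀ n : ℕ, 0 < n →
      ∫ ω, (n : ℂ)⁻¹ * twistSum S 1 n F ω ∂P = ∫ x, F x ∂P := by
    intro n hn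
    have hi : ∀ j, Integrable (fun x => (1 : ℂ) ^ j * F (S^[j] x)) P := fun j =>
      ((hmp.iterate j).integrable_comp_of_integrable (hF2.integrable (by norm_num))).const_mul _
    rw [integral_const_mul]
    simp only [twistSum]
    rw [integral_finsetSum _ fun j _ => hi j]
    have : ∀ j, ∫ x, (1 : ℂ) ^ j * F (S^[j] x) ∂P = ∫ x, F x ∂P := by
      intro j
      have h1 := (hmp.iterate j).map_eq
      conv_rhs => rw [← h1]
      rw [integral_map (hmp.iterate j).measurable.aemeasurable hFm.aestronglyMeasurable]
      simp
    simp only [this, Finset.sum_const, Finset.card_range, nsmul_eq_mul]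
    rw [inv_mul_cancel_left₀]
    exact_mod_cast hn.ne'
  have hp' : p = ∫ x, F x ∂P := by
    refine tendsto_nhds_unique ?_ (tendsto_const_nhds.congr'
      ((eventually_gt_atTop 0).mono fun n hn => (hconst n hn).symm))
    simpa using hlim
  rw [← hp']
  exact hp

end WeightedBirkhoff

/-! ### Characteristic function estimates and McLeish's theorem. -/

section CharEstimates

lemma norm_prod_sub_prod_le_sum {a b : ℕ → ℂ} (ha : ∀ k, ‖a k‖ ≤ 1) (hb : ∀ k, ‖b k‖ ≤ 1) (n : ℕ) :
    ‖∏ k ∈ Finset.range n, a k - ∏ k ∈ Finset.range n, b k‖ ≤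
      ∑ k ∈ Finset.range n, ‖a k - b k‖ := by
  induction n with
  | zero => simp
  | succ n ih =>
    rw [Finset.prod_range_succ, Finset.prod_range_succ, Finset.sum_range_succ]
    have e : (∏ k ∈ Finset.range n, a k) * a n - (∏ k ∈ Finset.range n, b k) * b n =
        (∏ k ∈ Finset.range n, a k - ∏ k ∈ Finset.range n, b k) * a n +
        (∏ k ∈ Finset.range n, b k) * (a n - b n) := by ring
    rw [e]
    refine (norm_add_le _ _).trans (add_le_add ?_ ?_)
    · rw [norm_mul]
      exact (mul_le_of_le_one_right (norm_nonneg _) (ha n)).trans ih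
    · rw [norm_mul, norm_prod]
      exact mul_le_of_le_one_left (norm_nonneg _)
        (Finset.prod_le_one (fun k _ => norm_nonneg _) fun k _ => hb k)

lemma norm_one_add_I_mul_le (x : ℝ) : ‖1 + Complex.I * (x : ℂ)‖ ≤ Real.exp (x ^ 2 / 2) := by
  have h1 : ‖1 + Complex.I * (x : ℂ)‖ ^ 2 = 1 + x ^ 2 := by
    rw [← Complex.normSq_eq_norm_sq, Complex.normSq_apply]
    simp; ring
  refine le_of_sq_le_sq ?_ (Real.exp_pos _).le
  rw [h1, ← Real.exp_nat_mul]
  have := Real.add_one_le_exp (x ^ 2)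
  refine (by linarith : 1 + x ^ 2 ≤ Real.exp (x ^ 2)).trans (le_of_eq ?_)
  congr 1; push_cast; ring

/-- Both expressions agree up to second order. The cubic errors are `2/9` from the exponential
series, `1/2` from the product `ix · x²/2`, and `1/2` from expanding the Gaussian factor. -/
lemma norm_exp_I_mul_sub_le {x : ℝ} (hx : |x| ≤ 1) :
    ‖Complex.exp (Complex.I * x) - (1 + Complex.I * x) * Complex.exp (-(x : ℂ) ^ 2 / 2)‖ ≤
      2 * |x| ^ 3 := by
  have hx0 := abs_nonneg x
  have hnx : ‖Complex.I * (x : ℂ)‖ = |x| := by simp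
  have h1 : ‖Complex.exp (Complex.I * x) - (1 + Complex.I * x - (x : ℂ) ^ 2 / 2)‖ ≤
      |x| ^ 3 * (2 / 9) := by
    have := Complex.exp_bound (x := Complex.I * x) (by rw [hnx]; exact hx) (n := 3) (by norm_num)
    rw [hnx] at this
    have e : ∑ m ∈ Finset.range 3, (Complex.I * (x : ℂ)) ^ m / (m.factorial : ℂ) =
        1 + Complex.I * x - (x : ℂ) ^ 2 / 2 := by
      simp [Finset.sum_range_succ, mul_pow, Nat.factorial]
      ring
    rw [e] at this
    refine this.trans (le_of_eq ?_)
    norm_num [Nat.factorial]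
  have hx2 : |-(x ^ 2 / 2)| ≤ 1 := by
    rw [abs_neg, abs_of_nonneg (by positivity), ← sq_abs]
    nlinarith
  have h2 := Real.abs_exp_sub_one_sub_id_le hx2
  set δ : ℝ := Real.exp (-(x ^ 2 / 2)) - 1 - -(x ^ 2 / 2) with hδ
  have hδ' : |δ| ≤ |x| ^ 3 / 4 := by
    refine h2.trans ?_
    have : (-(x ^ 2 / 2)) ^ 2 = |x| ^ 3 * |x| / 4 := by
      rw [← pow_succ, show (3 + 1 : ℕ) = 2 * 2 by norm_num, pow_mul, sq_abs]; ring
    rw [this]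
    have : |x| ^ 3 * |x| ≤ |x| ^ 3 * 1 := mul_le_mul_of_nonneg_left hx (by positivity)
    linarith
  have he : Complex.exp (-(x : ℂ) ^ 2 / 2) = 1 - (x : ℂ) ^ 2 / 2 + δ := by
    have : Complex.exp (-(x : ℂ) ^ 2 / 2) = ((Real.exp (-(x ^ 2 / 2)) : ℝ) : ℂ) := by
      push_cast; congr 1; ring
    rw [this, hδ]; push_cast; ring
  have hdec : Complex.exp (Complex.I * x) - (1 + Complex.I * x) * Complex.exp (-(x : ℂ) ^ 2 / 2) =
      (Complex.exp (Complex.I * x) - (1 + Complex.I * x - (x : ℂ) ^ 2 / 2)) +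
      (Complex.I * (x : ℂ) ^ 3 / 2 - (1 + Complex.I * x) * δ) := by
    rw [he]; ring
  rw [hdec]
  have h3 : ‖Complex.I * (x : ℂ) ^ 3 / 2‖ = |x| ^ 3 / 2 := by simp
  have h4 : ‖(1 + Complex.I * (x : ℂ)) * δ‖ ≤ 2 * (|x| ^ 3 / 4) := by
    rw [norm_mul]
    refine mul_le_mul ?_ (by simpa using hδ') (norm_nonneg _) (by norm_num)
    refine (norm_add_le _ _).trans ?_
    rw [hnx, norm_one]; linarith
  refine (norm_add_le _ _).trans ?_
  have h5 := (norm_sub_le (Complex.I * (x : ℂ) ^ 3 / 2) ((1 + Complex.I * x) * δ))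
  have : 0 ≤ |x| ^ 3 := by positivity
  linarith

lemma norm_one_add_I_mul_mul_exp_le (x : ℝ) :
    ‖(1 + Complex.I * (x : ℂ)) * Complex.exp (-(x : ℂ) ^ 2 / 2)‖ ≤ 1 := by
  have e : Complex.exp (-(x : ℂ) ^ 2 / 2) = ((Real.exp (-(x ^ 2 / 2)) : ℝ) : ℂ) := by
    push_cast; congr 1; ring
  rw [norm_mul, e, Complex.norm_real, Real.norm_of_nonneg (Real.exp_pos _).le, Real.exp_neg,
    ← div_eq_mul_inv, div_le_one (Real.exp_pos _)]
  exact norm_one_add_I_mul_le x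

/-- McLeish's central limit theorem for bounded summands. -/
lemma tendsto_integral_exp_of_prod {Ω : Type*} [MeasurableSpace Ω] {μ : Measure Ω}
    [IsProbabilityMeasure μ] {ζ : ℕ → Ω → ℝ} (hζm : ∀ k, Measurable (ζ k)) {M : ℝ}
    (hζ : ∀ k x, |ζ k x| ≤ M)
    (hprod : ∀ n : ℕ, ∫ x, ∏ k ∈ Finset.range n,
      (1 + Complex.I * ((ζ k x / √n : ℝ) : ℂ)) ∂μ = 1)
    {s : ℝ} (hs : ∀ᵐ x ∂μ, Tendsto (fun n : ℕ => (∑ k ∈ Finset.range n, ζ k x ^ 2) / n) atTop (𝓝 s)) :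
    Tendsto (fun n : ℕ => ∫ x, Complex.exp (Complex.I *
      (((∑ k ∈ Finset.range n, ζ k x) / √n : ℝ) : ℂ)) ∂μ) atTop
      (𝓝 (Complex.exp (((-s / 2 : ℝ) : ℂ)))) := by
  rcases isEmpty_or_nonempty Ω with hΩ | ⟨⟨x₀⟩⟩
  · exact absurd (measure_univ (μ := μ)) (by simp [Measure.eq_zero_of_isEmpty μ])
  have hM : 0 ≤ M := (abs_nonneg _).trans (hζ 0 x₀)
  set ξ : ℕ → ℕ → Ω → ℝ := fun n k x => ζ k x / √n with hξ
  have hξm : ∀ n k, Measurable (ξ n k) := fun n k => (hζm k).div_const _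
  set X : ℕ → Ω → ℂ := fun n x => ∏ k ∈ Finset.range n, Complex.exp (Complex.I * (ξ n k x : ℂ))
    with hX
  set Tn : ℕ → Ω → ℂ := fun n x => ∏ k ∈ Finset.range n, (1 + Complex.I * (ξ n k x : ℂ)) with hT
  set q : ℕ → Ω → ℝ := fun n x => (∑ k ∈ Finset.range n, ζ k x ^ 2) / n with hq
  have hqξ : ∀ n x, ∑ k ∈ Finset.range n, ξ n k x ^ 2 = q n x := fun n x => by
    simp only [hξ, hq, div_pow, Finset.sum_div, Real.sq_sqrt (Nat.cast_nonneg n)]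
  set Y : ℕ → Ω → ℂ := fun n x => ∏ k ∈ Finset.range n,
    ((1 + Complex.I * (ξ n k x : ℂ)) * Complex.exp (-(ξ n k x : ℂ) ^ 2 / 2)) with hY
  have hXeq : ∀ n x, Complex.exp (Complex.I *
      (((∑ k ∈ Finset.range n, ζ k x) / √n : ℝ) : ℂ)) = X n x := fun n x => by
    simp only [hX]
    rw [← Complex.exp_sum, ← Finset.mul_sum]
    congr 2
    rw [Finset.sum_div, Complex.ofReal_sum]
  have hYeq : ∀ n x, Y n x = Tn n x * Complex.exp ((-q n x / 2 : ℝ) : ℂ) := fun n x => by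
    rw [hY, hT]
    simp only [Finset.prod_mul_distrib]
    rw [← Complex.exp_sum, ← hqξ]
    congr 2
    push_cast
    rw [neg_div, Finset.sum_div, ← Finset.sum_neg_distrib]
    exact Finset.sum_congr rfl fun k _ => by ring
  have hq0 : ∀ n x, 0 ≤ q n x := fun n x =>
    div_nonneg (Finset.sum_nonneg fun k _ => sq_nonneg _) (Nat.cast_nonneg n)
  have hqM : ∀ n x, q n x ≤ M ^ 2 := fun n x => by
    rcases Nat.eq_zero_or_pos n with rfl | hn
    · simp [hq]; positivity
    · rw [hq, div_le_iff₀ (by exact_mod_cast hn)]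
      refine (Finset.sum_le_sum fun k _ => ?_).trans
        (le_of_eq (by simp [mul_comm] : ∑ _k ∈ Finset.range n, M ^ 2 = M ^ 2 * n))
      rw [← sq_abs]; exact pow_le_pow_left₀ (abs_nonneg _) (hζ k x) 2
  -- Boundedness of the `ζ k` makes the products uniformly bounded, so dominated convergence applies
  -- and no truncation is needed.
  have hTb : ∀ n x, ‖Tn n x‖ ≤ Real.exp (M ^ 2 / 2) := fun n x => by
    rw [hT, norm_prod]
    refine (Finset.prod_le_prod (fun k _ => norm_nonneg _)
      fun k _ => norm_one_add_I_mul_le (ξ n k x)).trans ?_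
    rw [← Real.exp_sum, ← Finset.sum_div, hqξ]
    exact Real.exp_le_exp.2 (by linarith [hqM n x])
  have hXm : ∀ n, Measurable (X n) := fun n => Finset.measurable_fun_prod _ fun k _ =>
    Complex.measurable_exp.comp ((Complex.measurable_ofReal.comp (hξm n k)).const_mul _)
  have hTm : ∀ n, Measurable (Tn n) := fun n => Finset.measurable_fun_prod _ fun k _ =>
    ((Complex.measurable_ofReal.comp (hξm n k)).const_mul _).const_add _
  have hqm : ∀ n, Measurable (q n) := fun n =>
    (Finset.measurable_fun_sum _ fun k _ => (hζm k).pow_const 2).div_const _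
  have hEm : ∀ n, Measurable fun x => Complex.exp ((-q n x / 2 : ℝ) : ℂ) := fun n =>
    Complex.measurable_exp.comp (Complex.measurable_ofReal.comp ((hqm n).neg.div_const 2))
  set E : ℂ := Complex.exp (((-s / 2 : ℝ) : ℂ)) with hE
  have hnE : ∀ y : ℝ, ‖Complex.exp ((y : ℝ) : ℂ)‖ = Real.exp y := fun y => by
    rw [← Complex.ofReal_exp, Complex.norm_real, Real.norm_of_nonneg (Real.exp_pos _).le]
  have hEb : ∀ n x, ‖Complex.exp ((-q n x / 2 : ℝ) : ℂ)‖ ≤ 1 := fun n x => by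
    rw [hnE]; exact Real.exp_le_one_iff.2 (by linarith [hq0 n x])
  have hXb : ∀ n x, ‖X n x‖ ≤ 1 := fun n x => by
    rw [hX, norm_prod]
    refine Finset.prod_le_one (fun k _ => norm_nonneg _) fun k _ => ?_
    rw [mul_comm, Complex.norm_exp_ofReal_mul_I]
  have hTi : ∀ n, Integrable (Tn n) μ := fun n =>
    Integrable.of_bound (hTm n).aestronglyMeasurable _ (ae_of_all _ (hTb n))
  have hXi : ∀ n, Integrable (X n) μ := fun n =>
    Integrable.of_bound (hXm n).aestronglyMeasurable _ (ae_of_all _ (hXb n))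
  have hDm : ∀ n, Measurable fun x => Tn n x * (Complex.exp ((-q n x / 2 : ℝ) : ℂ) - E) :=
    fun n => (hTm n).mul ((hEm n).sub_const _)
  have hDb : ∀ n x, ‖Tn n x * (Complex.exp ((-q n x / 2 : ℝ) : ℂ) - E)‖ ≤
      Real.exp (M ^ 2 / 2) * (1 + ‖E‖) := fun n x => by
    rw [norm_mul]
    exact mul_le_mul (hTb n x) ((norm_sub_le _ _).trans (by linarith [hEb n x]))
      (norm_nonneg _) (Real.exp_pos _).le
  have hDi : ∀ n, Integrable (fun x => Tn n x * (Complex.exp ((-q n x / 2 : ℝ) : ℂ) - E)) μ :=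
    fun n => Integrable.of_bound (hDm n).aestronglyMeasurable _ (ae_of_all _ (hDb n))
  have hlim1 : Tendsto (fun n => ∫ x, Tn n x * (Complex.exp ((-q n x / 2 : ℝ) : ℂ) - E) ∂μ) atTop
      (𝓝 0) := by
    have := tendsto_integral_of_dominated_convergence (μ := μ)
      (F := fun n x => Tn n x * (Complex.exp ((-q n x / 2 : ℝ) : ℂ) - E)) (f := fun _ => (0 : ℂ))
      (fun _ => Real.exp (M ^ 2 / 2) * (1 + ‖E‖)) (fun n => (hDm n).aestronglyMeasurable)
      (integrable_const _) (fun n => ae_of_all _ (hDb n)) ?_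
    · simpa using this
    · filter_upwards [hs] with x hx
      have h1 : Tendsto (fun n => Complex.exp ((-q n x / 2 : ℝ) : ℂ) - E) atTop (𝓝 0) := by
        rw [← sub_self E]
        refine Tendsto.sub_const ?_ _
        refine (Complex.continuous_exp.tendsto _).comp ((Complex.continuous_ofReal.tendsto _).comp ?_)
        exact hx.neg.div_const 2
      refine squeeze_zero_norm (a := fun n => Real.exp (M ^ 2 / 2) *
        ‖Complex.exp ((-q n x / 2 : ℝ) : ℂ) - E‖) (fun n => ?_) ?_
      · rw [norm_mul]; exact mul_le_mul_of_nonneg_right (hTb n x) (norm_nonneg _)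
      · simpa using h1.norm.const_mul (Real.exp (M ^ 2 / 2))
  -- There are `n` factors, each with an error at most `2 (M/√n)³`.
  have hlim2 : Tendsto (fun n => ∫ x, (X n x - Y n x) ∂μ) atTop (𝓝 0) := by
    have hsqrt : Tendsto (fun n : ℕ => √(n : ℝ)) atTop atTop :=
      Real.tendsto_sqrt_atTop.comp tendsto_natCast_atTop_atTop
    refine squeeze_zero_norm' (a := fun n : ℕ => 2 * M ^ 3 / √(n : ℝ)) ?_
      (hsqrt.const_div_atTop _)
    filter_upwards [hsqrt.eventually_ge_atTop M, eventually_gt_atTop 0] with n hn hn0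
    have hn0' : (0 : ℝ) < n := by exact_mod_cast hn0
    have hsn : 0 < √(n : ℝ) := Real.sqrt_pos.2 hn0'
    have hξb : ∀ k x, |ξ n k x| ≤ M / √n := fun k x => by
      rw [hξ, abs_div, abs_of_pos hsn]; gcongr; exact hζ k x
    have hξ1 : ∀ k x, |ξ n k x| ≤ 1 := fun k x =>
      (hξb k x).trans ((div_le_one hsn).2 hn)
    refine (norm_integral_le_of_norm_le_const (ae_of_all _ fun x => ?_)).trans
      (le_of_eq (by simp) : (2 * M ^ 3 / √(n : ℝ)) * μ.real Set.univ ≤ _)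
    refine (norm_prod_sub_prod_le_sum (fun k => ?_)
      (fun k => norm_one_add_I_mul_mul_exp_le (ξ n k x)) n).trans ?_
    · rw [mul_comm, Complex.norm_exp_ofReal_mul_I]
    · refine (Finset.sum_le_sum fun k _ => (norm_exp_I_mul_sub_le (hξ1 k x)).trans
        (mul_le_mul_of_nonneg_left (pow_le_pow_left₀ (abs_nonneg _) (hξb k x) 3)
          zero_le_two)).trans (le_of_eq ?_)
      rw [Finset.sum_const, Finset.card_range, nsmul_eq_mul, div_pow, pow_succ √(n : ℝ) 2,
        Real.sq_sqrt hn0'.le]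
      field_simp
  have hfinal : ∀ n, ∫ x, X n x ∂μ = ∫ x, (X n x - Y n x) ∂μ +
      ∫ x, Tn n x * (Complex.exp ((-q n x / 2 : ℝ) : ℂ) - E) ∂μ + E := by
    intro n
    have hYi : Integrable (Y n) μ := by
      have : Y n = fun x => Tn n x * (Complex.exp ((-q n x / 2 : ℝ) : ℂ) - E) + Tn n x * E := by
        ext x; rw [hYeq]; ring
      rw [this]
      exact (hDi n).add ((hTi n).mul_const E)
    rw [integral_sub (hXi n) hYi]
    have h1 : ∫ x, Y n x ∂μ =
        ∫ x, Tn n x * (Complex.exp ((-q n x / 2 : ℝ) : ℂ) - E) ∂μ + E := by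
      have : Y n = fun x => Tn n x * (Complex.exp ((-q n x / 2 : ℝ) : ℂ) - E) + Tn n x * E := by
        ext x; rw [hYeq]; ring
      rw [this, integral_add (hDi n) ((hTi n).mul_const E), integral_mul_const]
      congr 1
      have := hprod n
      simp only [hT, hξ]
      rw [this, one_mul]
    rw [h1]; ring
  simp only [hXeq, hfinal]
  simpa using (hlim2.add hlim1).add_const E

end CharEstimates

/-! ### Quenched central limit theorem for bounded martingale differences. -/

section QuenchedMartingale

variable {Ω : Type*} {F₀ : MeasurableSpace Ω} [mΩ : MeasurableSpace Ω] {P : Measure Ω}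
  [IsProbabilityMeasure P] {κ : Ω → Measure Ω} {S : Ω → Ω} {c : ℂ} {w : Ω → ℂ} {B : ℝ}

/-- The partial products form a martingale under `κ ω`: each new factor adds a function of the past
times a centred term. -/
lemma IsRegularCondProb.ae_integral_prod_eq_one (hκ : IsRegularCondProb F₀ P κ) (hF₀ : F₀ ≤ mΩ)
    (hS : MeasurePreserving S P P) (hSF : F₀ ≤ F₀.comap S)
    (hw : StronglyMeasurable[F₀.comap S] w) (hB : ∀ x, ‖w x‖ ≤ B) (hw0 : P[w | F₀] =ᵐ[P] 0)
    (hc : ‖c‖ = 1) :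
    ∀ᵐ ω ∂P, ∀ θ : ℂ, ∀ n : ℕ, ∫ x, ∏ k ∈ Finset.range n,
      (1 + Complex.I * ((((starRingEnd ℂ) θ * (c ^ k * w (S^[k] x))).re : ℝ) : ℂ)) ∂κ ω = 1 := by
  have hle := comap_le_of_measurable hF₀ hS.measurable
  set L : ℂ → ℕ → Ω → ℂ := fun θ k x =>
    ((((starRingEnd ℂ) θ * (c ^ k * w (S^[k] x))).re : ℝ) : ℂ) with hL
  have hLb : ∀ θ k x, ‖L θ k x‖ ≤ ‖θ‖ * B := fun θ k x => by
    rw [hL, Complex.norm_real]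
    refine (Complex.abs_re_le_norm _).trans ?_
    rw [norm_mul, norm_mul, norm_pow, hc, one_pow, one_mul, RCLike.norm_conj]
    exact mul_le_mul_of_nonneg_left (hB _) (norm_nonneg _)
  set T : ℂ → ℕ → Ω → ℂ := fun θ n x => ∏ k ∈ Finset.range n, (1 + Complex.I * L θ k x) with hT
  have hTb : ∀ θ n x, ‖T θ n x‖ ≤ (1 + ‖θ‖ * B) ^ n := fun θ n x => by
    rw [hT, norm_prod]
    refine (Finset.prod_le_prod (g := fun _ => 1 + ‖θ‖ * B) (fun k _ => norm_nonneg _)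
      fun k _ => ?_).trans (le_of_eq (by simp))
    refine (norm_add_le _ _).trans ?_
    rw [norm_mul, Complex.norm_I, one_mul, norm_one]
    linarith [hLb θ k x]
  have hLm : ∀ θ k, StronglyMeasurable[F₀.comap S^[k + 1]] (L θ k) := fun θ k => by
    have h1 : StronglyMeasurable[(F₀.comap S).comap S^[k]] fun ω => w (S^[k] ω) :=
      hw.comp_measurable (@comap_measurable Ω Ω (F₀.comap S) S^[k])
    rw [MeasurableSpace.comap_comp, ← Function.iterate_succ'] at h1
    exact (Complex.continuous_ofReal.comp Complex.continuous_re).comp_stronglyMeasurable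
      ((h1.const_mul _).const_mul _)
  have hTm : ∀ θ n, StronglyMeasurable[F₀.comap S^[n]] (T θ n) := fun θ n =>
    Finset.stronglyMeasurable_fun_prod _ fun k hk =>
      stronglyMeasurable_const.add (((hLm θ k).mono
        (comap_iterate_mono hSF (Finset.mem_range.1 hk))).const_mul _)
  have hlen : ∀ n, F₀.comap S^[n] ≤ mΩ := fun n =>
    comap_le_of_measurable hF₀ (hS.iterate n).measurable
  have hTm' : ∀ θ n, StronglyMeasurable (T θ n) := fun θ n => (hTm θ n).mono (hlen n)
  have hfix : ∀ θ : ℂ, ∀ᵐ ω ∂P, ∀ n, ∫ x, T θ n x ∂κ ω = 1 := by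
    intro θ
    have horth : ∀ᵐ ω ∂P, ∀ n : ℕ, ∫ x, (T θ n x * Complex.I) * L θ n x ∂κ ω = 0 := by
      refine ae_all_iff.2 fun n => ?_
      set Y : Ω → ℂ := fun x => ((((starRingEnd ℂ) θ * (c ^ n * w x)).re : ℝ) : ℂ) with hY
      have hwi : Integrable w P :=
        Integrable.of_bound (hw.mono hle).aestronglyMeasurable B (ae_of_all _ hB)
      have hYi : Integrable Y P := ((hwi.const_mul _).const_mul _).re.ofReal
      have hY0 : P[Y | F₀] =ᵐ[P] 0 := by
        set A : ℂ →L[ℝ] ℂ := Complex.ofRealCLM ∘L Complex.reCLM ∘L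
          (ContinuousLinearMap.mul ℝ ℂ ((starRingEnd ℂ) θ * c ^ n)) with hA
        have hAY : A ∘ w = Y := by
          ext x; simp [hA, hY, mul_assoc]
        have := A.comp_condExp_comm hwi (m := F₀)
        rw [hAY] at this
        filter_upwards [this, hw0] with x h1 h2
        rw [← h1, Function.comp_apply, h2]
        simp
      have hint : Integrable (fun x => (T θ n x * Complex.I) * Y (S^[n] x)) P := by
        refine Integrable.of_bound (C := (1 + ‖θ‖ * B) ^ n * (‖θ‖ * B)) ?_ (ae_of_all _ fun x => ?_)
        · exact (((hTm' θ n).mul_const _).mul ((hLm θ n).mono (hlen _))).aestronglyMeasurable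
        · have h1 := hTb θ n x
          rw [norm_mul, norm_mul, Complex.norm_I, mul_one]
          exact mul_le_mul h1 (hLb θ n x) (norm_nonneg _) ((norm_nonneg _).trans h1)
      exact hκ.ae_integral_mul_comp_eq_zero hF₀ (hS.iterate n) (le_comap_iterate hSF n)
        ((hTm θ n).mul_const _) hYi hY0 hint
    filter_upwards [horth] with ω hω n
    have hprob := hκ.isProbabilityMeasure ω
    induction n with
    | zero => simp [hT]
    | succ n ih =>
      have e : ∀ x, T θ (n + 1) x = T θ n x + (T θ n x * Complex.I) * L θ n x := fun x => by
        simp only [hT, Finset.prod_range_succ]; ring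
      simp only [e]
      rw [integral_add, ih, hω n, add_zero]
      · exact Integrable.of_bound (hTm' θ n).aestronglyMeasurable _ (ae_of_all _ (hTb θ n))
      · refine Integrable.of_bound (C := (1 + ‖θ‖ * B) ^ n * (‖θ‖ * B)) ?_ (ae_of_all _ fun x => ?_)
        · exact (((hTm' θ n).mul_const _).mul ((hLm θ n).mono (hlen _))).aestronglyMeasurable
        · have h1 := hTb θ n x
          rw [norm_mul, norm_mul, Complex.norm_I, mul_one]
          exact mul_le_mul h1 (hLb θ n x) (norm_nonneg _) ((norm_nonneg _).trans h1)
  -- The exceptional set depends on `θ`; a countable dense set and continuity in `θ` give a single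
  -- one for all `θ`, in particular for every `θ/√n`.
  have hdense := ae_all_iff.2 fun i => hfix (TopologicalSpace.denseSeq ℂ i)
  filter_upwards [hdense] with ω hω θ n
  have hprob := hκ.isProbabilityMeasure ω
  have hcont : Continuous fun θ => ∫ x, T θ n x ∂κ ω := by
    refine continuous_iff_continuousAt.2 fun θ₀ => ?_
    refine continuousAt_of_dominated (bound := fun _ => (1 + (‖θ₀‖ + 1) * |B|) ^ n)
      (Eventually.of_forall fun θ => (hTm' θ n).aestronglyMeasurable) ?_ (integrable_const _)
      (ae_of_all _ fun x => ?_)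
    · filter_upwards [Metric.ball_mem_nhds θ₀ one_pos] with θ hθ
      refine ae_of_all _ fun x => (hTb θ n x).trans ?_
      have hB0 : 0 ≤ B := (norm_nonneg _).trans (hB x)
      have hθ' : ‖θ‖ ≤ ‖θ₀‖ + 1 := by
        have h1 := norm_sub_norm_le θ θ₀
        have h2 : ‖θ - θ₀‖ < 1 := by simpa [dist_eq_norm] using hθ
        linarith
      rw [abs_of_nonneg hB0]
      gcongr
    · refine Continuous.continuousAt ?_
      refine continuous_finsetProd _ fun k _ => ?_
      refine continuous_const.add (continuous_const.mul (Complex.continuous_ofReal.comp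
        (Complex.continuous_re.comp ((Complex.continuous_conj).mul continuous_const))))
  have heq : (fun θ => ∫ x, T θ n x ∂κ ω) = fun _ => 1 :=
    (TopologicalSpace.denseRange_denseSeq ℂ).equalizer hcont continuous_const
      (funext fun i => hω i n)
  exact congrFun heq θ

/-- Quenched convergence of characteristic functions for stationary bounded martingale
differences. -/
lemma IsRegularCondProb.ae_tendsto_integral_exp_twistSum (hκ : IsRegularCondProb F₀ P κ)
    (hF₀ : F₀ ≤ mΩ) (hS : MeasurePreserving S P P) (hSF : F₀ ≤ F₀.comap S)
    (hw : StronglyMeasurable[F₀.comap S] w) (hB : ∀ x, ‖w x‖ ≤ B) (hw0 : P[w | F₀] =ᵐ[P] 0)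
    (hc : ‖c‖ = 1) {s : ℝ}
    (h1 : ∀ᵐ x ∂P, Tendsto (fun n : ℕ => (n : ℂ)⁻¹ *
      twistSum S 1 n (fun x => ((‖w x‖ ^ 2 : ℝ) : ℂ)) x) atTop (𝓝 (s : ℂ)))
    (h2 : ∀ᵐ x ∂P, Tendsto (fun n : ℕ => (n : ℂ)⁻¹ *
      twistSum S (c ^ 2) n (fun x => w x ^ 2) x) atTop (𝓝 0)) :
    ∀ᵐ ω ∂P, ∀ θ : ℂ, Tendsto (fun n : ℕ => ∫ x, Complex.exp (Complex.I *
      ((((starRingEnd ℂ) θ * twistSum S c n w x).re / √n : ℝ) : ℂ)) ∂κ ω) atTop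
      (𝓝 (Complex.exp ((-(‖θ‖ ^ 2 * s / 2) / 2 : ℝ) : ℂ))) := by
  have hle := comap_le_of_measurable hF₀ hS.measurable
  filter_upwards [hκ.ae_integral_prod_eq_one hF₀ hS hSF hw hB hw0 hc, hκ.ae_ae hF₀ h1,
    hκ.ae_ae hF₀ h2] with ω hprod h1 h2 θ
  have hprob := hκ.isProbabilityMeasure ω
  set ζ : ℕ → Ω → ℝ := fun k x => ((starRingEnd ℂ) θ * (c ^ k * w (S^[k] x))).re with hζ
  have hζm : ∀ k, Measurable (ζ k) := fun k =>
    Complex.measurable_re.comp ((((hw.mono hle).measurable.comp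
      (hS.measurable.iterate k)).const_mul _).const_mul _)
  have hζb : ∀ k x, |ζ k x| ≤ ‖θ‖ * B := fun k x => by
    refine (Complex.abs_re_le_norm _).trans ?_
    rw [norm_mul, norm_mul, norm_pow, hc, one_pow, one_mul, RCLike.norm_conj]
    exact mul_le_mul_of_nonneg_left (hB _) (norm_nonneg _)
  have hsum : ∀ n x, ∑ k ∈ Finset.range n, ζ k x = ((starRingEnd ℂ) θ * twistSum S c n w x).re :=
    fun n x => by simp only [hζ, twistSum, Finset.mul_sum, Complex.re_sum]
  have key := tendsto_integral_exp_of_prod (μ := κ ω) hζm hζb (s := ‖θ‖ ^ 2 * s / 2) ?_ ?_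
  · simpa only [hsum] using key
  · intro n
    refine Eq.trans (integral_congr_ae (ae_of_all _ fun x => ?_)) (hprod (θ / (√(n : ℝ) : ℂ)) n)
    refine Finset.prod_congr rfl fun k _ => ?_
    congr 3
    rw [map_div₀, Complex.conj_ofReal, div_mul_eq_mul_div, Complex.div_ofReal_re]
  · filter_upwards [h1, h2] with x h1 h2
    -- The first part is an untwisted average of `‖w‖²`; the second is an average of `w²` twisted by
    -- `c ^ 2`, whose limit is `0`. Hence the variance depends on `θ` only through `‖θ‖`.
    have hre : ∀ z : ℂ, z.re ^ 2 = (‖z‖ ^ 2 + (z ^ 2).re) / 2 := fun z => by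
      rw [← Complex.normSq_eq_norm_sq, Complex.normSq_apply, pow_two z, Complex.mul_re]; ring
    have hsq : ∀ n : ℕ, (∑ k ∈ Finset.range n, ζ k x ^ 2) / n =
        (((‖θ‖ ^ 2 : ℝ) : ℂ) * ((n : ℂ)⁻¹ *
          twistSum S 1 n (fun x => ((‖w x‖ ^ 2 : ℝ) : ℂ)) x) +
        (starRingEnd ℂ) θ ^ 2 * ((n : ℂ)⁻¹ * twistSum S (c ^ 2) n (fun x => w x ^ 2) x)).re / 2 := by
      intro n
      have e : ((‖θ‖ ^ 2 : ℝ) : ℂ) * ((n : ℂ)⁻¹ *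
          twistSum S 1 n (fun x => ((‖w x‖ ^ 2 : ℝ) : ℂ)) x) +
        (starRingEnd ℂ) θ ^ 2 * ((n : ℂ)⁻¹ * twistSum S (c ^ 2) n (fun x => w x ^ 2) x) =
        (∑ k ∈ Finset.range n, (((‖θ‖ ^ 2 * ‖w (S^[k] x)‖ ^ 2 : ℝ) : ℂ) +
          ((starRingEnd ℂ) θ * (c ^ k * w (S^[k] x))) ^ 2)) / ((n : ℝ) : ℂ) := by
        simp only [twistSum, Finset.mul_sum, Finset.sum_div]
        rw [← Finset.sum_add_distrib]
        refine Finset.sum_congr rfl fun k _ => ?_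
        push_cast
        ring
      rw [e, Complex.div_ofReal_re, Complex.re_sum, div_right_comm]
      congr 1
      rw [Finset.sum_div]
      refine Finset.sum_congr rfl fun k _ => ?_
      rw [hζ, hre, Complex.add_re, Complex.ofReal_re, norm_mul, norm_mul, norm_pow, hc, one_pow,
        one_mul, RCLike.norm_conj, mul_pow]
    simp only [hsq]
    have hlim := ((h1.const_mul (((‖θ‖ ^ 2 : ℝ) : ℂ))).add
      (h2.const_mul ((starRingEnd ℂ) θ ^ 2)))
    rw [mul_zero, add_zero] at hlim
    have := (((Complex.continuous_re.tendsto _).comp hlim).div_const 2)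
    rw [← Complex.ofReal_mul, Complex.ofReal_re] at this
    exact this

end QuenchedMartingale

/-! ### Martingale approximation under the Maxwell–Woodroofe condition. -/

section Approximation

variable {Ω : Type*} {F₀ : MeasurableSpace Ω} [mΩ : MeasurableSpace Ω] {P : Measure Ω}
  {κ : Ω → Measure Ω} {S : Ω → Ω} {c : ℂ} {f : Ω → ℂ}

lemma IsRegularCondProb.stronglyMeasurable_integral (hκ : IsRegularCondProb F₀ P κ)
    {u : Ω → ℂ} (hu : StronglyMeasurable u) : StronglyMeasurable[F₀] fun ω => ∫ x, u x ∂κ ω :=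
  @StronglyMeasurable.integral_kernel Ω Ω F₀ mΩ hκ.toKernel ℂ _ _ _ hu

variable [IsProbabilityMeasure P]

/-- Approximation of the twisted sums of a function satisfying the Maxwell–Woodroofe condition by
sums of stationary bounded martingale differences. -/
lemma IsRegularCondProb.exists_martingale_approx (hκ : IsRegularCondProb F₀ P κ) (hF₀ : F₀ ≤ mΩ)
    (hS : MeasurePreserving S P P) (hSF : F₀ ≤ F₀.comap S) (hc : ‖c‖ = 1)
    (hf : StronglyMeasurable[F₀] f) (hf2 : MemLp f 2 P)
    (hMW : Summable fun k : ℕ => 1 / ((k + 1 : ℕ) : ℝ) ^ (3 / 2 : ℝ) *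
      (eLpNorm (P[fun x => c * twistSum S c (k + 1) f (S x) | F₀]) 2 P).toReal)
    {ε : ℝ} (hε : 0 < ε) :
    ∃ (w : Ω → ℂ) (B : ℝ) (H : Ω → ℝ≥0∞) (C : ℝ≥0), StronglyMeasurable[F₀.comap S] w ∧
      (∀ x, ‖w x‖ ≤ B) ∧ P[w | F₀] =ᵐ[P] 0 ∧ Measurable H ∧
      ∫⁻ ω, H ω ∂P ≤ ENNReal.ofReal ε ∧
      (∀ᵐ ω ∂P, ∀ n : ℕ,
        eLpNorm (fun x => c * twistSum S c n f (S x) - twistSum S c n w x) 2 (κ ω) ≤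
          ENNReal.ofReal √(n + 1) * H ω + (C + eLpNorm f 2 (κ ω))) ∧
      ∀ n : ℕ, eLpNorm (fun x => c * twistSum S c n f (S x) - twistSum S c n w x) 2 P ≤
          ENNReal.ofReal √(n + 1) * ENNReal.ofReal ε + (C + eLpNorm f 2 P) := by
  have hle := comap_le_of_measurable hF₀ hS.measurable
  obtain ⟨h, hhm, ⟨K, hK⟩, happrox⟩ := exists_bounded_twistNorm_sub_lt hF₀ hS hSF hc hf hf2 hMW
    (show 0 < ε / 10 by positivity)
  set Y : Ω → ℂ := fun y => c * h (S y) with hY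
  have hYm1 : StronglyMeasurable[F₀.comap S] Y :=
    (hhm.comp_measurable (@comap_measurable Ω Ω F₀ S)).const_mul c
  have hYb : ∀ x, ‖Y x‖ ≤ K := fun x => by rw [hY, norm_mul, hc, one_mul]; exact hK _
  have hYi : Integrable Y P :=
    Integrable.of_bound (hYm1.mono hle).aestronglyMeasurable K (ae_of_all _ hYb)
  -- This version of `E[c h ∘ S | F₀]` is `F₀`-measurable and bounded at every point, so that `w` is
  -- bounded everywhere.
  set e : Ω → ℂ := fun ω => ∫ x, Y x ∂κ ω with he
  have hem : StronglyMeasurable[F₀] e := hκ.stronglyMeasurable_integral (hYm1.mono hle)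
  have hec : e =ᵐ[P] P[Y | F₀] := (hκ.condExp_ae_eq hF₀ hYi).symm
  have heb : ∀ x, ‖e x‖ ≤ K := fun x => by
    have := hκ.isProbabilityMeasure x
    exact (norm_integral_le_of_norm_le_const (ae_of_all _ hYb)).trans (by simp)
  have hei : Integrable e P :=
    Integrable.of_bound (hem.mono hF₀).aestronglyMeasurable K (ae_of_all _ heb)
  set w : Ω → ℂ := fun x => Y x - e x with hw
  have hwm : StronglyMeasurable[F₀.comap S] w := hYm1.sub (hem.mono hSF)
  have hwb : ∀ x, ‖w x‖ ≤ 2 * K := fun x =>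
    (norm_sub_le _ _).trans (by linarith [hYb x, heb x])
  have hw0 : P[w | F₀] =ᵐ[P] 0 := by
    have h1 := condExp_sub hYi hei F₀
    rw [condExp_of_stronglyMeasurable hF₀ hem hei] at h1
    filter_upwards [h1, hec] with x h1 h2
    have h3 : (P[w | F₀]) x = (P[Y - e | F₀]) x := rfl
    rw [h3, h1, Pi.sub_apply, h2]; simp
  set g : Ω → ℂ := fun x => f x - (h x - e x) with hg
  have hgm : StronglyMeasurable[F₀] g := hf.sub (hhm.sub hem)
  have hg2 : MemLp g 2 P := hf2.sub
    ((MemLp.of_bound (hhm.mono hF₀).aestronglyMeasurable K (ae_of_all _ hK)).sub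
      (MemLp.of_bound (hem.mono hF₀).aestronglyMeasurable K (ae_of_all _ heb)))
  have hglt := happrox e hem hec
  obtain ⟨H, hHm, hHint, hHb⟩ := hκ.exists_maximal_bound hF₀ hS hSF hgm hg2 hc
  have hsmall : 10 * twistNorm F₀ P S c g ≤ ENNReal.ofReal ε := by
    refine (mul_le_mul_right hglt.le _).trans (le_of_eq ?_)
    rw [show (10 : ℝ≥0∞) = ENNReal.ofReal 10 by simp, ← ENNReal.ofReal_mul (by norm_num)]
    congr 1; ring
  -- From `f = g + w + (h - c h ∘ S)` and `c · twistSum n f ∘ S = twistSum (n + 1) f - f`: the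
  -- remainder is the extra martingale term and the telescoped coboundary, bounded by `2K + K + K`.
  set r : ℕ → Ω → ℂ := fun n x => c ^ n * w (S^[n] x) + (h x - c ^ (n + 1) * h (S^[n + 1] x))
    with hr
  have hrb : ∀ n x, ‖r n x‖ ≤ 4 * K := fun n x => by
    have h1 : ‖c ^ n * w (S^[n] x)‖ ≤ 2 * K := by
      rw [norm_mul, norm_pow, hc, one_pow, one_mul]; exact hwb _
    have h2 : ‖c ^ (n + 1) * h (S^[n + 1] x)‖ ≤ K := by
      rw [norm_mul, norm_pow, hc, one_pow, one_mul]; exact hK _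
    have h3 := norm_add_le (c ^ n * w (S^[n] x)) (h x - c ^ (n + 1) * h (S^[n + 1] x))
    have h4 := norm_sub_le (h x) (c ^ (n + 1) * h (S^[n + 1] x))
    simp only [hr]
    linarith [hK x]
  have hdec : ∀ n, (fun x => c * twistSum S c n f (S x) - twistSum S c n w x) =
      fun x => (twistSum S c (n + 1) g x + r n x) - f x := by
    intro n
    ext x
    have h1 := twistSum_add (S := S) (c := c) 1 n f x
    rw [twistSum_one, pow_one, Function.iterate_one, add_comm 1 n] at h1
    have h2 : twistSum S c (n + 1) f x = twistSum S c (n + 1) g x +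
        (twistSum S c (n + 1) w x + twistSum S c (n + 1) (fun x => h x - c * h (S x)) x) := by
      rw [← twistSum_add_fun, ← twistSum_add_fun]
      congr 1
      ext y
      simp only [hg, hw, hY]; ring
    rw [twistSum_coboundary, twistSum_succ n w] at h2
    simp only [hr]
    linear_combination h2 - h1
  have hwm' := hwm.mono hle
  have hhm' := hhm.mono hF₀
  have hrm : ∀ n, StronglyMeasurable (r n) := fun n =>
    ((hwm'.comp_measurable (hS.measurable.iterate n)).const_mul _).add
      (hhm'.sub ((hhm'.comp_measurable (hS.measurable.iterate (n + 1))).const_mul _))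
  have hgen : ∀ (μ : Measure Ω) [IsProbabilityMeasure μ] (n : ℕ),
      eLpNorm (fun x => c * twistSum S c n f (S x) - twistSum S c n w x) 2 μ ≤
        eLpNorm (twistSum S c (n + 1) g) 2 μ + (((4 * K).toNNReal : ℝ≥0∞) + eLpNorm f 2 μ) := by
    intro μ _ n
    have hgs : StronglyMeasurable (twistSum S c (n + 1) g) :=
      StronglyMeasurable.twistSum_of_measurable hS.measurable (hgm.mono hF₀) _
    rw [hdec n, ← add_assoc]
    refine (eLpNorm_sub_le (hgs.add (hrm n)).aestronglyMeasurable
      (hf.mono hF₀).aestronglyMeasurable (by norm_num)).trans (add_le_add_left ?_ _)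
    refine (eLpNorm_add_le hgs.aestronglyMeasurable (hrm n).aestronglyMeasurable
      (by norm_num)).trans (add_le_add_right ?_ _)
    refine (eLpNorm_le_of_ae_bound (ae_of_all _ (hrb n))).trans (le_of_eq ?_)
    simp [ENNReal.ofReal]
  refine ⟨w, 2 * K, H, (4 * K).toNNReal, hwm, hwb, hw0, hHm, hHint.trans hsmall, ?_, fun n => ?_⟩
  · filter_upwards [hHb] with ω hω n
    have := hκ.isProbabilityMeasure ω
    refine (hgen (κ ω) n).trans (add_le_add_left ?_ _)
    exact_mod_cast hω (n + 1)
  · refine (hgen P n).trans (add_le_add_left ?_ _)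
    refine (hκ.eLpNorm_twistSum_le hF₀ hS hSF hgm hg2 hc (n + 1)).trans ?_
    push_cast
    refine mul_le_mul_right ((mul_le_mul_left ?_ _).trans hsmall) _
    norm_num

/-- Second moment of a sum of stationary twisted martingale differences. -/
lemma IsRegularCondProb.eLpNorm_twistSum_martingale (hκ : IsRegularCondProb F₀ P κ)
    (hF₀ : F₀ ≤ mΩ) (hS : MeasurePreserving S P P) (hSF : F₀ ≤ F₀.comap S) {w : Ω → ℂ}
    (hw : StronglyMeasurable[F₀.comap S] w) (hw2 : MemLp w 2 P) (hw0 : P[w | F₀] =ᵐ[P] 0)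
    (hc : ‖c‖ = 1) (n : ℕ) :
    eLpNorm (twistSum S c n w) 2 P ^ 2 = n * eLpNorm w 2 P ^ 2 := by
  have hwm := hw.mono (comap_le_of_measurable hF₀ hS.measurable)
  have hm : ∀ i, Measurable fun x => ‖w (S^[i] x)‖ₑ ^ 2 := fun i =>
    (hwm.measurable.comp (hS.measurable.iterate i)).enorm.pow_const 2
  rw [eLpNorm_two_sq, eLpNorm_two_sq, ← hκ.lintegral_lintegral hF₀
    ((StronglyMeasurable.twistSum_of_measurable hS.measurable hwm n).measurable.enorm.pow_const 2)]
  have h1 := hκ.ae_lintegral_twistSum_sq hF₀ hS hSF hw hw2 hw0 hc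
  rw [lintegral_congr_ae (h1.mono fun ω hω => hω n),
    lintegral_finsetSum _ fun i _ => (hκ.measurable_lintegral (hm i)).mono hF₀ le_rfl,
    Finset.sum_congr rfl (g := fun _ => ∫⁻ x, ‖w x‖ₑ ^ 2 ∂P)]
  · simp
  · intro i _
    rw [hκ.lintegral_lintegral hF₀ (hm i)]
    exact (hS.iterate i).lintegral_comp (hwm.measurable.enorm.pow_const 2)

end Approximation

/-! ### Passing to the limit in the approximations. -/

section Limits

/-- The factor `2` comes from `√(n + 1) ≤ 2 √n` for `n ≥ 1`; the fixed term `C` is negligible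
against `√n`. -/
lemma eventually_toReal_div_sqrt_le {d : ℕ → ℝ≥0∞} {H C : ℝ≥0∞} (hH : H ≠ ∞) (hC : C ≠ ∞)
    (hd : ∀ n : ℕ, d n ≤ ENNReal.ofReal √(n + 1) * H + C) {δ : ℝ} (hδ : 0 < δ) :
    ∀ᶠ n : ℕ in atTop, (d n).toReal / √n ≤ 2 * H.toReal + δ := by
  have hsqrt : Tendsto (fun n : ℕ => √(n : ℝ)) atTop atTop :=
    Real.tendsto_sqrt_atTop.comp tendsto_natCast_atTop_atTop
  filter_upwards [hsqrt.eventually_ge_atTop (C.toReal / δ), eventually_gt_atTop 0] with n hn hn0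
  have hn1 : (1 : ℝ) ≤ n := by exact_mod_cast hn0
  have hsn : 0 < √(n : ℝ) := Real.sqrt_pos.2 (by linarith)
  have h1 : (d n).toReal ≤ √(n + 1) * H.toReal + C.toReal := by
    have := ENNReal.toReal_mono (by finiteness) (hd n)
    rwa [ENNReal.toReal_add (by finiteness) hC, ENNReal.toReal_mul,
      ENNReal.toReal_ofReal (Real.sqrt_nonneg _)] at this
  have h2 : √((n : ℝ) + 1) ≤ 2 * √n := by
    rw [Real.sqrt_le_left (by positivity), mul_pow, Real.sq_sqrt (by linarith)]
    linarith
  rw [div_le_iff₀ hδ] at hn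
  rw [div_le_iff₀ hsn]
  have := mul_le_mul_of_nonneg_right h2 (ENNReal.toReal_nonneg (a := H))
  linarith

lemma tendsto_of_eventually_dist_le {E : Type*} [PseudoMetricSpace E] {x y : ℕ → E} {ε : ℕ → ℝ}
    (hε : Tendsto ε atTop (𝓝 0)) (h : ∀ m, ∀ᶠ n in atTop, dist (x n) (y m) ≤ ε m) {L : E}
    (hy : Tendsto y atTop (𝓝 L)) : Tendsto x atTop (𝓝 L) := by
  rw [Metric.tendsto_nhds]
  intro δ hδ
  obtain ⟨m, hm1, hm2⟩ := ((hε.eventually_lt_const (half_pos hδ)).and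
    ((Metric.tendsto_nhds.1 hy) _ (half_pos hδ))).exists
  filter_upwards [h m] with n hn
  linarith [dist_triangle (x n) (y m) L]

/-- Two approximants are both close to a common `x n`, so `y` is Cauchy. Existence of the limit
variance is obtained in this way. -/
lemma exists_tendsto_of_eventually_dist_le {E : Type*} [PseudoMetricSpace E] [CompleteSpace E]
    {x y : ℕ → E} {ε : ℕ → ℝ}
    (hε : Tendsto ε atTop (𝓝 0)) (h : ∀ m, ∀ᶠ n in atTop, dist (x n) (y m) ≤ ε m) :
    ∃ L, Tendsto y atTop (𝓝 L) ∧ Tendsto x atTop (𝓝 L) := by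
  have hc : CauchySeq y := by
    rw [Metric.cauchySeq_iff]
    intro δ hδ
    obtain ⟨N, hN⟩ := eventually_atTop.1 (hε.eventually_lt_const (half_pos hδ))
    refine ⟨N, fun m hm k hk => ?_⟩
    obtain ⟨n, h1, h2⟩ := ((h m).and (h k)).exists
    have := dist_triangle_left (y m) (y k) (x n)
    linarith [hN m hm, hN k hk]
  obtain ⟨L, hL⟩ := cauchySeq_tendsto_of_complete hc
  exact ⟨L, hL, tendsto_of_eventually_dist_le hε h hL⟩

lemma norm_integral_exp_sub_le {Ω : Type*} [MeasurableSpace Ω] {μ : Measure Ω}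
    [IsProbabilityMeasure μ] {U V : Ω → ℂ} (hU : StronglyMeasurable U) (hV : StronglyMeasurable V)
    (hUV : eLpNorm (fun x => U x - V x) 2 μ ≠ ∞) (θ : ℂ) (a : ℝ) (ha : 0 ≤ a) :
    ‖∫ x, Complex.exp (Complex.I * ((((starRingEnd ℂ) θ * U x).re / a : ℝ) : ℂ)) ∂μ -
      ∫ x, Complex.exp (Complex.I * ((((starRingEnd ℂ) θ * V x).re / a : ℝ) : ℂ)) ∂μ‖ ≤
      ‖θ‖ * ((eLpNorm (fun x => U x - V x) 2 μ).toReal / a) := by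
  have hm : ∀ {W : Ω → ℂ}, StronglyMeasurable W → Measurable fun x =>
      Complex.exp (Complex.I * ((((starRingEnd ℂ) θ * W x).re / a : ℝ) : ℂ)) := fun hW =>
    Complex.measurable_exp.comp ((Complex.measurable_ofReal.comp
      ((Complex.measurable_re.comp (hW.measurable.const_mul _)).div_const a)).const_mul _)
  have hi : ∀ {W : Ω → ℂ}, StronglyMeasurable W → Integrable (fun x =>
      Complex.exp (Complex.I * ((((starRingEnd ℂ) θ * W x).re / a : ℝ) : ℂ))) μ := fun hW =>
    Integrable.of_bound (hm hW).aestronglyMeasurable 1 (ae_of_all _ fun x => by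
      rw [mul_comm, Complex.norm_exp_ofReal_mul_I])
  have hmem : MemLp (fun x => U x - V x) 2 μ :=
    ⟨(hU.sub hV).aestronglyMeasurable, lt_top_iff_ne_top.2 hUV⟩
  have hd : Integrable (fun x => U x - V x) μ := hmem.integrable (by norm_num)
  have hexp : ∀ u v : ℝ, ‖Complex.exp (Complex.I * (u : ℂ)) - Complex.exp (Complex.I * (v : ℂ))‖ ≤
      |u - v| := fun u v => by
    have e : Complex.exp (Complex.I * (u : ℂ)) - Complex.exp (Complex.I * (v : ℂ)) =
        Complex.exp (Complex.I * (v : ℂ)) * (Complex.exp (Complex.I * ((u - v : ℝ) : ℂ)) - 1) := by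
      rw [mul_sub, ← Complex.exp_add, mul_one]
      congr 2
      push_cast; ring
    rw [e, norm_mul, mul_comm Complex.I (v : ℂ), Complex.norm_exp_ofReal_mul_I, one_mul]
    exact Real.norm_exp_I_mul_ofReal_sub_one_le
  rw [← integral_sub (hi hU) (hi hV)]
  calc ‖∫ x, (Complex.exp (Complex.I * ((((starRingEnd ℂ) θ * U x).re / a : ℝ) : ℂ)) -
          Complex.exp (Complex.I * ((((starRingEnd ℂ) θ * V x).re / a : ℝ) : ℂ))) ∂μ‖
      ≤ ∫ x, ‖θ‖ / a * ‖U x - V x‖ ∂μ := by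
        refine norm_integral_le_of_norm_le (hd.norm.const_mul _) (ae_of_all _ fun x => ?_)
        refine (hexp _ _).trans ?_
        rw [← sub_div, ← Complex.sub_re, ← mul_sub, abs_div, abs_of_nonneg ha, div_mul_eq_mul_div]
        refine div_le_div_of_nonneg_right ((Complex.abs_re_le_norm _).trans (le_of_eq ?_)) ha
        rw [norm_mul, RCLike.norm_conj]
    _ = ‖θ‖ * ((eLpNorm (fun x => U x - V x) 1 μ).toReal / a) := by
        rw [integral_const_mul, eLpNorm_one_eq_lintegral_enorm,
          ← ofReal_integral_norm_eq_lintegral_enorm hd,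
          ENNReal.toReal_ofReal (integral_nonneg fun x => norm_nonneg _)]
        ring
    _ ≤ ‖θ‖ * ((eLpNorm (fun x => U x - V x) 2 μ).toReal / a) := by
        gcongr
        exact eLpNorm_le_eLpNorm_of_exponent_le (by norm_num) (hU.sub hV).aestronglyMeasurable

end Limits

/-! ### Gaussian limit in the plane, non-eigenvalues and the Fourier sums. -/

lemma charFun_gaussianReal_prod_map (v : ℝ≥0) (θ : ℂ) :
    charFun (((gaussianReal 0 v).prod (gaussianReal 0 v)).map
      fun p : ℝ × ℝ => Complex.equivRealProdCLM.symm p) θ =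
      Complex.exp ((-(‖θ‖ ^ 2 * v) / 2 : ℝ) : ℂ) := by
  rw [charFun_apply, integral_map (by fun_prop) (by fun_prop)]
  have h1 : ∀ p : ℝ × ℝ,
      Complex.exp ((inner ℝ (Complex.equivRealProdCLM.symm p) θ : ℝ) * Complex.I) =
      Complex.exp (θ.re * p.1 * Complex.I) * Complex.exp (θ.im * p.2 * Complex.I) := fun p => by
    rw [← Complex.exp_add, Complex.inner]
    congr 1
    simp
    ring
  simp_rw [h1]
  rw [integral_prod_mul (fun x : ℝ => Complex.exp (θ.re * x * Complex.I))
    fun x : ℝ => Complex.exp (θ.im * x * Complex.I), ← charFun_apply_real, ← charFun_apply_real,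
    charFun_gaussianReal, charFun_gaussianReal, ← Complex.exp_add, ← Complex.normSq_eq_norm_sq,
    Complex.normSq_apply]
  congr 1
  push_cast
  ring

/-- Lévy's continuity theorem on `ℂ`, identified with the real plane. Convergence holds for all test
functions at once, so no exceptional set depends on `g`. -/
lemma tendsto_integral_of_tendsto_integral_exp {Ω : Type*} [MeasurableSpace Ω] {μ : Measure Ω}
    [IsProbabilityMeasure μ] {U : ℕ → Ω → ℂ} (hU : ∀ n, Measurable (U n)) {v : ℝ≥0}
    (h : ∀ θ : ℂ, Tendsto (fun n : ℕ => ∫ x,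
      Complex.exp (Complex.I * ((((starRingEnd ℂ) θ * U n x).re / √n : ℝ) : ℂ)) ∂μ) atTop
      (𝓝 (Complex.exp ((-(‖θ‖ ^ 2 * v) / 2 : ℝ) : ℂ)))) (g : (ℝ × ℝ) →ᵇ ℝ) :
    Tendsto (fun n : ℕ => ∫ x, g ((U n x).re / √n, (U n x).im / √n) ∂μ) atTop
      (𝓝 (∫ x, g x ∂((gaussianReal 0 v).prod (gaussianReal 0 v)))) := by
  have hm : ∀ n : ℕ, Measurable fun x => U n x / (√n : ℂ) := fun n => (hU n).div_const _
  have hL : Measurable fun p : ℝ × ℝ => Complex.equivRealProdCLM.symm p := by fun_prop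
  let ν : ℕ → ProbabilityMeasure ℂ := fun n =>
    ⟨μ.map fun x => U n x / (√n : ℂ), Measure.isProbabilityMeasure_map (hm n).aemeasurable⟩
  let ν₀ : ProbabilityMeasure ℂ := ⟨((gaussianReal 0 v).prod (gaussianReal 0 v)).map
    fun p : ℝ × ℝ => Complex.equivRealProdCLM.symm p,
    Measure.isProbabilityMeasure_map hL.aemeasurable⟩
  have hν : Tendsto ν atTop (𝓝 ν₀) := by
    refine ProbabilityMeasure.tendsto_of_tendsto_charFun fun θ => ?_
    have h0 : charFun (ν₀ : Measure ℂ) θ = Complex.exp ((-(‖θ‖ ^ 2 * v) / 2 : ℝ) : ℂ) :=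
      charFun_gaussianReal_prod_map v θ
    rw [h0]
    refine (h θ).congr fun n => ?_
    change _ = charFun (μ.map fun x => U n x / (√n : ℂ)) θ
    rw [charFun_apply, integral_map (hm n).aemeasurable (by fun_prop)]
    refine integral_congr_ae (ae_of_all _ fun x => ?_)
    have h3 : (inner ℝ (U n x / (√n : ℂ)) θ : ℝ) = ((starRingEnd ℂ) θ * U n x).re / √n := by
      rw [real_inner_comm, Complex.inner, mul_comm, ← Complex.div_ofReal_re]
      congr 1
      ring
    simp only [h3, mul_comm]
  rw [ProbabilityMeasure.tendsto_iff_forall_integral_tendsto] at hν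
  have h4 := hν (g.compContinuous ⟨fun z : ℂ => (z.re, z.im), by fun_prop⟩)
  have h5 : ∀ u : ℂ → ℝ, Continuous u → ∫ z, u z ∂(ν₀ : Measure ℂ) =
      ∫ p, u (Complex.equivRealProdCLM.symm p) ∂((gaussianReal 0 v).prod (gaussianReal 0 v)) :=
    fun u hu => integral_map hL.aemeasurable hu.aestronglyMeasurable
  have h6 : ∀ u : ℂ → ℝ, Continuous u → ∀ n, ∫ z, u z ∂(ν n : Measure ℂ) =
      ∫ x, u (U n x / (√n : ℂ)) ∂μ :=
    fun u hu n => integral_map (hm n).aemeasurable hu.aestronglyMeasurable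
  rw [h5 _ (BoundedContinuousFunction.continuous _)] at h4
  simp_rw [h6 _ (BoundedContinuousFunction.continuous _)] at h4
  simpa using h4

/-- A fixed vector of `d · (∘ S)` is an eigenvector of the Koopman operator for `d⁻¹`, so only `0`
is fixed. -/
lemma Ergodic.ae_tendsto_twistSum_of_not_hasEigenvalue {Ω : Type*} [MeasurableSpace Ω]
    {P : Measure Ω} [IsProbabilityMeasure P] {S : Ω → Ω} (hS : MeasurePreserving S P P) {d : ℂ}
    (hd : ‖d‖ = 1) (heig : ¬ (koopman hS).HasEigenvalue d⁻¹) {F : Ω → ℂ}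
    (hFm : StronglyMeasurable F) {K : ℝ} (hF : ∀ x, ‖F x‖ ≤ K) :
    ∀ᵐ ω ∂P, Tendsto (fun n : ℕ => (n : ℂ)⁻¹ * twistSum S d n F ω) atTop (𝓝 0) := by
  have hd0 : d ≠ 0 := by
    rintro rfl
    simp at hd
  have hfix : ∀ g : Lp ℂ 2 P, d • Lp.compMeasurePreserving S hS g = g → g = 0 := fun g hg => by
    by_contra hg0
    refine heig (Module.End.hasEigenvalue_of_hasEigenvector
      (x := g) ⟨Module.End.mem_eigenspace_iff.2 ?_, hg0⟩)
    change Lp.compMeasurePreserving S hS g = d⁻¹ • g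
    rw [eq_inv_smul_iff₀ hd0, hg]
  obtain ⟨p, hp, h⟩ := exists_ae_tendsto_twistSum hS hd hFm hF fun g hg =>
    ⟨0, mul_zero d, by rw [hfix g hg]; exact Lp.coeFn_zero ..⟩
  -- Constants are eigenvectors for `1`, so `d = 1` is excluded and `d * p = p` forces `p = 0`.
  have hd1 : d ≠ 1 := by
    rintro rfl
    have hone : MemLp (fun _ : Ω => (1 : ℂ)) 2 P := memLp_const 1
    have h0 := hfix (hone.toLp _) (by
      rw [one_smul, Lp.toLp_compMeasurePreserving]
      rfl)
    have h1 := hone.coeFn_toLp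
    rw [h0] at h1
    obtain ⟨ω, hω1, hω2⟩ := (h1.and (Lp.coeFn_zero ℂ 2 P)).exists
    rw [hω2] at hω1
    exact zero_ne_one hω1
  have hp0 : p = 0 := by
    by_contra hp0
    exact hd1 (mul_right_cancel₀ hp0 (by rw [hp, one_mul]))
  rwa [hp0] at h

/-- The sum starts at `k = 1`, whence the outer factor and the evaluation at `S ω`. -/
lemma fourierSum_eq_twistSum {Ω : Type*} (S : Ω → Ω) (X₀ : Ω → ℝ) (t : ℝ) (n : ℕ) (ω : Ω) :
    fourierSum S X₀ t n ω = Complex.exp (Complex.I * t) *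
      twistSum S (Complex.exp (Complex.I * t)) n (fun x => (X₀ x : ℂ)) (S ω) := by
  induction n with
  | zero => simp [fourierSum, twistSum_zero]
  | succ n ih =>
    rw [fourierSum, Finset.sum_Icc_succ_top (by omega), ← fourierSum, ih, twistSum_succ, mul_add,
      ← mul_assoc, ← pow_succ', ← Complex.exp_nat_mul, Function.iterate_succ_apply]
    congr 3
    ring

lemma toReal_eLpNorm_two_sq {Ω : Type*} [MeasurableSpace Ω] {μ : Measure Ω} {u : Ω → ℂ}
    (hu : AEStronglyMeasurable u μ) : (eLpNorm u 2 μ).toReal ^ 2 = ∫ x, ‖u x‖ ^ 2 ∂μ := by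
  rw [← ENNReal.toReal_pow, eLpNorm_two_sq,
    integral_eq_lintegral_of_nonneg_ae (f := fun x => ‖u x‖ ^ 2)
      (ae_of_all _ fun x => by positivity) (hu.norm.pow 2)]
  congr 1
  refine lintegral_congr fun x => ?_
  rw [ENNReal.ofReal_pow (norm_nonneg _), ofReal_norm]

lemma abs_toReal_eLpNorm_sub_le {Ω : Type*} [MeasurableSpace Ω] {μ : Measure Ω} {U V : Ω → ℂ}
    (hU : MemLp U 2 μ) (hV : MemLp V 2 μ) :
    |(eLpNorm U 2 μ).toReal - (eLpNorm V 2 μ).toReal| ≤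
      (eLpNorm (fun x => U x - V x) 2 μ).toReal := by
  have := abs_norm_sub_norm_le (hU.toLp U) (hV.toLp V)
  rwa [← MemLp.toLp_sub, Lp.norm_toLp, Lp.norm_toLp, Lp.norm_toLp] at this

/-! ### Quenched convergence and the main theorem. -/

section Quenched

variable {Ω : Type*} {F₀ : MeasurableSpace Ω} [mΩ : MeasurableSpace Ω] {P : Measure Ω}
  [IsProbabilityMeasure P] {κ : Ω → Measure Ω} {S : Ω → Ω} {c : ℂ} {f : Ω → ℂ}

/-- The approximation is used twice with the same martingales: in `L²(P)` it yields the convergence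
of their norms to `σ`, in `L²(κ ω)` the convergence of characteristic functions. -/
lemma IsRegularCondProb.exists_tendsto_charFun_twistSum (hκ : IsRegularCondProb F₀ P κ)
    (hF₀ : F₀ ≤ mΩ) (hS : Ergodic S P) (hSF : F₀ ≤ F₀.comap S) (hc : ‖c‖ = 1)
    (heig : ¬ (koopman hS.toMeasurePreserving).HasEigenvalue (c ^ 2)⁻¹)
    (hf : StronglyMeasurable[F₀] f) (hf2 : MemLp f 2 P)
    (hMW : Summable fun k : ℕ => 1 / ((k + 1 : ℕ) : ℝ) ^ (3 / 2 : ℝ) *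
      (eLpNorm (P[fun x => c * twistSum S c (k + 1) f (S x) | F₀]) 2 P).toReal) :
    ∃ σ : ℝ, Tendsto (fun n : ℕ => (eLpNorm (fun x => c * twistSum S c n f (S x)) 2 P).toReal / √n)
        atTop (𝓝 σ) ∧
      ∀ᵐ ω ∂P, ∀ θ : ℂ, Tendsto (fun n : ℕ => ∫ x, Complex.exp (Complex.I *
        ((((starRingEnd ℂ) θ * (c * twistSum S c n f (S x))).re / √n : ℝ) : ℂ)) ∂κ ω) atTop
        (𝓝 (Complex.exp ((-(‖θ‖ ^ 2 * (σ ^ 2 / 2)) / 2 : ℝ) : ℂ))) := by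
  have hmp := hS.toMeasurePreserving
  have hle := comap_le_of_measurable hF₀ hmp.measurable
  let ε : ℕ → ℝ := fun m => (1 / 2) ^ m
  have hε : ∀ m, 0 < ε m := fun m => by positivity
  have hε0 : Tendsto ε atTop (𝓝 0) :=
    tendsto_pow_atTop_nhds_zero_of_lt_one (by norm_num) (by norm_num)
  choose w B H C hw hB hw0 hHm hH hq ha using fun m =>
    hκ.exists_martingale_approx hF₀ hmp hSF hc hf hf2 hMW (hε m)
  have hwm : ∀ m, StronglyMeasurable (w m) := fun m => (hw m).mono hle
  have hw2 : ∀ m, MemLp (w m) 2 P := fun m =>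
    MemLp.of_bound (hwm m).aestronglyMeasurable (B m) (ae_of_all _ (hB m))
  have hSum : ∀ n, StronglyMeasurable fun x => c * twistSum S c n f (S x) := fun n =>
    ((StronglyMeasurable.twistSum_of_measurable hmp.measurable (hf.mono hF₀) n).comp_measurable
      hmp.measurable).const_mul c
  have hSum2 : ∀ n, MemLp (fun x => c * twistSum S c n f (S x)) 2 P := fun n =>
    ((MemLp.twistSum hmp hf2 n).comp_measurePreserving hmp).const_mul c
  have hMart : ∀ m n, StronglyMeasurable (twistSum S c n (w m)) := fun m n =>
    StronglyMeasurable.twistSum_of_measurable hmp.measurable (hwm m) n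
  let s : ℕ → ℝ := fun m => (eLpNorm (w m) 2 P).toReal
  -- By orthogonality the normalized martingale has norm exactly `s m` for every `n > 0`. The `3` is
  -- the `2` of `eventually_toReal_div_sqrt_le` plus one `ε m` for the fixed term.
  have hann : ∀ m, ∀ᶠ n : ℕ in atTop,
      dist ((eLpNorm (fun x => c * twistSum S c n f (S x)) 2 P).toReal / √n) (s m) ≤ 3 * ε m := by
    intro m
    have hCf : (C m : ℝ≥0∞) + eLpNorm f 2 P ≠ ∞ :=
      ENNReal.add_ne_top.2 ⟨ENNReal.coe_ne_top, hf2.eLpNorm_ne_top⟩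
    filter_upwards [eventually_toReal_div_sqrt_le ENNReal.ofReal_ne_top hCf (ha m) (hε m),
      eventually_gt_atTop 0] with n hn hn0
    have hsn : 0 < √(n : ℝ) := Real.sqrt_pos.2 (by exact_mod_cast hn0)
    have h1 : s m = (eLpNorm (twistSum S c n (w m)) 2 P).toReal / √n := by
      have h2 := congrArg ENNReal.toReal
        (hκ.eLpNorm_twistSum_martingale hF₀ hmp hSF (hw m) (hw2 m) (hw0 m) hc n)
      rw [ENNReal.toReal_pow, ENNReal.toReal_mul, ENNReal.toReal_pow, ENNReal.toReal_natCast] at h2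
      rw [eq_div_iff hsn.ne', ← sq_eq_sq₀ (by positivity) (by positivity), h2, mul_pow,
        Real.sq_sqrt (by positivity), mul_comm]
    rw [h1, Real.dist_eq, ← sub_div, abs_div, abs_of_pos hsn]
    rw [ENNReal.toReal_ofReal (hε m).le] at hn
    calc _ ≤ (eLpNorm (fun x => c * twistSum S c n f (S x) - twistSum S c n (w m) x) 2 P).toReal /
          √n := by
          gcongr
          exact abs_toReal_eLpNorm_sub_le (hSum2 n) (MemLp.twistSum hmp (hw2 m) n)
      _ ≤ _ := by linarith
  obtain ⟨σ, hσ, hx⟩ := exists_tendsto_of_eventually_dist_le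
    (by simpa using hε0.const_mul 3) hann
  refine ⟨σ, hx, ?_⟩
  -- The summable choice `ε m = 2^{-m}` makes `H m ω → 0` for almost every `ω` along the whole
  -- sequence.
  have hHsum : ∀ᵐ ω ∂P, ∑' m, H m ω ≠ ∞ := by
    have h1 : ∫⁻ ω, ∑' m, H m ω ∂P ≠ ∞ := by
      rw [lintegral_tsum fun m => (hHm m).aemeasurable]
      refine ne_top_of_le_ne_top ?_ (ENNReal.tsum_le_tsum hH)
      exact (summable_geometric_of_lt_one (by norm_num) (by norm_num)).tsum_ofReal_ne_top
    exact (ae_lt_top (Measurable.tsum hHm) h1).mono fun ω h => h.ne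
  have hs2 : ∀ m, ∫ x, ((‖w m x‖ ^ 2 : ℝ) : ℂ) ∂P = ((s m ^ 2 : ℝ) : ℂ) := fun m => by
    rw [integral_complex_ofReal]
    congr 1
    exact (toReal_eLpNorm_two_sq (hwm m).aestronglyMeasurable).symm
  have hcf : ∀ᵐ ω ∂P, ∀ m, ∀ θ : ℂ, Tendsto (fun n : ℕ => ∫ x, Complex.exp (Complex.I *
      ((((starRingEnd ℂ) θ * twistSum S c n (w m) x).re / √n : ℝ) : ℂ)) ∂κ ω) atTop
      (𝓝 (Complex.exp ((-(‖θ‖ ^ 2 * s m ^ 2 / 2) / 2 : ℝ) : ℂ))) := by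
    rw [ae_all_iff]
    intro m
    refine hκ.ae_tendsto_integral_exp_twistSum hF₀ hmp hSF (hw m) (hB m) (hw0 m) hc ?_ ?_
    · rw [← hs2 m]
      refine hS.ae_tendsto_twistSum_one (K := B m ^ 2)
        (Complex.continuous_ofReal.comp_stronglyMeasurable ((hwm m).norm.pow 2)) fun x => ?_
      rw [Complex.norm_real, Real.norm_of_nonneg (by positivity)]
      gcongr
      exact hB m x
    · refine Ergodic.ae_tendsto_twistSum_of_not_hasEigenvalue hmp (K := B m ^ 2)
        (by rw [norm_pow, hc, one_pow]) heig ((hwm m).pow 2) fun x => ?_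
      rw [norm_pow]
      gcongr
      exact hB m x
  filter_upwards [hHsum, hcf, ae_all_iff.2 hq, hκ.ae_memLp hF₀ (hf.mono hF₀) hf2]
    with ω h1 h2 h3 h4 θ
  have := hκ.isProbabilityMeasure ω
  have hH0 : Tendsto (fun m => (H m ω).toReal) atTop (𝓝 0) := by
    have := ENNReal.tendsto_atTop_zero_of_tsum_ne_top h1
    simpa [Function.comp_def] using (ENNReal.tendsto_toReal ENNReal.zero_ne_top).comp this
  have hHt : ∀ m, H m ω ≠ ∞ := ENNReal.ne_top_of_tsum_ne_top h1
  refine tendsto_of_eventually_dist_le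
    (y := fun m => Complex.exp ((-(‖θ‖ ^ 2 * s m ^ 2 / 2) / 2 : ℝ) : ℂ))
    (ε := fun m => ‖θ‖ * (2 * (H m ω).toReal + ε m) + ε m) ?_ (fun m => ?_) ?_
  · simpa using (((hH0.const_mul 2).add hε0).const_mul ‖θ‖).add hε0
  · have hCf : (C m : ℝ≥0∞) + eLpNorm f 2 (κ ω) ≠ ∞ :=
      ENNReal.add_ne_top.2 ⟨ENNReal.coe_ne_top, h4.eLpNorm_ne_top⟩
    filter_upwards [eventually_toReal_div_sqrt_le (hHt m) hCf (h3 m) (hε m),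
      Metric.tendsto_nhds.1 (h2 m θ) _ (hε m)] with n hn1 hn2
    refine (dist_triangle _ _ _).trans (add_le_add ?_ hn2.le)
    rw [dist_eq_norm]
    refine (norm_integral_exp_sub_le (hSum n) (hMart m n) ?_ θ _ (Real.sqrt_nonneg _)).trans ?_
    · exact ne_top_of_le_ne_top (ENNReal.add_ne_top.2
        ⟨ENNReal.mul_ne_top ENNReal.ofReal_ne_top (hHt m), hCf⟩) (h3 m n)
    · gcongr
  · have hcont : Continuous fun r : ℝ => Complex.exp ((-(‖θ‖ ^ 2 * r ^ 2 / 2) / 2 : ℝ) : ℂ) := by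
      fun_prop
    have := (hcont.tendsto σ).comp hσ
    rwa [mul_div_assoc] at this

end Quenched

theorem theorem3 {Ω : Type*} (F₀ : MeasurableSpace Ω) [mΩ : MeasurableSpace Ω]
    (P : Measure Ω) [IsProbabilityMeasure P]
    (T : Ω ≃ᵐ Ω) (hT : Ergodic T P)
    (hF₀ : F₀ ≤ mΩ) (hTF₀ : F₀ ≤ F₀.comap T)
    (κ : Ω → Measure Ω) (hκ : IsRegularCondProb F₀ P κ)
    (X₀ : Ω → ℝ) (hX₀ : Measurable[F₀] X₀) (hX₀_sq : MemLp X₀ 2 P) (hX₀_mean : ∫ ω, X₀ ω ∂P = 0)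
    (t : ℝ) (ht : t ∈ Set.Ioo 0 (2 * Real.pi))
    (ht_eig : ¬ (koopman hT.toMeasurePreserving).HasEigenvalue
      (Complex.exp (-2 * Complex.I * (t : ℂ))))
    (hMW : Summable fun k : ℕ =>
      1 / ((k + 1 : ℕ) : ℝ) ^ (3 / 2 : ℝ) *
        (eLpNorm (P[fourierSum T X₀ t (k + 1) | F₀]) 2 P).toReal) :
    ∃ σsq : ℝ≥0,
      Tendsto (fun n : ℕ => (∫ ω, ‖fourierSum T X₀ t n ω‖ ^ 2 ∂P) / n) atTop (𝓝 (σsq : ℝ)) ∧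
      ∀ᵐ ω ∂P, ∀ g : (ℝ × ℝ) →ᵇ ℝ,
        Tendsto (fun n : ℕ => ∫ ω', g (normalizedFourier T X₀ t n ω') ∂(κ ω)) atTop
          (𝓝 (∫ x, g x ∂((gaussianReal 0 (σsq / 2)).prod (gaussianReal 0 (σsq / 2))))) := by
  have hc : ‖Complex.exp (Complex.I * t)‖ = 1 := by rw [mul_comm, Complex.norm_exp_ofReal_mul_I]
  have hS : ∀ n, fourierSum T X₀ t n = fun x => Complex.exp (Complex.I * t) *
      twistSum T (Complex.exp (Complex.I * t)) n (fun x => (X₀ x : ℂ)) (T x) := fun n =>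
    funext (fourierSum_eq_twistSum T X₀ t n)
  have hf : StronglyMeasurable[F₀] fun x => (X₀ x : ℂ) :=
    Complex.continuous_ofReal.comp_stronglyMeasurable hX₀.stronglyMeasurable
  have hf2 : MemLp (fun x => (X₀ x : ℂ)) 2 P := hX₀_sq.ofReal
  have hmeas : ∀ n, Measurable (fourierSum T X₀ t n) := fun n => by
    rw [hS n]
    exact ((StronglyMeasurable.twistSum_of_measurable T.measurable (hf.mono hF₀)
      n).measurable.comp T.measurable).const_mul _
  have heig : (Complex.exp (Complex.I * t) ^ 2)⁻¹ = Complex.exp (-2 * Complex.I * t) := by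
    rw [← Complex.exp_nat_mul, ← Complex.exp_neg]
    congr 1
    push_cast
    ring
  rw [← heig] at ht_eig
  simp_rw [hS] at hMW
  obtain ⟨σ, hσ, hq⟩ := hκ.exists_tendsto_charFun_twistSum hF₀ hT hTF₀ hc ht_eig hf hf2 hMW
  -- `σ` is the limit of the norms divided by `√n`, so its square is the limit of the second moments
  -- divided by `n`.
  refine ⟨⟨σ ^ 2, sq_nonneg σ⟩, ?_, ?_⟩
  · refine (hσ.pow 2).congr fun n => ?_
    rw [← hS n, div_pow, Real.sq_sqrt (by positivity),
      toReal_eLpNorm_two_sq (hmeas n).aestronglyMeasurable]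
  · filter_upwards [hq] with ω hω g
    have := hκ.isProbabilityMeasure ω
    refine tendsto_integral_of_tendsto_integral_exp hmeas (fun θ => ?_) g
    simp_rw [hS]
    exact hω θ
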